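/- Let $n,k\ge 0$ be integers. Write $[1,i]=\{1,\dots,i\}$, $I^{\mathrm{op}}=\{n+1-a\mid a\in I\}$, and let $\Delta_{I,J}(g)$ be the minor of $g$ with rows $I$ and columns $J$. Let $B_-\subset \mathrm{GL}_n(\mathbb C)$ be the group of invertible lower triangular matrices, $\mathrm{pr}_i\colon B_-^k\to B_-$ the $i$-th projection, and $$\Phi_{\rm BK}(g)=\sum_{i=1}^{n-1}\frac{\Delta_{([1,i+1]\setminus\{i\})^{\rm op},[1,i]}(g)+\Delta_{[1,i]^{\rm op},[1,i+1]\setminus\{i\}}(g)}{\Delta_{[1,i]^{\rm op},[1,i]}(g)} .$$ *Networks.* The standard planar network $\Pi_{\rm st}$ of rank $n$ consists of $n$ horizontal lines, numbered $1,\dots,n$ from bottom to top and oriented from left to right, with sources at the left ends and sinks at the right ends, and of slanted edges $(i,j)$, $1\le j<i\le n$, descending from line $i$ to line $i-1$; on line $l$ the ends of the slanted edges occur from left to right in the order $(l+1,1),(l,1),(l+1,2),(l,2),\dots,(l,l-1),(l+1,l)$ (edges $(l+1,\cdot)$ are absent for $l=n$). Its $d=n(n+1)/2$ essential edges are the slanted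 edges, with weights $a_{i,j}$, and the final segments of the lines $i$ (adjacent to the sinks), with weights $a_{i,i}$; all other edges carry the unit weight. Let $\theta_{\rm st}\colon(\mathbb C^*)^{d}\to B_-$ send $(a_{i,j})$ to the matrix whose $(i,j)$ entry is the sum, over the directed paths from source $i$ to sink $j$, of the products of the weights of their edges. *Functions.* For $\underline\alpha\in\mathbb Z_{\ge0}^k$ with $|\underline\alpha|:=\sum_i\alpha_i\le n$ and $g_1,\dots,g_k\in B_-$: * $M_{\underline\alpha}(g_1,\dots,g_k)$ is the $n\times n$ minor of the $n\times(k+1)n$ matrix $[\,1\mid g_1\mid g_1g_2\mid\cdots\mid g_1\cdots g_k\,]$ on the first $n-|\underline\alpha|$ columns of the block $1$ and the first $\alpha_i$ columns of the block $g_1\cdots g_i$, $i=1,\dots,k$ (the multi-corner minor); * $\displaystyle\widetilde M_{\underline\alpha}(g_1,\dots,g_k)=\sum\ \prod_{i=1}^k\Delta_{L_{i-1},\,J_i\sqcup L_i}(g_i)$, the sum being over all $L_0,\dots,L_k,J_1,\dots,J_k\subset[1,n]$ with $L_k=\emptyset$, $|J_i|=\alpha_i$, $J_i\cap L_i=\emptyset$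 and $|L_{i-1}|=|J_i|+|L_i|$. *Tropicalization.* If a function $f$ on $B_-^k$ becomes in the chart $\theta_{\rm st}^{\times k}\colon(\mathbb C^*)^{kd}\to B_-^k$ a Laurent polynomial $\sum_e c_e x^e$ with all occurring coefficients $c_e>0$, then $f$ is called positive and $f^t(w)=\max_e\langle e,w\rangle$ for $w\in\mathbb R^{kd}$ (with $f^t=-\infty$ for $f=0$). For $w=(w_1,\dots,w_k)\in\mathbb R^{kd}$ let $m_{\underline\alpha}(w)$ be the maximal weight of an $\underline\alpha$-multipath, that is, of a family of pairwise vertex-disjoint paths in the concatenation $\Pi_{\rm st}\circ\cdots\circ\Pi_{\rm st}$ ($k$ copies) consisting, for each $i$, of $\alpha_i$ paths from sources of the first copy to sinks of the $i$-th copy. Its weight is the sum of the weights of its edges, where the essential edges of the $i$-th copy have the weights $w_i$ and all other edges have weight $0$; $m_{\underline\alpha}=-\infty$ if there is no such family. **Theorem.** All functions $M_{\underline\alpha}$, $\widetilde M_{\underline\alpha}$ ($|\underline\alpha|\le n$) and $\Phi_{\rm BK}\circ\mathrm{pr}_i$ ($1\le i\le k$) are positive in the chart $\theta_{\rm st}^{\times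 k}$. For every $w\in\mathbb R^{kd}$ one has $\widetilde M_{\underline\alpha}^t(w)=m_{\underline\alpha}(w)$ for all $\underline\alpha$ with $|\underline\alpha|\le n$, and $$M_{\underline\alpha}^t(w)=\widetilde M_{\underline\alpha}^t(w)\ \text{ for all }\underline\alpha\text{ with }|\underline\alpha|\le n\quad\Longleftrightarrow\quad(\Phi_{\rm BK}\circ\mathrm{pr}_i)^t(w)\le 0\ \text{ for all }i\in[1,k].$$ -/

import Mathlib

open Finset

noncomputable section

namespace BKGZ

/-! ### Planar networks -/

/-- A planar network of rank `n`, drawn in the strip on the integer grid with columns `0, …, width`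
and levels `0, …, n - 1` (from bottom to top).  Every edge is oriented from left to right and joins
a point `(c, u)` to a point `(c + 1, v)`; the sources are the points of column `0`, the sinks are
the points of column `width`.  Subdividing a long edge by bivalent vertices changes neither the
multipaths nor, if the extra pieces carry the unit weight, their weights. -/
structure PlanarNetwork (n : ℕ) where
  width : ℕ
  IsEdge : ℕ → Fin n → Fin n → Prop
  planar : ∀ c u v u' v', IsEdge c u v → IsEdge c u' v' → u < u' → v ≤ v'

variable {n : ℕ}

/-- The levels of an oriented path from a source to a sink. -/
def PlanarNetwork.IsPath (N : PlanarNetwork n) (p : Fin (N.width + 1) → Fin n) : Prop :=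
  ∀ c : Fin N.width, N.IsEdge c (p c.castSucc) (p c.succ)

/-- The weight of a path, for weights `w c u v` of the edges `(c, u) ⟶ (c + 1, v)` in a
multiplicative monoid. -/
def PlanarNetwork.pathWeight {R : Type*} [CommMonoid R] (N : PlanarNetwork n)
    (w : ℕ → Fin n → Fin n → R) (p : Fin (N.width + 1) → Fin n) : R :=
  ∏ c : Fin N.width, w c (p c.castSucc) (p c.succ)

open Classical in
/-- The correspondence map: the `(i, j)` entry is the sum of the weights of the paths from the
source `i` to the sink `j`. -/
def PlanarNetwork.matrix {R : Type*} [CommSemiring R] (N : PlanarNetwork n)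
    (w : ℕ → Fin n → Fin n → R) : Matrix (Fin n) (Fin n) R :=
  Matrix.of fun i j =>
    ∑ p ∈ univ.filter (fun p : Fin (N.width + 1) → Fin n =>
      N.IsPath p ∧ p 0 = i ∧ p (Fin.last _) = j), N.pathWeight w p

/-- The essential edges of the standard network: with zero-based indices, `(i, j)` with `j < i` is
the `j`-th slanted edge from level `i` down to level `i - 1`, and `(i, i)` is the horizontal edge
adjacent to the sink `i`. -/
abbrev EssEdge (n : ℕ) : Type := {x : Fin n × Fin n // x.2 ≤ x.1}

/-- The essential edge `x` is the grid edge `(c, u) ⟶ (c + 1, v)`.  The slanted edge `(i, j)` starts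
in column `2 (n - i) + 3 j`. -/
def EssEdge.Occupies (x : EssEdge n) (c : ℕ) (u v : Fin n) : Prop :=
  x.1.1 = u ∧
    ((x.1.2 < x.1.1 ∧ (v : ℕ) + 1 = u ∧ c + 2 * (u : ℕ) = 2 * n + 3 * (x.1.2 : ℕ)) ∨
      (x.1.2 = x.1.1 ∧ v = u ∧ c + 1 = 3 * n))

lemma EssEdge.Occupies.le {x : EssEdge n} {c : ℕ} {u v : Fin n} (h : x.Occupies c u v) :
    v ≤ u ∧ (u : ℕ) ≤ v + 1 := by
  obtain ⟨-, ⟨-, h, -⟩ | ⟨-, h, -⟩⟩ := h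
  · exact ⟨by rw [Fin.le_def]; omega, by omega⟩
  · subst h; exact ⟨le_rfl, by omega⟩

/-- The standard planar network: `n` horizontal lines together with the slanted edges. -/
def standardNetwork (n : ℕ) : PlanarNetwork n where
  width := 3 * n
  IsEdge c u v := u = v ∨ ∃ x : EssEdge n, x.Occupies c u v
  planar := by
    intro c u v u' v' h h' huv
    have h1 : v ≤ u := by
      rcases h with h | ⟨x, h⟩
      · exact h.ge
      · exact h.le.1
    have h2 : (u' : ℕ) ≤ v' + 1 := by
      rcases h' with h | ⟨x, h⟩
      · subst h; omega
      · exact h.le.2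
    rw [Fin.lt_def] at huv
    rw [Fin.le_def] at h1 ⊢
    omega

open Classical in
/-- The weighting of the standard network with weights `a x` on the essential edges and the unit
weight on all other edges. -/
def standardWeighting {R : Type*} [CommMonoid R] (a : EssEdge n → R) (c : ℕ) (u v : Fin n) : R :=
  ∏ x : EssEdge n, if x.Occupies c u v then a x else 1

/-! ### Maximal weights of multipaths -/

/-- The tropical numbers `ℝ ∪ {-∞}`; tropical addition is `max`, tropical multiplication is `+`. -/
abbrev Trop : Type := WithBot ℝ

/-- The tropical weight of a path. -/
def PlanarNetwork.tropWeight (N : PlanarNetwork n) (w : ℕ → Fin n → Fin n → Trop)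
    (p : Fin (N.width + 1) → Fin n) : Trop :=
  ∑ c : Fin N.width, w c (p c.castSucc) (p c.succ)

open Classical in
/-- The tropical weighting of the standard network with finite weights on the essential edges and
the unit weight `0` on all other edges. -/
def tropStandardWeighting (a : EssEdge n → ℝ) (c : ℕ) (u v : Fin n) : Trop :=
  ∑ x : EssEdge n, if x.Occupies c u v then (a x : Trop) else 0

/-- `α`-multipaths in the concatenation `N ∘ ⋯ ∘ N` of `k` copies of a network.  For each `i`, the
paths `q i a` with `a < α i` run through the first `i + 1` copies; `q i a b` is the part of the path
in copy number `b`, and consecutive parts are glued at the common sink and source.  Any two different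
paths have no vertex in common. -/
structure PlanarNetwork.IsMultipath (N : PlanarNetwork n) {k : ℕ} (α : Fin k → ℕ)
    (q : (i : Fin k) → Fin (α i) → Fin (i.val + 1) → Fin (N.width + 1) → Fin n) : Prop where
  isPath : ∀ i a b, N.IsPath (q i a b)
  glue : ∀ i a (b b' : Fin (i.val + 1)), (b' : ℕ) = b + 1 → q i a b (Fin.last _) = q i a b' 0
  disjoint : ∀ i a i' a', (⟨i, a⟩ : Σ i : Fin k, Fin (α i)) ≠ ⟨i', a'⟩ →
    ∀ (b : Fin (i.val + 1)) (b' : Fin (i'.val + 1)), (b : ℕ) = b' → ∀ c, q i a b c ≠ q i' a' b' c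

open Classical in
/-- `m_α(w₁, …, w_k)`: the maximal weight of an `α`-multipath (`-∞` if there is none). -/
def PlanarNetwork.maxWeight (N : PlanarNetwork n) {k : ℕ} (w : Fin k → ℕ → Fin n → Fin n → Trop)
    (α : Fin k → ℕ) : Trop :=
  (univ.filter fun q : (i : Fin k) → Fin (α i) → Fin (i.val + 1) → Fin (N.width + 1) → Fin n =>
    N.IsMultipath α q).sup fun q =>
      ∑ i, ∑ a, ∑ b : Fin (i.val + 1), N.tropWeight (w (Fin.castLE i.isLt b)) (q i a b)

/-! ### Minors -/

/-- The minor `Δ_{I,J}` of a matrix, rows and columns being taken in increasing order (only used for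
`I`, `J` of equal size). -/
def minor {ι κ : Type*} [LinearOrder ι] [LinearOrder κ] (A : Matrix ι κ ℂ)
    (I : Finset ι) (J : Finset κ) : ℂ :=
  if h : J.card = I.card then
    (A.submatrix (I.orderEmbOfFin rfl) (J.orderEmbOfFin h)).det
  else 0

/-- The first `i` indices `[1, i]`. -/
def initial (n i : ℕ) : Finset (Fin n) := univ.filter fun x => (x : ℕ) < i

/-- The set `[1, i + 1] ∖ {i}`. -/
def skipped (n i : ℕ) : Finset (Fin n) := univ.filter fun x => (x : ℕ) < i + 1 ∧ (x : ℕ) + 1 ≠ i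

/-- The opposite `I^op` of a set of indices. -/
def op (I : Finset (Fin n)) : Finset (Fin n) := I.image Fin.rev

/-- The Berenstein–Kazhdan potential. -/
def potential (g : GL (Fin n) ℂ) : ℂ :=
  ∑ i ∈ Icc 1 (n - 1),
    (minor g.val (op (skipped n i)) (initial n i) + minor g.val (op (initial n i)) (skipped n i)) /
      minor g.val (op (initial n i)) (initial n i)

/-- The matrix `[1 | g₁ | g₁ g₂ | ⋯ | g₁ ⋯ g_k]`, whose columns are indexed by pairs
(block, column in the block) in the lexicographic order. -/
def blockRow {k : ℕ} (g : Fin k → GL (Fin n) ℂ) :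
    Matrix (Fin n) (Fin (k + 1) ×ₗ Fin n) ℂ :=
  Matrix.of fun r x => ((List.ofFn g).take (ofLex x).1).prod.val r (ofLex x).2

/-- The columns of a multi-corner minor: the first `n - ∑ α_i` columns of block `0` and the first
`α_i` columns of block `i`, for `i = 1, …, k`. -/
def cornerColumns (n : ℕ) {k : ℕ} (α : Fin k → ℕ) : Finset (Fin (k + 1) ×ₗ Fin n) :=
  univ.filter fun x =>
    ((ofLex x).2 : ℕ) < (Fin.cons (n - ∑ i, α i) α : Fin (k + 1) → ℕ) (ofLex x).1

/-- The multi-corner minor `M_α`. -/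
def multiCorner {k : ℕ} (α : Fin k → ℕ) (g : Fin k → GL (Fin n) ℂ) : ℂ :=
  minor (blockRow g) univ (cornerColumns n α)

open Classical in
/-- The function `M̃_α`: the sum of `∏ i, Δ_{L_{i-1}, J_i ∪ L_i}(g_i)` over all sets of indices
`L_0, …, L_k` and `J_1, …, J_k` with `L_k = ∅`, `|J_i| = α_i`, `J_i ∩ L_i = ∅` and
`|L_{i-1}| = |J_i| + |L_i|`. -/
def fullMinorSum {k : ℕ} (α : Fin k → ℕ) (g : Fin k → GL (Fin n) ℂ) : ℂ :=
  ∑ s ∈ univ.filter (fun s : (Fin (k + 1) → Finset (Fin n)) × (Fin k → Finset (Fin n)) =>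
      s.1 (Fin.last k) = ∅ ∧
        ∀ i : Fin k, (s.2 i).card = α i ∧ Disjoint (s.2 i) (s.1 i.succ) ∧
          (s.1 i.castSucc).card = (s.2 i).card + (s.1 i.succ).card),
    ∏ i : Fin k, minor (g i).val (s.1 i.castSucc) (s.2 i ∪ s.1 i.succ)

/-! ### The standard chart -/

/-- `B₋`, the invertible lower triangular matrices. -/
def BMinus (n : ℕ) : Set (GL (Fin n) ℂ) := {g | ∀ i j : Fin n, i < j → g.val i j = 0}

lemma standardNetwork_antitone {p : Fin ((standardNetwork n).width + 1) → Fin n}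
    (hp : (standardNetwork n).IsPath p) : Antitone p := by
  refine Fin.antitone_iff_succ_le.2 fun c => ?_
  rcases hp c with h | ⟨x, h⟩
  · exact h.ge
  · exact h.le.1

lemma standardWeighting_ne_zero (a : EssEdge n → ℂˣ) (c : ℕ) (u v : Fin n) :
    standardWeighting (fun x => (a x : ℂ)) c u v ≠ 0 := by
  unfold standardWeighting
  refine prod_ne_zero_iff.2 fun x _ => ?_
  split_ifs
  · exact (a x).ne_zero
  · exact one_ne_zero

lemma standardMatrix_lower (a : EssEdge n → ℂˣ) (i j : Fin n) (hij : i < j) :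
    (standardNetwork n).matrix (standardWeighting fun x => (a x : ℂ)) i j = 0 := by
  classical
  simp only [PlanarNetwork.matrix, Matrix.of_apply]
  refine sum_eq_zero fun p hp => ?_
  obtain ⟨h, rfl, rfl⟩ := (mem_filter.1 hp).2
  exact absurd (standardNetwork_antitone h (Fin.zero_le _)) (not_le.2 hij)

lemma standardMatrix_diag (a : EssEdge n → ℂˣ) (i : Fin n) :
    (standardNetwork n).matrix (standardWeighting fun x => (a x : ℂ)) i i ≠ 0 := by
  classical
  simp only [PlanarNetwork.matrix, Matrix.of_apply]
  rw [sum_eq_single (fun _ => i)]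
  · exact prod_ne_zero_iff.2 fun c _ => standardWeighting_ne_zero a _ _ _
  · intro p hp hne
    obtain ⟨h, h0, hl⟩ := (mem_filter.1 hp).2
    refine absurd (funext fun c => le_antisymm ?_ ?_) hne
    · exact h0 ▸ standardNetwork_antitone h (Fin.zero_le c)
    · have := standardNetwork_antitone h (Fin.le_last c)
      rwa [hl] at this
  · intro h
    exact absurd (mem_filter.2 ⟨mem_univ _, fun _ => Or.inl rfl, rfl, rfl⟩) h

lemma standardMatrix_det (a : EssEdge n → ℂˣ) :
    ((standardNetwork n).matrix (standardWeighting fun x => (a x : ℂ))).det ≠ 0 := by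
  rw [Matrix.det_of_isLowerTriangular _ fun i j h => standardMatrix_lower a i j h]
  exact prod_ne_zero_iff.2 fun i _ => standardMatrix_diag a i

/-- The chart `θ_st`, which sends nonzero weights of the essential edges to the matrix of the
standard network. -/
def standardChart (a : EssEdge n → ℂˣ) : BMinus n :=
  ⟨Matrix.GeneralLinearGroup.mkOfDetNeZero _ (standardMatrix_det a),
    fun i j h => standardMatrix_lower a i j h⟩

/-- The product chart `θ_st × ⋯ × θ_st` on `B₋^k`. -/
def standardChartPow {k : ℕ} (a : Fin k × EssEdge n → ℂˣ) : Fin k → BMinus n :=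
  fun i => standardChart fun x => a (i, x)

/-! ### Tropicalization -/

section Tropicalization

variable {σ P : Type*} [Fintype σ]

/-- The Laurent polynomial with exponents `e ∈ ℤ^σ` and coefficients `L e` has positive coefficients
and expresses the function `f` in the chart `θ`. -/
def IsPositiveExpression (θ : (σ → ℂˣ) → P) (f : P → ℂ) (L : (σ → ℤ) →₀ ℝ) : Prop :=
  (∀ e ∈ L.support, 0 < L e) ∧
    ∀ x : σ → ℂˣ, f (θ x) = L.sum fun e c => (c : ℂ) * ((∏ s, x s ^ e s : ℂˣ) : ℂ)

/-- In the chart `θ`, the function `f` is a Laurent polynomial with positive coefficients. -/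
def IsPositive (θ : (σ → ℂˣ) → P) (f : P → ℂ) : Prop :=
  ∃ L, IsPositiveExpression θ f L

/-- The positive Laurent polynomial of a function in a chart is unique. -/
lemma IsPositiveExpression.unique {θ : (σ → ℂˣ) → P} {f : P → ℂ} {L L' : (σ → ℤ) →₀ ℝ}
    (h : IsPositiveExpression θ f L) (h' : IsPositiveExpression θ f L') : L = L' := by
  classical
  let χ : (σ → ℤ) → ((σ → ℂˣ) →* ℂ) := fun e =>
    (Units.coeHom ℂ).comp
      { toFun := fun x => ∏ s, x s ^ e s
        map_one' := by simp
        map_mul' := fun x y => by simp [mul_zpow, prod_mul_distrib] }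
  have hχ : Function.Injective χ := by
    intro e e' hee
    funext s
    have h2 : (2 : ℂ) ≠ 0 := two_ne_zero
    have := DFunLike.congr_fun hee (Pi.mulSingle s (Units.mk0 2 h2))
    have key : ∀ e : σ → ℤ, χ e (Pi.mulSingle s (Units.mk0 2 h2)) = (2 : ℂ) ^ e s := by
      intro e
      have : ∏ t, (Pi.mulSingle s (Units.mk0 2 h2) : σ → ℂˣ) t ^ e t = Units.mk0 2 h2 ^ e s := by
        rw [prod_eq_single s]
        · simp
        · intro t _ hts
          simp [Pi.mulSingle_eq_of_ne hts]
        · simp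
      change ((∏ t, (Pi.mulSingle s (Units.mk0 2 h2) : σ → ℂˣ) t ^ e t : ℂˣ) : ℂ) = _
      rw [this]
      simp
    rw [key, key] at this
    have h3 : (2 : ℝ) ^ e s = (2 : ℝ) ^ e' s := by
      apply Complex.ofReal_injective
      push_cast
      exact this
    exact zpow_right_injective₀ (by norm_num) (by norm_num) h3
  have hli : LinearIndependent ℂ (fun e => (χ e : (σ → ℂˣ) → ℂ)) :=
    (linearIndependent_monoidHom (σ → ℂˣ) ℂ).comp χ hχ
  have hinj := hli.finsuppLinearCombination_injective
  let toC : ((σ → ℤ) →₀ ℝ) → ((σ → ℤ) →₀ ℂ) := fun L => L.mapRange (fun r : ℝ => (r : ℂ)) (by simp)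
  have hval : ∀ L : (σ → ℤ) →₀ ℝ, IsPositiveExpression θ f L →
      Finsupp.linearCombination ℂ (fun e => (χ e : (σ → ℂˣ) → ℂ)) (toC L) = fun x => f (θ x) := by
    intro L hL
    funext x
    rw [hL.2 x, Finsupp.linearCombination_apply, Finsupp.sum_mapRange_index (by simp)]
    simp only [Finsupp.sum, Finset.sum_apply, Pi.smul_apply, smul_eq_mul]
    rfl
  have := hinj ((hval L h).trans (hval L' h').symm)
  ext e
  have h4 := DFunLike.congr_fun this e
  simpa [toC] using h4

/-- The tropical value of a positive Laurent polynomial at `w ∈ ℝ^σ`: the maximum of the linear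
forms `∑ s, e s * w s` over the exponents `e` that occur (`-∞` for the zero polynomial). -/
def tropValue (L : (σ → ℤ) →₀ ℝ) (w : σ → ℝ) : Trop :=
  L.support.sup fun e => ((∑ s, (e s : ℝ) * w s : ℝ) : Trop)

open Classical in
/-- The tropicalization `f^t` of a function that is a positive Laurent polynomial in the chart `θ`
(with the value `-∞` assigned to all other functions). -/
def tropicalization (θ : (σ → ℂˣ) → P) (f : P → ℂ) (w : σ → ℝ) : Trop :=
  if h : IsPositive θ f then tropValue h.choose w else ⊥

end Tropicalization

end BKGZ

end

/-! All minors are evaluated by one subtraction-free recursion. Since far-apart slanted edges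
commute, the network matrix is B_0 B_1 ⋯ B_{n-1} D, where B_r collects the slanted edges with second
index r and D is diagonal (`standardNetwork_matrix_eq`). Multiplying on the left by the elementary
matrix of an edge adds to a minor at most one term, in which a row index drops by one. A minor is
thus a partition function of particles that jump down one level at a time
(`minor_prod_slantedEdges`); it is positive, and its tropicalization is the same recursion in (max,
+) (`posTrop_minor`). `PosTrop` carries a function together with its tropical value, and
`PosTrop.unique` says that every positive expression gives the same value.

Cauchy–Binet and the elimination of unit columns show that M_α is the part of the sum M̃_α with J_i
= [1, α_i] and L_0 the last |α| indices (`multiCorner_eq_sum`); hence M_α^t ≤ M̃_α^t always.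
Evaluating minors column by column identifies tropical minors with maximal families of disjoint
paths (`tropMinor_eq_sup_chains`), and gluing such families over the copies gives M̃_α^t = m_α
(`maxWeight_eq_fullVal`).

The corner minors in the denominators of the potential are monomials (`tailVal_corner`). So the
tropical potential is nonpositive exactly when each corner minor tropically dominates its two
neighbours in the numerators. The heart of the proof is a pair of exchange inequalities,
`left_exchange` and `right_exchange`: in the product of an arbitrary minor and a corner minor, one
may raise a row index (or lower a column index) of the first by one at the cost of replacing the
second by its neighbour. If the potential is nonpositive, the finite corner term cancels, and
tropical minors increase when rows move up and columns move down.

In a term of M̃_α one then replaces each L_i with i ≥ 1 by the largest |L_i| elements of J_i ∪ L_i,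
J_i by an initial segment and L_0 by a final one. No factor decreases, and the result is a term of
M_α (`termVal_le_cornerVal`). Conversely, an α supported on the indices j - 1 and j isolates the
j-th factor; equality then makes the corner minor maximal among all minors of its size
(`tropMinor_le_corner`), which contains the inequalities of the potential. -/

noncomputable section

namespace BKGZ

/-! ### Sums of positive Laurent monomials -/

section PosTrop

variable {σ : Type*} [Fintype σ]

/-- `F` is a sum of Laurent monomials with positive coefficients, and `τ` is its tropicalization. -/
def PosTrop (F : (σ → ℂˣ) → ℂ) (τ : (σ → ℝ) → Trop) : Prop :=
  ∃ (ι : Type) (_ : Fintype ι) (e : ι → σ → ℤ) (c : ι → ℝ), (∀ i, 0 < c i) ∧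
    (∀ x, F x = ∑ i, (c i : ℂ) * ((∏ s, x s ^ e i s : ℂˣ) : ℂ)) ∧
    ∀ w, τ w = univ.sup fun i => ((∑ s, (e i s : ℝ) * w s : ℝ) : Trop)

lemma PosTrop.congr {F F' : (σ → ℂˣ) → ℂ} {τ τ' : (σ → ℝ) → Trop} (h : PosTrop F τ)
    (hF : ∀ x, F' x = F x) (hτ : ∀ w, τ' w = τ w) : PosTrop F' τ' := by
  rwa [funext hF, funext hτ]

lemma posTrop_zero : PosTrop (fun _ : σ → ℂˣ => 0) (fun _ => ⊥) :=
  ⟨Empty, inferInstance, Empty.elim, Empty.elim, fun i => i.elim, by simp, by simp⟩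

lemma posTrop_monomial (e : σ → ℤ) :
    PosTrop (fun x : σ → ℂˣ => ((∏ s, x s ^ e s : ℂˣ) : ℂ))
      (fun w => ((∑ s, (e s : ℝ) * w s : ℝ) : Trop)) :=
  ⟨Unit, inferInstance, fun _ => e, fun _ => 1, fun _ => one_pos, by simp, by simp⟩

lemma posTrop_one : PosTrop (fun _ : σ → ℂˣ => 1) (fun _ => 0) :=
  (posTrop_monomial (0 : σ → ℤ)).congr (by simp) (by simp)

lemma posTrop_coord (s : σ) : PosTrop (fun x : σ → ℂˣ => (x s : ℂ)) (fun w => (w s : Trop)) := by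
  classical
  refine (posTrop_monomial (Pi.single s 1 : σ → ℤ)).congr (fun x => ?_) fun w => ?_
  · rw [prod_eq_single s (fun t _ h => by simp [h]) (by simp)]
    simp
  · rw [sum_eq_single s (fun t _ h => by simp [h]) (by simp)]
    simp

lemma PosTrop.add {F G : (σ → ℂˣ) → ℂ} {τ υ : (σ → ℝ) → Trop} (h : PosTrop F τ)
    (h' : PosTrop G υ) : PosTrop (fun x => F x + G x) (fun w => τ w ⊔ υ w) := by
  obtain ⟨ι, _, e, c, hc, hF, hτ⟩ := h
  obtain ⟨κ, _, e', c', hc', hG, hυ⟩ := h'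
  refine ⟨ι ⊕ κ, inferInstance, Sum.elim e e', Sum.elim c c', ?_, fun x => ?_, fun w => ?_⟩
  · rintro (i | i) <;> simp [hc, hc']
  · simp [hF, hG]
  · beta_reduce
    rw [hτ, hυ]
    refine le_antisymm (sup_le ?_ ?_) ?_
    · exact Finset.sup_le fun i _ => le_sup_of_le (mem_univ (Sum.inl i)) le_rfl
    · exact Finset.sup_le fun i _ => le_sup_of_le (mem_univ (Sum.inr i)) le_rfl
    · refine Finset.sup_le fun i _ => ?_
      rcases i with i | i
      · exact le_sup_of_le_left (le_sup (f := fun i => ((∑ s, (e i s : ℝ) * w s : ℝ) : Trop))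
          (mem_univ i))
      · exact le_sup_of_le_right (le_sup (f := fun i => ((∑ s, (e' i s : ℝ) * w s : ℝ) : Trop))
          (mem_univ i))

lemma sup_add_sup_prod {ι κ : Type*} [Fintype ι] [Fintype κ] (f : ι → Trop) (g : κ → Trop) :
    (univ.sup fun p : ι × κ => f p.1 + g p.2) = univ.sup f + univ.sup g := by
  refine le_antisymm (Finset.sup_le fun p _ => add_le_add (le_sup (mem_univ _)) (le_sup (mem_univ _)))
    ?_
  rcases isEmpty_or_nonempty ι with hι | hι
  · simp
  rcases isEmpty_or_nonempty κ with hκ | hκ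
  · simp
  obtain ⟨i, -, hi⟩ := exists_mem_eq_sup univ univ_nonempty f
  obtain ⟨j, -, hj⟩ := exists_mem_eq_sup univ univ_nonempty g
  rw [hi, hj]
  exact le_sup (f := fun p : ι × κ => f p.1 + g p.2) (mem_univ (i, j))

lemma PosTrop.mul {F G : (σ → ℂˣ) → ℂ} {τ υ : (σ → ℝ) → Trop} (h : PosTrop F τ)
    (h' : PosTrop G υ) : PosTrop (fun x => F x * G x) (fun w => τ w + υ w) := by
  obtain ⟨ι, _, e, c, hc, hF, hτ⟩ := h
  obtain ⟨κ, _, e', c', hc', hG, hυ⟩ := h'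
  refine ⟨ι × κ, inferInstance, fun p => e p.1 + e' p.2, fun p => c p.1 * c' p.2,
    fun p => mul_pos (hc _) (hc' _), fun x => ?_, fun w => ?_⟩
  · beta_reduce
    rw [hF, hG, sum_mul_sum, ← sum_product', univ_product_univ]
    refine sum_congr rfl fun p _ => ?_
    simp only [Pi.add_apply, zpow_add, prod_mul_distrib]
    push_cast
    ring
  · beta_reduce
    rw [hτ, hυ, ← sup_add_sup_prod]
    refine congrArg _ (funext fun p => ?_)
    rw [← WithBot.coe_add, ← sum_add_distrib]
    simp [add_mul]

lemma PosTrop.sum {ι : Type*} (s : Finset ι) {F : ι → (σ → ℂˣ) → ℂ} {τ : ι → (σ → ℝ) → Trop}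
    (h : ∀ i ∈ s, PosTrop (F i) (τ i)) :
    PosTrop (fun x => ∑ i ∈ s, F i x) (fun w => s.sup fun i => τ i w) := by
  classical
  induction s using Finset.induction_on with
  | empty => simpa using posTrop_zero
  | insert a s ha ih =>
    simp only [sum_insert ha, sup_insert]
    exact (h a (mem_insert_self _ _)).add (ih fun i hi => h i (mem_insert_of_mem hi))

lemma PosTrop.prod {ι : Type*} (s : Finset ι) {F : ι → (σ → ℂˣ) → ℂ} {τ : ι → (σ → ℝ) → Trop}
    (h : ∀ i ∈ s, PosTrop (F i) (τ i)) :
    PosTrop (fun x => ∏ i ∈ s, F i x) (fun w => ∑ i ∈ s, τ i w) := by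
  classical
  induction s using Finset.induction_on with
  | empty => simpa using posTrop_one
  | insert a s ha ih =>
    simp only [prod_insert ha, sum_insert ha]
    exact (h a (mem_insert_self _ _)).mul (ih fun i hi => h i (mem_insert_of_mem hi))

/-- Different indices may carry the same exponent, but positive coefficients cannot cancel. The
collected polynomial therefore has all occurring exponents in its support, and collecting terms does
not change the maximum. -/
lemma PosTrop.exists_isPositiveExpression {P : Type*} {θ : (σ → ℂˣ) → P} {f : P → ℂ}
    {τ : (σ → ℝ) → Trop} (h : PosTrop (fun x => f (θ x)) τ) :
    ∃ L, IsPositiveExpression θ f L ∧ ∀ w, tropValue L w = τ w := by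
  classical
  obtain ⟨ι, _, e, c, hc, hF, hτ⟩ := h
  have hL : ∀ a, (∑ i, Finsupp.single (e i) (c i)) a = ∑ i, if e i = a then c i else 0 := by
    intro a
    simp [Finsupp.finsetSum_apply, Finsupp.single_apply]
  have hnn : ∀ a i, 0 ≤ if e i = a then c i else 0 := by
    intro a i
    split_ifs
    exacts [(hc i).le, le_rfl]
  have hsupp : (∑ i, Finsupp.single (e i) (c i)).support = univ.image e := by
    ext a
    rw [Finsupp.mem_support_iff, hL, Ne, sum_eq_zero_iff_of_nonneg fun i _ => hnn a i]
    simp only [mem_univ, true_imp_iff, mem_image, true_and, not_forall]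
    refine exists_congr fun i => ?_
    by_cases hi : e i = a
    · simp [hi, (hc i).ne']
    · simp [hi]
  refine ⟨∑ i, Finsupp.single (e i) (c i), ⟨fun a ha => ?_, fun x => ?_⟩, fun w => ?_⟩
  · rw [Finsupp.mem_support_iff] at ha
    refine lt_of_le_of_ne ?_ (Ne.symm ha)
    rw [hL]
    exact sum_nonneg fun i _ => hnn a i
  · rw [show f (θ x) = _ from hF x, ← Finsupp.sum_finsetSum_index (by simp) (by intros; push_cast; ring)]
    exact sum_congr rfl fun i _ => by rw [Finsupp.sum_single_index (by simp)]
  · rw [hτ, tropValue, hsupp, sup_image]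
    rfl

lemma PosTrop.isPositive {P : Type*} {θ : (σ → ℂˣ) → P} {f : P → ℂ}
    {τ : (σ → ℝ) → Trop} (h : PosTrop (fun x => f (θ x)) τ) : IsPositive θ f :=
  let ⟨L, hL, _⟩ := h.exists_isPositiveExpression
  ⟨L, hL⟩

lemma PosTrop.tropicalization_eq {P : Type*} {θ : (σ → ℂˣ) → P} {f : P → ℂ}
    {τ : (σ → ℝ) → Trop} (h : PosTrop (fun x => f (θ x)) τ) (w : σ → ℝ) :
    tropicalization θ f w = τ w := by
  obtain ⟨L, hL, hτ⟩ := h.exists_isPositiveExpression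
  have hp : IsPositive θ f := ⟨L, hL⟩
  rw [tropicalization, dif_pos hp, hp.choose_spec.unique hL, hτ]

/-- Turns two positive evaluations of one function into an identity of (max, +) expressions, without
any combinatorial bijection. -/
lemma PosTrop.unique {F : (σ → ℂˣ) → ℂ} {τ υ : (σ → ℝ) → Trop} (h : PosTrop F τ)
    (h' : PosTrop F υ) (w : σ → ℝ) : τ w = υ w := by
  rw [← PosTrop.tropicalization_eq (θ := id) (f := F) h w,
    ← PosTrop.tropicalization_eq (θ := id) (f := F) h' w]

end PosTrop

/-! ### Minors -/

section Minor

variable {ι κ μ : Type*} [LinearOrder ι] [LinearOrder κ] [LinearOrder μ]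

lemma minor_eq_det (A : Matrix ι κ ℂ) {I : Finset ι} {J : Finset κ} {m : ℕ} (hI : I.card = m)
    (hJ : J.card = m) :
    minor A I J = (A.submatrix (I.orderEmbOfFin hI) (J.orderEmbOfFin hJ)).det := by
  subst hI
  exact dif_pos hJ

lemma minor_of_card_ne (A : Matrix ι κ ℂ) {I : Finset ι} {J : Finset κ} (h : J.card ≠ I.card) :
    minor A I J = 0 :=
  dif_neg h

lemma minor_image (A : Matrix ι κ ℂ) {m : ℕ} {s : Fin m → ι} {t : Fin m → κ} (hs : StrictMono s)
    (ht : StrictMono t) :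
    minor A (univ.image s) (univ.image t) = (A.submatrix s t).det := by
  have hI : (univ.image s).card = m := by rw [card_image_of_injective _ hs.injective, card_fin]
  have hJ : (univ.image t).card = m := by rw [card_image_of_injective _ ht.injective, card_fin]
  rw [minor_eq_det A hI hJ,
    ← orderEmbOfFin_unique hI (fun x => mem_image_of_mem s (mem_univ x)) hs,
    ← orderEmbOfFin_unique hJ (fun x => mem_image_of_mem t (mem_univ x)) ht]

lemma minor_empty (A : Matrix ι κ ℂ) : minor A ∅ ∅ = 1 := by
  rw [minor_eq_det A (m := 0) rfl rfl, Matrix.det_isEmpty]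

/-! ### The Cauchy–Binet formula -/

lemma det_mul_eq_sum_functions {m : ℕ} {κ : Type*} [Fintype κ] (A : Matrix (Fin m) κ ℂ)
    (B : Matrix κ (Fin m) ℂ) :
    (A * B).det = ∑ f : Fin m → κ, (∏ i, B (f i) i) * (A.submatrix id f).det := by
  classical
  simp only [Matrix.det_apply', Matrix.mul_apply, prod_univ_sum, mul_sum, Fintype.piFinset_univ]
  rw [sum_comm]
  refine sum_congr rfl fun f _ => sum_congr rfl fun σ _ => ?_
  rw [prod_mul_distrib]
  simp only [Matrix.submatrix_apply, id]
  ring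

/-- Functions with an image of full size are the increasing enumeration of `K` composed with a
permutation. The permuted columns of `A` contribute the sign, and the sum over permutations
assembles the determinant of `B`. -/
lemma sum_functions_with_image {m : ℕ} [Fintype κ] (A : Matrix (Fin m) κ ℂ)
    (B : Matrix κ (Fin m) ℂ) {K : Finset κ} (hK : K.card = m) :
    ∑ f : Fin m → κ with univ.image f = K, (∏ i, B (f i) i) * (A.submatrix id f).det =
      (A.submatrix id (K.orderEmbOfFin hK)).det * (B.submatrix (K.orderEmbOfFin hK) id).det := by
  classical
  set e := K.orderEmbOfFin hK
  rw [Matrix.det_apply' (B.submatrix e id), mul_sum]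
  symm
  refine sum_bij (fun (π : Equiv.Perm (Fin m)) _ => e ∘ π) (fun π _ => ?_) (fun π _ π' _ h => ?_)
    (fun f hf => ?_) fun π _ => ?_
  · rw [mem_filter, ← image_image, image_univ_equiv]
    exact ⟨mem_univ _, image_orderEmbOfFin_univ K hK⟩
  · exact Equiv.ext fun x => e.injective (congrFun h x)
  · have himg : univ.image f = K := (mem_filter.1 hf).2
    have hinj : Function.Injective f := by
      rw [← Set.injOn_univ, ← coe_univ, ← card_image_iff, himg, hK, card_fin]
    have hmem : ∀ i, ∃ j, e j = f i := by
      intro i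
      have : f i ∈ Set.range e := by
        rw [range_orderEmbOfFin K hK, ← himg]
        exact mem_coe.2 (mem_image_of_mem f (mem_univ i))
      exact this
    choose π hπ using hmem
    have hπi : Function.Injective π := fun i j h => hinj (by rw [← hπ, ← hπ, h])
    exact ⟨Equiv.ofBijective π (Finite.injective_iff_bijective.1 hπi), mem_univ _, funext hπ⟩
  · have := Matrix.det_permute' π (A.submatrix id e)
    rw [Matrix.submatrix_submatrix] at this
    change _ = _ * (A.submatrix id (e ∘ π)).det
    simp only [Function.comp_id] at this
    rw [this]
    simp only [Matrix.submatrix_apply, id, Function.comp_apply]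
    ring

/-- The Cauchy–Binet formula. -/
lemma minor_mul [Fintype κ] (A : Matrix ι κ ℂ) (B : Matrix κ μ ℂ) (I : Finset ι)
    (J : Finset μ) : minor (A * B) I J = ∑ K : Finset κ, minor A I K * minor B K J := by
  classical
  by_cases hJ : J.card = I.card
  swap
  · rw [minor_of_card_ne _ hJ]
    refine (sum_eq_zero fun K _ => ?_).symm
    by_cases hK : K.card = I.card
    · rw [minor_of_card_ne B (hK ▸ hJ), mul_zero]
    · rw [minor_of_card_ne A hK, zero_mul]
  rw [minor_eq_det _ rfl hJ, Matrix.submatrix_mul _ _ _ id _ Function.bijective_id,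
    det_mul_eq_sum_functions, ← sum_fiberwise (g := fun f => univ.image f)]
  refine sum_congr rfl fun K _ => ?_
  by_cases hK : K.card = I.card
  · rw [sum_functions_with_image _ _ hK, minor_eq_det A rfl hK, minor_eq_det B hK hJ]
    rfl
  · rw [minor_of_card_ne A hK, zero_mul]
    refine sum_eq_zero fun f hf => ?_
    have hf' : ¬ Function.Injective f := by
      intro hinj
      apply hK
      rw [← (mem_filter.1 hf).2, card_image_of_injective _ hinj, card_fin]
    simp only [Function.Injective, not_forall] at hf'
    obtain ⟨i, j, hij, hne⟩ := hf'
    rw [Matrix.det_zero_of_column_eq hne (fun x => by simp [hij]), mul_zero]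

/-- Adding a multiple of the row of the predecessor `u₁` of `u₀` to the row of `u₀`. -/
lemma minor_add_row (A A' : Matrix ι κ ℂ) (t : ℂ) {u₁ u₀ : ι} (hu : u₁ < u₀)
    (hadj : ∀ x, x < u₀ → x ≤ u₁) (h₀ : ∀ c, A' u₀ c = A u₀ c + t * A u₁ c)
    (h : ∀ x, x ≠ u₀ → A' x = A x) (I : Finset ι) (J : Finset κ) :
    minor A' I J = minor A I J +
      if u₀ ∈ I ∧ u₁ ∉ I then t * minor A (insert u₁ (I.erase u₀)) J else 0 := by
  classical
  by_cases hJ : J.card = I.card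
  swap
  · rw [minor_of_card_ne _ hJ, minor_of_card_ne _ hJ]
    split_ifs with hc
    · rw [minor_of_card_ne, mul_zero, add_zero]
      rw [card_insert_of_notMem (fun h => hc.2 (mem_of_mem_erase h)),
        card_erase_add_one hc.1]
      exact hJ
    · simp
  rw [minor_eq_det A' rfl hJ, minor_eq_det A rfl hJ]
  set r := I.orderEmbOfFin rfl with hr
  set s := J.orderEmbOfFin hJ
  by_cases h0 : u₀ ∈ I
  swap
  · rw [if_neg (fun h => h0 h.1), add_zero]
    congr 1
    ext i j
    have : r i ≠ u₀ := fun h => h0 (h ▸ orderEmbOfFin_mem I rfl i)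
    simp [h _ this]
  obtain ⟨p, hp⟩ : ∃ p, r p = u₀ := by
    have : u₀ ∈ Set.range r := by rw [range_orderEmbOfFin]; exact mem_coe.2 h0
    exact this
  have hA' : A'.submatrix r s = (A.submatrix r s).updateRow p
      ((A.submatrix r s) p + t • fun j => A u₁ (s j)) := by
    ext i j
    by_cases hi : i = p
    · subst hi
      simp [hp, h₀]
    · have : r i ≠ u₀ := fun h => hi (r.injective (h.trans hp.symm))
      simp [hi, h _ this]
  rw [hA', Matrix.det_updateRow_add, Matrix.det_updateRow_smul, Matrix.updateRow_eq_self]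
  congr 1
  by_cases h1 : u₁ ∈ I
  · obtain ⟨q, hq⟩ : ∃ q, r q = u₁ := by
      have : u₁ ∈ Set.range r := by rw [range_orderEmbOfFin]; exact mem_coe.2 h1
      exact this
    have hqp : p ≠ q := by
      rintro rfl
      exact hu.ne (hq.symm.trans hp)
    rw [if_neg (fun h => h.2 h1), Matrix.det_zero_of_row_eq hqp, mul_zero]
    funext j
    simp [Matrix.updateRow_ne hqp.symm, hq]
  · rw [if_pos ⟨h0, h1⟩]
    congr 1
    have hcard : (insert u₁ (I.erase u₀)).card = I.card := by
      rw [card_insert_of_notMem (fun h => h1 (mem_of_mem_erase h)), card_erase_add_one h0]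
    rw [minor_eq_det A hcard hJ]
    -- Nothing lies strictly between `u₁` and `u₀`, so the replacement keeps the rows in increasing
    -- order and no sign appears.
    have hmono : StrictMono (Function.update r p u₁) := by
      intro i j hij
      have hlt : r i < r j := r.strictMono hij
      rcases eq_or_ne i p with rfl | hi
      · rw [Function.update_self, Function.update_of_ne hij.ne']
        exact hu.trans (hp ▸ hlt)
      rcases eq_or_ne j p with rfl | hj
      · rw [Function.update_self, Function.update_of_ne hij.ne]
        refine lt_of_le_of_ne (hadj _ (hp ▸ hlt)) fun h => h1 ?_
        rw [← h]
        exact orderEmbOfFin_mem I rfl i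
      · rwa [Function.update_of_ne hi, Function.update_of_ne hj]
    rw [← orderEmbOfFin_unique hcard (f := Function.update r p u₁) (fun i => ?_) hmono]
    · congr 1
      ext i j
      rcases eq_or_ne i p with rfl | hi
      · simp [s]
      · simp [hi, s]
    · rcases eq_or_ne i p with rfl | hi
      · simp
      · rw [Function.update_of_ne hi]
        refine mem_insert_of_mem (mem_erase.2 ⟨fun h => hi (r.injective (h.trans hp.symm)), ?_⟩)
        exact orderEmbOfFin_mem I rfl i

/-- If the nonzero entries of `T` are the edges of a planar graph, then its minors are products. -/
lemma minor_planar (T : Matrix ι κ ℂ)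
    (hT : ∀ u v u' v', T u v ≠ 0 → T u' v' ≠ 0 → u < u' → v ≤ v') {m : ℕ} {s : Fin m → ι}
    {t : Fin m → κ} (hs : StrictMono s) (ht : StrictMono t) :
    minor T (univ.image s) (univ.image t) = ∏ a, T (s a) (t a) := by
  rw [minor_image T hs ht, Matrix.det_apply', sum_eq_single 1]
  · simp
  · intro σ _ hσ
    by_contra hne
    have hprod : ∀ i, T (s (σ i)) (t i) ≠ 0 := fun i =>
      prod_ne_zero_iff.1 (right_ne_zero_of_mul hne) i (mem_univ i)
    refine hσ (Equiv.ext fun i => ?_)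
    -- A nonzero term of the determinant is a family of edges without crossings, so its permutation
    -- is increasing, hence trivial.
    have hmono : StrictMono σ := by
      intro i j hij
      refine lt_of_le_of_ne (le_of_not_gt fun hlt => ?_) fun h => hij.ne (σ.injective h)
      exact absurd (hT _ _ _ _ (hprod j) (hprod i) (hs hlt)) (not_le.2 (ht hij))
    exact congrFun ((hmono.range_inj strictMono_id).1
      (by rw [σ.surjective.range_eq, Set.range_id])) i
  · simp

lemma minor_submatrix_map (A : Matrix ι κ ℂ) (φ : μ ↪o κ) (I : Finset ι) (J : Finset μ) :
    minor (A.submatrix id φ) I J = minor A I (J.map φ.toEmbedding) := by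
  by_cases hJ : J.card = I.card
  · rw [minor_eq_det _ rfl hJ, minor_eq_det A rfl ((card_map _).trans hJ),
      ← orderEmbOfFin_unique ((card_map _).trans hJ) (f := φ ∘ J.orderEmbOfFin hJ) (fun i => ?_)
        (φ.strictMono.comp (OrderEmbedding.strictMono _))]
    · rfl
    · exact mem_map_of_mem _ (orderEmbOfFin_mem J hJ i)
  · rw [minor_of_card_ne _ hJ, minor_of_card_ne _ (by rwa [card_map])]

end Minor

/-! ### Products of matrices as sums over paths -/

/-- The index type is arbitrary because this is applied both to levels, giving paths, and to sets of
levels (compound matrices), giving chains of minors. -/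
lemma list_ofFn_prod_apply {ι R : Type*} [Fintype ι] [DecidableEq ι] [CommSemiring R] :
    ∀ {W : ℕ} (A : Fin W → Matrix ι ι R) (i j : ι), (List.ofFn A).prod i j =
      ∑ p : Fin (W + 1) → ι with p 0 = i ∧ p (Fin.last W) = j,
        ∏ c : Fin W, A c (p c.castSucc) (p c.succ)
  | 0, A, i, j => by
    rw [List.ofFn_zero, List.prod_nil, Matrix.one_apply]
    simp only [univ_eq_empty, prod_empty, sum_const, nsmul_eq_mul, mul_one]
    by_cases h : i = j
    · subst h
      rw [if_pos rfl, card_eq_one.2 ⟨fun _ => i, ?_⟩, Nat.cast_one]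
      ext p
      simp only [mem_filter, mem_univ, true_and, mem_singleton, funext_iff]
      exact ⟨fun hp x => by rw [Fin.fin_one_eq_zero x]; exact hp.1, fun hp => ⟨hp _, hp _⟩⟩
    · rw [if_neg h, card_eq_zero.2 (filter_eq_empty_iff.2 ?_), Nat.cast_zero]
      rintro p - ⟨h1, h2⟩
      exact h (h1.symm.trans h2)
  | W + 1, A, i, j => by
    rw [List.ofFn_succ, List.prod_cons, Matrix.mul_apply]
    simp only [list_ofFn_prod_apply fun c : Fin W => A c.succ, mul_sum]
    rw [sum_sigma']
    refine sum_bij' (fun q _ => Fin.cons i q.2) (fun p _ => ⟨p 1, Fin.tail p⟩) ?_ ?_ ?_ ?_ ?_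
    · rintro ⟨m, p⟩ hp
      simp only [mem_sigma, mem_univ, mem_filter, true_and] at hp ⊢
      refine ⟨Fin.cons_zero _ _, ?_⟩
      rw [← Fin.succ_last, Fin.cons_succ]
      exact hp.2
    · intro p hp
      simp only [mem_sigma, mem_univ, mem_filter, true_and] at hp ⊢
      exact ⟨rfl, hp.2⟩
    · rintro ⟨m, p⟩ hp
      simp only [mem_sigma, mem_univ, mem_filter, true_and] at hp
      obtain ⟨rfl, -⟩ := hp
      rfl
    · intro p hp
      simp only [mem_univ, mem_filter, true_and] at hp
      obtain ⟨rfl, -⟩ := hp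
      exact Fin.cons_self_tail p
    · rintro ⟨m, p⟩ hp
      simp only [mem_sigma, mem_univ, mem_filter, true_and] at hp
      obtain ⟨rfl, -⟩ := hp
      rw [Fin.prod_univ_succ]
      rfl

/-- The compound matrix, whose entries are the minors. -/
def compound {n : ℕ} (A : Matrix (Fin n) (Fin n) ℂ) :
    Matrix (Finset (Fin n)) (Finset (Fin n)) ℂ :=
  Matrix.of fun I J => minor A I J

lemma minor_diagonal {n : ℕ} (d : Fin n → ℂ) (I J : Finset (Fin n)) :
    minor (Matrix.diagonal d) I J = if I = J then ∏ i ∈ I, d i else 0 := by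
  by_cases hJ : J.card = I.card
  swap
  · rw [minor_of_card_ne _ hJ, if_neg fun h => hJ (congrArg card h).symm]
  have h := minor_planar (Matrix.diagonal d) (fun u v u' v' h h' huv => by
    have h1 : u = v := by_contra fun hne => h (Matrix.diagonal_apply_ne _ hne)
    have h2 : u' = v' := by_contra fun hne => h' (Matrix.diagonal_apply_ne _ hne)
    exact h1 ▸ h2 ▸ huv.le) (I.orderEmbOfFin rfl).strictMono (J.orderEmbOfFin hJ).strictMono
  rw [image_orderEmbOfFin_univ, image_orderEmbOfFin_univ] at h
  rw [h]
  split_ifs with hIJ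
  · subst hIJ
    conv_rhs => rw [← image_orderEmbOfFin_univ I rfl]
    rw [prod_image fun x _ y _ hxy => (I.orderEmbOfFin rfl).injective hxy]
    simp
  · by_contra hne
    refine hIJ ?_
    rw [← image_orderEmbOfFin_univ I rfl, ← image_orderEmbOfFin_univ J hJ]
    refine image_congr fun a _ => by_contra fun h => ?_
    exact prod_ne_zero_iff.1 hne a (mem_univ a) (Matrix.diagonal_apply_ne _ h)

lemma compound_one {n : ℕ} : compound (1 : Matrix (Fin n) (Fin n) ℂ) = 1 := by
  ext I J
  rw [compound, Matrix.of_apply, ← Matrix.diagonal_one, minor_diagonal, Matrix.one_apply]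
  simp

lemma compound_mul {n : ℕ} (A B : Matrix (Fin n) (Fin n) ℂ) :
    compound (A * B) = compound A * compound B := by
  ext I J
  exact minor_mul A B I J

/-- A minor of a product is a sum over chains of sets of indices. -/
lemma minor_list_ofFn_prod {n W : ℕ} (A : Fin W → Matrix (Fin n) (Fin n) ℂ)
    (I J : Finset (Fin n)) : minor (List.ofFn A).prod I J =
      ∑ K : Fin (W + 1) → Finset (Fin n) with K 0 = I ∧ K (Fin.last W) = J,
        ∏ c : Fin W, minor (A c) (K c.castSucc) (K c.succ) := by
  have h : ∀ l : List (Matrix (Fin n) (Fin n) ℂ), compound l.prod = (l.map compound).prod := by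
    intro l
    induction l with
    | nil => exact compound_one
    | cons a l ih => rw [List.prod_cons, compound_mul, ih, List.map_cons, List.prod_cons]
  have := congrFun₂ ((h (List.ofFn A)).trans (by rw [List.map_ofFn])) I J
  exact this.trans (list_ofFn_prod_apply _ I J)

/-! ### Factorization of the network matrix -/

section Factorization

/-- Sorting by columns: two factors change their order only if their columns are inverted in the
list, and such factors commute. -/
lemma list_prod_ofFn_filter {α M : Type*} [Monoid M] (X : α → M) (col : α → ℕ) (L : List α)
    (hL : L.Pairwise fun e e' => col e' < col e → Commute (X e) (X e')) :
    ∀ N : ℕ, (List.ofFn fun c : Fin N => ((L.filter fun e => col e = c).map X).prod).prod =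
      ((L.filter fun e => col e < N).map X).prod
  | 0 => by simp
  | N + 1 => by
    rw [List.ofFn_succ', List.concat_eq_append, List.prod_append, List.prod_singleton]
    simp only [Fin.val_castSucc, Fin.val_last]
    rw [list_prod_ofFn_filter X col L hL N]
    clear list_prod_ofFn_filter
    induction L with
    | nil => simp
    | cons e L ih =>
      rw [List.pairwise_cons] at hL
      have ih := ih hL.2
      rcases lt_trichotomy (col e) N with h | h | h
      · rw [List.filter_cons_of_pos (by simpa using h), List.filter_cons_of_neg (by simp [h.ne]),
          List.filter_cons_of_pos (by simp; omega), List.map_cons, List.prod_cons, List.map_cons,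
          List.prod_cons, mul_assoc, ih]
      · have hc : Commute (X e) ((L.filter fun e => col e < N).map X).prod := by
          refine Commute.list_prod_right _ _ fun y hy => ?_
          obtain ⟨e', he', rfl⟩ := List.mem_map.1 hy
          rw [List.mem_filter] at he'
          exact hL.1 e' he'.1 (by simpa [h] using he'.2)
        rw [List.filter_cons_of_neg (by simp [h]), List.filter_cons_of_pos (by simp [h]),
          List.filter_cons_of_pos (by simp; omega), List.map_cons, List.prod_cons, List.map_cons,
          List.prod_cons, ← mul_assoc, ← hc.eq, mul_assoc, ih]
      · rw [List.filter_cons_of_neg (by simp; omega), List.filter_cons_of_neg (by simp; omega),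
          List.filter_cons_of_neg (by simp; omega), ih]

lemma list_prod_one_add {α R : Type*} [Semiring R] (N : α → R) (L : List α)
    (hL : L.Pairwise fun e e' => N e * N e' = 0) :
    (L.map fun e => 1 + N e).prod = 1 + (L.map N).sum := by
  induction L with
  | nil => simp
  | cons e L ih =>
    rw [List.pairwise_cons] at hL
    rw [List.map_cons, List.prod_cons, ih hL.2, List.map_cons, List.sum_cons, add_mul, mul_add,
      mul_add]
    have : N e * (L.map N).sum = 0 := by
      rw [← List.sum_map_mul_left]
      exact List.sum_eq_zero fun x hx => by
        obtain ⟨e', he', rfl⟩ := List.mem_map.1 hx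
        exact hL.1 e' he'
    rw [this]
    simp [add_assoc, add_comm]

/-- The matrix unit in the row `i` and the column `i - 1`. -/
def lowerUnit (n i : ℕ) : Matrix (Fin n) (Fin n) ℂ :=
  Matrix.of fun u v => if (u : ℕ) = i ∧ (v : ℕ) + 1 = i then 1 else 0

lemma lowerUnit_mul_lowerUnit (n : ℕ) {i i' : ℕ} (h : i ≠ i' + 1) :
    lowerUnit n i * lowerUnit n i' = 0 := by
  ext u v
  rw [Matrix.mul_apply, Matrix.zero_apply]
  refine sum_eq_zero fun x _ => ?_
  simp only [lowerUnit, Matrix.of_apply]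
  split_ifs with h1 h2
  · omega
  all_goals simp

/-- The elementary matrix of a slanted edge of weight `t` from level `i` to level `i - 1`. -/
def slantMatrix (n i : ℕ) (t : ℂ) : Matrix (Fin n) (Fin n) ℂ := 1 + t • lowerUnit n i

lemma slantMatrix_commute (n : ℕ) {i i' : ℕ} (t t' : ℂ) (h : i + 2 ≤ i') :
    Commute (slantMatrix n i t) (slantMatrix n i' t') := by
  have h1 := lowerUnit_mul_lowerUnit n (show i ≠ i' + 1 by omega)
  have h2 := lowerUnit_mul_lowerUnit n (show i' ≠ i + 1 by omega)
  simp only [Commute, SemiconjBy, slantMatrix, add_mul, mul_add, one_mul, mul_one,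
    smul_mul_assoc, mul_smul_comm, h1, h2, smul_zero, add_zero]
  abel

/-- The edges of the `r`-th block on the levels at most `r + d`, ordered from left to right. -/
def blockEdges (r : ℕ) : ℕ → List (ℕ × ℕ)
  | 0 => []
  | d + 1 => (r + d + 1, r) :: blockEdges r d

/-- The slanted edges of the last `m` blocks. -/
def slantedEdges (n : ℕ) : ℕ → List (ℕ × ℕ)
  | 0 => []
  | m + 1 => blockEdges (n - 1 - m) m ++ slantedEdges n m

lemma mem_blockEdges {r d : ℕ} {e : ℕ × ℕ} :
    e ∈ blockEdges r d ↔ e.2 = r ∧ r < e.1 ∧ e.1 ≤ r + d := by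
  induction d with
  | zero =>
    simp only [blockEdges, List.not_mem_nil, false_iff]
    omega
  | succ d ih =>
    rw [blockEdges, List.mem_cons, ih, Prod.ext_iff]
    dsimp only
    omega

lemma mem_slantedEdges {n m : ℕ} (hm : m ≤ n) {e : ℕ × ℕ} :
    e ∈ slantedEdges n m ↔ n ≤ m + e.2 ∧ e.2 < e.1 ∧ e.1 < n := by
  induction m with
  | zero =>
    simp only [slantedEdges, List.not_mem_nil, false_iff]
    omega
  | succ m ih =>
    rw [slantedEdges, List.mem_append, ih (by omega), mem_blockEdges]
    omega

lemma blockEdges_pairwise (r d : ℕ) :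
    (blockEdges r d).Pairwise fun e e' => e.2 = e'.2 ∧ e'.1 < e.1 := by
  induction d with
  | zero => exact List.Pairwise.nil
  | succ d ih =>
    refine List.pairwise_cons.2 ⟨fun e he => ?_, ih⟩
    rw [mem_blockEdges] at he
    exact ⟨he.1.symm, by dsimp only; omega⟩

lemma slantedEdges_pairwise {n m : ℕ} (hm : m ≤ n) :
    (slantedEdges n m).Pairwise fun e e' => e.2 = e'.2 ∧ e'.1 < e.1 ∨ e.2 < e'.2 := by
  induction m with
  | zero => exact List.Pairwise.nil
  | succ m ih =>
    refine List.pairwise_append.2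
      ⟨(blockEdges_pairwise _ _).imp fun h => Or.inl h, ih (by omega), fun e he e' he' => ?_⟩
    rw [mem_blockEdges] at he
    rw [mem_slantedEdges (by omega)] at he'
    omega

/-- The column in which a slanted edge starts. -/
def slantColumn (n : ℕ) (e : ℕ × ℕ) : ℕ := 2 * (n - e.1) + 3 * e.2

variable {n : ℕ}

/-- The weight of the essential edge `(i, j)` (`d` outside the range of indices). -/
def edgeWeight {R : Type*} (d : R) (a : EssEdge n → R) (i j : ℕ) : R :=
  if h : j ≤ i ∧ i < n then a ⟨(⟨i, h.2⟩, ⟨j, h.1.trans_lt h.2⟩), h.1⟩ else d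

lemma edgeWeight_of_essEdge {R : Type*} (d : R) (a : EssEdge n → R) (x : EssEdge n) :
    edgeWeight d a x.1.1 x.1.2 = a x :=
  dif_pos ⟨x.2, x.1.1.isLt⟩

open Classical in
/-- The transfer matrix of a column of a network. -/
def PlanarNetwork.stepMatrix (N : PlanarNetwork n) (w : ℕ → Fin n → Fin n → ℂ) (c : ℕ) :
    Matrix (Fin n) (Fin n) ℂ :=
  Matrix.of fun u v => if N.IsEdge c u v then w c u v else 0

lemma PlanarNetwork.matrix_eq_prod (N : PlanarNetwork n) (w : ℕ → Fin n → Fin n → ℂ) :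
    N.matrix w = (List.ofFn fun c : Fin N.width => N.stepMatrix w c).prod := by
  classical
  ext i j
  rw [list_ofFn_prod_apply, PlanarNetwork.matrix, Matrix.of_apply]
  have : (univ.filter fun p : Fin (N.width + 1) → Fin n => N.IsPath p ∧ p 0 = i ∧ p (Fin.last _) = j)
      = (univ.filter fun p : Fin (N.width + 1) → Fin n => p 0 = i ∧ p (Fin.last _) = j).filter
        N.IsPath := by
    ext p
    simp [and_comm]
  rw [this, sum_filter N.IsPath]
  refine sum_congr rfl fun p _ => ?_
  split_ifs with hp
  · exact prod_congr rfl fun c _ => (if_pos (hp c)).symm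
  · rw [PlanarNetwork.IsPath, not_forall] at hp
    obtain ⟨c, hc⟩ := hp
    exact (prod_eq_zero (mem_univ c) (if_neg hc)).symm

/-- Slanted edges in one column have the same value of 3j - 2i, so their starting levels differ by
multiples of 3. No two of them can be composed, and the product of the elementary matrices is 1 plus
the sum of the matrix units, which is the transfer matrix of the column. -/
lemma standardNetwork_stepMatrix_slanted (a : EssEdge n → ℂ) {c : ℕ} (hc : c + 1 < 3 * n) :
    (standardNetwork n).stepMatrix (standardWeighting a) c =
      (((slantedEdges n n).filter fun e => slantColumn n e = c).map
        fun e => slantMatrix n e.1 (edgeWeight 1 a e.1 e.2)).prod := by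
  classical
  have hpw := slantedEdges_pairwise (le_refl n)
  have hnd : (slantedEdges n n).Nodup := hpw.imp fun {e e'} h h' => by subst h'; omega
  have hmem : ∀ e, e ∈ slantedEdges n n ↔ e.2 < e.1 ∧ e.1 < n := by
    intro e
    rw [mem_slantedEdges le_rfl]
    omega
  simp only [slantMatrix]
  rw [list_prod_one_add, ← List.sum_toFinset _ (hnd.filter _)]
  · ext u v
    rw [Matrix.add_apply, Matrix.sum_apply, Matrix.one_apply]
    simp only [PlanarNetwork.stepMatrix, Matrix.of_apply, Matrix.smul_apply, lowerUnit, smul_eq_mul]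
    by_cases huv : u = v
    · subst huv
      rw [if_pos (show (standardNetwork n).IsEdge c u u from Or.inl rfl), if_pos rfl, sum_eq_zero, add_zero]
      · refine prod_eq_one fun x _ => if_neg ?_
        rintro ⟨-, ⟨-, h, -⟩ | ⟨-, -, h⟩⟩ <;> omega
      · intro e _
        rw [if_neg (by omega), mul_zero]
    rw [if_neg huv, zero_add]
    by_cases hx : ∃ x : EssEdge n, x.Occupies c u v
    · rw [if_pos (show (standardNetwork n).IsEdge c u v from Or.inr hx)]
      obtain ⟨x, hx⟩ := hx
      obtain ⟨h1, h2⟩ := id hx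
      have h3 : x.1.2 < x.1.1 ∧ (v : ℕ) + 1 = u ∧ c + 2 * (u : ℕ) = 2 * n + 3 * (x.1.2 : ℕ) := by
        rcases h2 with h2 | h2
        · exact h2
        · exact absurd h2.2.1.symm huv
      have hxu := u.isLt
      have hlt : (x.1.2 : ℕ) < x.1.1 := h3.1
      have hval : (x.1.1 : ℕ) = u := congrArg Fin.val h1
      rw [standardWeighting, prod_eq_single x, if_pos hx,
        sum_eq_single ((x.1.1 : ℕ), (x.1.2 : ℕ)), if_pos, mul_one, edgeWeight_of_essEdge]
      · exact ⟨hval.symm, by omega⟩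
      · rintro e he hne
        rw [List.mem_toFinset, List.mem_filter, hmem, decide_eq_true_eq, slantColumn] at he
        rw [if_neg, mul_zero]
        rintro ⟨h4, -⟩
        refine hne (Prod.ext ?_ ?_) <;> dsimp only <;> omega
      · intro h
        refine absurd (List.mem_toFinset.2 (List.mem_filter.2 ⟨(hmem _).2 ⟨hlt, x.1.1.isLt⟩, ?_⟩)) h
        rw [decide_eq_true_eq, slantColumn]
        dsimp only
        omega
      · rintro y - hne
        refine if_neg ?_
        rintro ⟨h4, h5⟩
        refine hne (Subtype.ext (Prod.ext (h4.trans h1.symm) (Fin.ext ?_)))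
        rcases h5 with h5 | h5
        · omega
        · exact absurd h5.2.1.symm huv
      · simp
    · rw [if_neg, sum_eq_zero]
      · rintro e he
        rw [List.mem_toFinset, List.mem_filter, hmem, decide_eq_true_eq, slantColumn] at he
        rw [if_neg, mul_zero]
        rintro ⟨h4, h5⟩
        refine hx ⟨⟨(u, ⟨e.2, by omega⟩), ?_⟩, rfl, Or.inl ⟨?_, by omega, ?_⟩⟩
        · rw [Fin.le_def]; dsimp only; omega
        · rw [Fin.lt_def]; dsimp only; omega
        · dsimp only; omega
      · rintro (h | h)
        exacts [huv h, hx h]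
  · have h2 : ((slantedEdges n n).filter fun e => slantColumn n e = c).Pairwise
        fun e e' => e.1 ≠ e'.1 + 1 := by
      rw [List.pairwise_filter]
      refine hpw.imp_of_mem fun {e e'} he he' h hc hc' h' => ?_
      rw [hmem] at he he'
      rw [decide_eq_true_eq, slantColumn] at hc hc'
      omega
    exact h2.imp fun h => by
      rw [smul_mul_assoc, mul_smul_comm, lowerUnit_mul_lowerUnit n h, smul_zero, smul_zero]

lemma standardNetwork_stepMatrix_last (a : EssEdge n → ℂ) {c : ℕ} (hc : c + 1 = 3 * n) :
    (standardNetwork n).stepMatrix (standardWeighting a) c =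
      Matrix.diagonal fun i : Fin n => edgeWeight 1 a i i := by
  classical
  have hocc : ∀ (x : EssEdge n) (u v : Fin n), x.Occupies c u v ↔ x.1.1 = u ∧ x.1.2 = u ∧ v = u := by
    intro x u v
    constructor
    · rintro ⟨h1, ⟨h2, h3, h4⟩ | ⟨h2, h3, -⟩⟩
      · have : (x.1.2 : ℕ) < x.1.1 := h2
        have := congrArg Fin.val h1
        have := u.isLt
        omega
      · exact ⟨h1, h2.trans h1, h3⟩
    · rintro ⟨h1, h2, h3⟩
      exact ⟨h1, Or.inr ⟨h2.trans h1.symm, h3, hc⟩⟩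
  ext u v
  simp only [PlanarNetwork.stepMatrix, Matrix.of_apply]
  by_cases huv : u = v
  · subst huv
    rw [if_pos (show (standardNetwork n).IsEdge c u u from Or.inl rfl), Matrix.diagonal_apply_eq, standardWeighting,
      prod_eq_single ⟨(u, u), le_rfl⟩, if_pos ((hocc _ _ _).2 ⟨rfl, rfl, rfl⟩)]
    · exact (edgeWeight_of_essEdge 1 a ⟨(u, u), le_rfl⟩).symm
    · intro x _ hx
      refine if_neg fun h => hx ?_
      rw [hocc] at h
      exact Subtype.ext (Prod.ext h.1 h.2.1)
    · simp
  · rw [Matrix.diagonal_apply_ne _ huv, if_neg]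
    rintro (h | ⟨x, h⟩)
    · exact huv h
    · exact huv ((hocc _ _ _).1 h).2.2.symm

/-- The factorization of the matrix of the standard network along its blocks. -/
lemma standardNetwork_matrix_eq (a : EssEdge n → ℂ) :
    (standardNetwork n).matrix (standardWeighting a) =
      ((slantedEdges n n).map fun e => slantMatrix n e.1 (edgeWeight 1 a e.1 e.2)).prod *
        Matrix.diagonal fun i : Fin n => edgeWeight 1 a i i := by
  rcases Nat.eq_zero_or_pos n with rfl | hn
  · exact Subsingleton.elim _ _
  have hmem : ∀ e, e ∈ slantedEdges n n ↔ e.2 < e.1 ∧ e.1 < n := by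
    intro e
    rw [mem_slantedEdges le_rfl]
    omega
  obtain ⟨W, hW⟩ : ∃ W, 3 * n = W + 1 := ⟨3 * n - 1, by omega⟩
  have h : ∀ V, V = W + 1 →
      (List.ofFn fun c : Fin V => (standardNetwork n).stepMatrix (standardWeighting a) c).prod =
      (List.ofFn fun c : Fin W => (standardNetwork n).stepMatrix (standardWeighting a) c).prod *
        (standardNetwork n).stepMatrix (standardWeighting a) W := by
    rintro V rfl
    rw [List.ofFn_succ', List.concat_eq_append, List.prod_append, List.prod_singleton]
    rfl
  rw [PlanarNetwork.matrix_eq_prod]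
  refine (h _ hW).trans ?_
  rw [standardNetwork_stepMatrix_last a hW.symm]
  congr 1
  have h' : (fun c : Fin W => (standardNetwork n).stepMatrix (standardWeighting a) c) =
      fun c : Fin W => (((slantedEdges n n).filter fun e => slantColumn n e = c).map
        fun e => slantMatrix n e.1 (edgeWeight 1 a e.1 e.2)).prod :=
    funext fun c => standardNetwork_stepMatrix_slanted a (by have := c.isLt; omega)
  rw [h', list_prod_ofFn_filter]
  · congr 2
    refine List.filter_eq_self.2 fun e he => ?_
    rw [hmem] at he
    rw [decide_eq_true_eq, slantColumn]
    omega
  -- Within a block the list is already sorted by columns. For edges (i, j), (i', j') with j < j',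
  -- an inversion means 3(j' - j) < 2(i' - i), hence i' ≥ i + 2, and the elementary matrices
  -- commute.
  · refine (slantedEdges_pairwise le_rfl).imp_of_mem fun {e e'} he he' h hc => ?_
    rw [hmem] at he he'
    rw [slantColumn, slantColumn] at hc
    exact slantMatrix_commute n _ _ (by omega)

end Factorization

/-! ### Particle dynamics of the block factorization -/

section Dynamics

variable {R : Type*} (add mul : R → R → R)

/-- A particle may move from `p + 1` to `p`, with weight `t`, if `p` is free. -/
def slantStep (p : ℕ) (t : R) (F : Finset ℕ → R) (S : Finset ℕ) : R :=
  if p + 1 ∈ S ∧ p ∉ S then add (F S) (mul t (F (insert p (S.erase (p + 1))))) else F S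

/-- The value of a set of particles in front of the last `d` edges of the block `r`, if `F` is the
value behind the block. -/
def blockVal (W : ℕ → ℕ → R) (r : ℕ) (F : Finset ℕ → R) : ℕ → Finset ℕ → R
  | 0 => F
  | d + 1 => slantStep add mul (r + d) (W (r + d + 1) r) (blockVal W r F d)

/-- The value of a set of particles in front of the last `m` blocks. -/
def tailVal (W : ℕ → ℕ → R) (n : ℕ) (F : Finset ℕ → R) : ℕ → Finset ℕ → R
  | 0 => F
  | m + 1 => blockVal add mul W (n - 1 - m) (tailVal W n F m) m

variable {add mul} {z : R} {W : ℕ → ℕ → R} {F : Finset ℕ → R}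

lemma slantStep_of_not {p : ℕ} {t : R} {S : Finset ℕ} (h : p + 1 ∈ S → p ∈ S) :
    slantStep add mul p t F S = F S :=
  if_neg fun h' => h'.2 (h h'.1)

lemma blockVal_succ {r d : ℕ} {S : Finset ℕ} : blockVal add mul W r F (d + 1) S =
    slantStep add mul (r + d) (W (r + d + 1) r) (blockVal add mul W r F d) S :=
  rfl

lemma tailVal_of_lt {n r : ℕ} (hr : r < n) :
    tailVal add mul W n F (n - r) =
      blockVal add mul W r (tailVal add mul W n F (n - (r + 1))) (n - 1 - r) := by
  obtain ⟨m, rfl⟩ : ∃ m, n = r + m + 1 := ⟨n - r - 1, by omega⟩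
  rw [show r + m + 1 - r = m + 1 by omega, show r + m + 1 - (r + 1) = m by omega,
    show r + m + 1 - 1 - r = m by omega, tailVal, show r + m + 1 - 1 - m = r by omega]

lemma blockVal_of_free {r d : ℕ} {S : Finset ℕ} (h : ∀ x, r < x → x ≤ r + d → x ∉ S) :
    blockVal add mul W r F d S = F S := by
  induction d with
  | zero => rfl
  | succ d ih =>
    rw [blockVal, slantStep_of_not fun h' => absurd h' (h _ (by omega) (by omega))]
    exact ih fun x h1 h2 => h x h1 (by omega)

variable (hadd : ∀ x, add z x = x) (hmul : ∀ t, mul t z = z)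

include hadd hmul in
lemma blockVal_eq_zero_of_untouched {r x : ℕ} {J : Finset ℕ} (hx : x < r)
    (hF : ∀ S : Finset ℕ, ¬ (x ∈ S ↔ x ∈ J) → F S = z) (d : ℕ) (S : Finset ℕ)
    (hS : ¬ (x ∈ S ↔ x ∈ J)) : blockVal add mul W r F d S = z := by
  induction d generalizing S with
  | zero => exact hF S hS
  | succ d ih =>
    rw [blockVal, slantStep]
    split_ifs
    · rw [ih S hS, ih _ ?_, hmul, hadd]
      rwa [mem_insert, mem_erase, or_iff_right (by omega), and_iff_right (by omega)]
    · exact ih S hS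

-- The last `m` blocks only touch the levels from n - m on. Below them the occupation is final, so
-- it must agree with that of the sinks `J`.
include hadd hmul in
lemma tailVal_eq_zero_of_untouched {n m x : ℕ} {J : Finset ℕ} (hx : x < n - m)
    (hF : ∀ S, S ≠ J → F S = z) (S : Finset ℕ) (hS : ¬ (x ∈ S ↔ x ∈ J)) :
    tailVal add mul W n F m S = z := by
  induction m generalizing S with
  | zero => exact hF S fun h => hS (h ▸ Iff.rfl)
  | succ m ih =>
    exact blockVal_eq_zero_of_untouched hadd hmul (by omega) (ih (by omega)) m S hS

-- Level `r` has to be filled by the end of the block, and the particle at r + d + 1 is the lowest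
-- one available. If it skipped its edge, nothing could reach `r`; so it must jump.
include hadd in
lemma blockVal_forced {r d : ℕ} (hF : ∀ S : Finset ℕ, r ∉ S → F S = z) {S : Finset ℕ}
    (h1 : r + d + 1 ∈ S) (h2 : ∀ x, r ≤ x → x ≤ r + d → x ∉ S) :
    blockVal add mul W r F (d + 1) S =
      mul (W (r + d + 1) r) (blockVal add mul W r F d (insert (r + d) (S.erase (r + d + 1)))) := by
  rw [blockVal, slantStep, if_pos ⟨h1, h2 _ (by omega) le_rfl⟩,
    blockVal_of_free (S := S) fun x h h' => h2 x h.le h', hF S (h2 r le_rfl (by omega)), hadd]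

end Dynamics

/-! ### Exchange inequalities -/

section Exchange

variable {W : ℕ → ℕ → Trop} {F F' G G' : Finset ℕ → Trop}

lemma slantStep_add_le {p : ℕ} {t : Trop} {S : Finset ℕ} {A B : Trop} (h : F S + A ≤ B)
    (h' : p + 1 ∈ S → p ∉ S → t + F (insert p (S.erase (p + 1))) + A ≤ B) :
    slantStep max (· + ·) p t F S + A ≤ B := by
  rw [slantStep]
  split_ifs with hc
  · rw [max_add]
    exact max_le h (h' hc.1 hc.2)
  · exact h

lemma le_slantStep {p : ℕ} {t : Trop} {S : Finset ℕ} : F S ≤ slantStep max (· + ·) p t F S := by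
  rw [slantStep]
  split_ifs
  exacts [le_max_left _ _, le_rfl]

lemma le_slantStep_move {p : ℕ} {t : Trop} {S : Finset ℕ} (h1 : p + 1 ∈ S) (h2 : p ∉ S) :
    t + F (insert p (S.erase (p + 1))) ≤ slantStep max (· + ·) p t F S := by
  rw [slantStep, if_pos ⟨h1, h2⟩]
  exact le_max_right _ _

lemma le_blockVal (r d : ℕ) (S : Finset ℕ) : F S ≤ blockVal max (· + ·) W r F d S := by
  induction d with
  | zero => exact le_rfl
  | succ d ih => exact ih.trans le_slantStep

/-- Two steps in which the same move of a particle is possible. -/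
lemma slantStep_add_le_slantStep_add {p : ℕ} {t : Trop} {S S' : Finset ℕ} {A A' : Trop}
    (h : F S + A ≤ F' S' + A')
    (h' : p + 1 ∈ S → p ∉ S → p + 1 ∈ S' ∧ p ∉ S' ∧
      F (insert p (S.erase (p + 1))) + A ≤ F' (insert p (S'.erase (p + 1))) + A') :
    slantStep max (· + ·) p t F S + A ≤ slantStep max (· + ·) p t F' S' + A' := by
  refine slantStep_add_le (h.trans (add_le_add_left le_slantStep _)) fun h1 h2 => ?_
  obtain ⟨h3, h4, h5⟩ := h' h1 h2
  refine le_trans ?_ (add_le_add_left (le_slantStep_move h3 h4) _)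
  rw [add_assoc, add_assoc]
  exact add_le_add_right h5 _

lemma add_left_comm_le {t a b c d : Trop} (h : a + b ≤ c + d) : a + (t + b) ≤ c + (t + d) := by
  rw [add_left_comm, add_left_comm c]
  exact add_le_add_right h t

/-- The exchange of the particles of a block below the discrepancy at `v`, `v + 1`. -/
lemma left_exchange_lower {n r v : ℕ}
    (hG : ∀ S : Finset ℕ, r ∉ S → G S = ⊥)
    (hFG : ∀ I : Finset ℕ, v ∈ I → v + 1 ∉ I →
      F I + G (range (r + 1) ∪ Ico (v + 1) n) ≤
        F (insert (v + 1) (I.erase v)) +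
          G (range (r + 1) ∪ ({v} ∪ Ico (v + 2) n))) (d : ℕ) (hd : r + d < v)
    (X : Finset ℕ) (h1 : v ∈ X) (h2 : v + 1 ∉ X) :
    blockVal max (· + ·) W r F d X +
        blockVal max (· + ·) W r G d (range r ∪ ({r + d} ∪ Ico (v + 1) n)) ≤
      blockVal max (· + ·) W r F d (insert (v + 1) (X.erase v)) +
        blockVal max (· + ·) W r G d (range r ∪ ({r + d} ∪ ({v} ∪ Ico (v + 2) n))) := by
  induction d generalizing X with
  | zero =>
    have h3 : ∀ Y, range r ∪ ({r + 0} ∪ Y) = range (r + 1) ∪ Y := fun Y => by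
      rw [range_add_one, insert_eq, ← union_assoc, union_comm (range r), add_zero]
    rw [h3, h3]
    exact hFG X h1 h2
  | succ d ih =>
    rw [blockVal_forced bot_sup_eq (d := d) hG]
    rotate_left
    · simp only [mem_union, mem_range, mem_singleton, mem_Ico]
      omega
    · intro x hx hx'
      simp only [mem_union, mem_range, mem_singleton, mem_Ico]
      omega
    have h3 : insert (r + d) ((range r ∪ ({r + (d + 1)} ∪ Ico (v + 1) n)).erase (r + d + 1)) =
        range r ∪ ({r + d} ∪ Ico (v + 1) n) := by
      ext x
      simp only [mem_insert, mem_erase, mem_union, mem_range, mem_singleton, mem_Ico]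
      omega
    have h4 : insert (r + d)
        ((range r ∪ ({r + (d + 1)} ∪ ({v} ∪ Ico (v + 2) n))).erase (r + d + 1)) =
        range r ∪ ({r + d} ∪ ({v} ∪ Ico (v + 2) n)) := by
      ext x
      simp only [mem_insert, mem_erase, mem_union, mem_range, mem_singleton, mem_Ico]
      omega
    rw [h3]
    have h5 := le_slantStep_move (p := r + d) (t := W (r + d + 1) r)
      (F := blockVal max (· + ·) W r G d)
      (S := range r ∪ ({r + (d + 1)} ∪ ({v} ∪ Ico (v + 2) n))) (by simp [add_assoc]) (by
        simp only [mem_union, mem_range, mem_singleton, mem_Ico]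
        omega)
    rw [h4] at h5
    refine le_trans ?_ (add_le_add_right h5 _)
    refine slantStep_add_le_slantStep_add (add_left_comm_le (ih (by omega) X h1 h2))
      fun h6 h7 => ⟨?_, ?_, ?_⟩
    · simp only [mem_insert, mem_erase]
      exact Or.inr ⟨by omega, h6⟩
    · simp only [mem_insert, mem_erase]
      rintro (h | h)
      exacts [by omega, h7 h.2]
    · have h8 : insert (r + d) ((insert (v + 1) (X.erase v)).erase (r + d + 1)) =
          insert (v + 1) ((insert (r + d) (X.erase (r + d + 1))).erase v) := by
        ext x
        simp only [mem_insert, mem_erase]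
        grind
      rw [h8]
      refine add_left_comm_le (ih (by omega) _ ?_ ?_)
      · simp only [mem_insert, mem_erase]
        exact Or.inr ⟨by omega, h1⟩
      · simp only [mem_insert, mem_erase]
        rintro (h | h)
        exacts [by omega, h2 h.2]

/-- The second family, the companion, has the sources and sinks of a corner minor, and its motion is
forced: in the block `r` its particle at u + r + 1 descends to `r`. The exchange either finishes
inside the block, when the first family takes over the companion's jump to u + r, or it passes to
the next block with the discrepancy one level higher. The number `k` counts the edges above the one
from u + r + 1 to u + r. -/
lemma left_exchange_block {n r u : ℕ}
    (hG : ∀ S : Finset ℕ, r ∉ S → G S = ⊥)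
    (hFG : u + r + 2 < n → ∀ I : Finset ℕ, u + r + 1 ∈ I → u + r + 2 ∉ I →
      F I + G (range (r + 1) ∪ Ico (u + r + 2) n) ≤
        F (insert (u + r + 2) (I.erase (u + r + 1))) +
          G (range (r + 1) ∪ ({u + r + 1} ∪ Ico (u + r + 3) n))) (k : ℕ)
    (hk : u + r + 1 + k < n) (I : Finset ℕ) (h1 : u + r ∈ I) (h2 : u + r + 1 ∉ I) :
    blockVal max (· + ·) W r F (u + 1 + k) I +
        blockVal max (· + ·) W r G (u + 1 + k) (range r ∪ Ico (u + r + 1) n) ≤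
      blockVal max (· + ·) W r F (u + 1 + k) (insert (u + r + 1) (I.erase (u + r))) +
        blockVal max (· + ·) W r G (u + 1 + k) (range r ∪ ({u + r} ∪ Ico (u + r + 2) n)) := by
  have hC : insert (r + u) ((range r ∪ Ico (u + r + 1) n).erase (r + u + 1)) =
      range r ∪ ({u + r} ∪ Ico (u + r + 2) n) := by
    ext x
    simp only [mem_insert, mem_erase, mem_union, mem_range, mem_singleton, mem_Ico]
    omega
  have hGC : blockVal max (· + ·) W r G (u + 1) (range r ∪ Ico (u + r + 1) n) =
      W (r + u + 1) r +
        blockVal max (· + ·) W r G u (range r ∪ ({u + r} ∪ Ico (u + r + 2) n)) := by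
    rw [blockVal_forced bot_sup_eq hG, hC]
    · simp only [mem_union, mem_range, mem_Ico]
      omega
    · intro x
      simp only [mem_union, mem_range, mem_Ico]
      omega
  have hFI : ∀ I : Finset ℕ, u + r ∈ I → u + r + 1 ∉ I →
      W (r + u + 1) r + blockVal max (· + ·) W r F u I ≤
      blockVal max (· + ·) W r F (u + 1) (insert (u + r + 1) (I.erase (u + r))) := by
    intro I h1 h2
    have hI : insert (r + u) ((insert (u + r + 1) (I.erase (u + r))).erase (r + u + 1)) = I := by
      ext x
      simp only [mem_insert, mem_erase]
      grind
    refine le_trans (le_of_eq ?_) (le_slantStep_move ?_ ?_)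
    · rw [hI]
    · simp only [mem_insert]
      omega
    · simp only [mem_insert, mem_erase]
      omega
  induction k generalizing I with
  | zero =>
    -- Here the companion has to jump from u + r + 1 to u + r while `I` cannot move. After the
    -- exchange the first family makes this jump and the companion stays; behind the edge the two
    -- pairs coincide.
    rw [add_zero, hGC]
    have h3 : blockVal max (· + ·) W r F (u + 1) I = blockVal max (· + ·) W r F u I :=
      slantStep_of_not fun h => absurd h (by rwa [add_comm r u])
    rw [h3]
    refine le_trans (le_of_eq ?_) (add_le_add (hFI I h1 h2) le_slantStep)
    abel
  | succ k ih =>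
    have hFI' := hFI I h1 h2
    rw [← add_assoc, blockVal_succ, blockVal_succ, blockVal_succ, blockVal_succ]
    have h3 : slantStep max (· + ·) (r + (u + 1 + k)) (W (r + (u + 1 + k) + 1) r)
          (blockVal max (· + ·) W r G (u + 1 + k)) (range r ∪ Ico (u + r + 1) n) =
        blockVal max (· + ·) W r G (u + 1 + k) (range r ∪ Ico (u + r + 1) n) := by
      refine slantStep_of_not fun _ => ?_
      simp only [mem_union, mem_range, mem_Ico]
      omega
    rw [h3]
    refine slantStep_add_le ((ih (by omega) I h1 h2).trans (add_le_add le_slantStep le_slantStep)) fun h4 h5 => ?_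
    -- The critical edge is the one just above the discrepancy: a particle of `I` jumping to u + r +
    -- 1 occupies the free place. Then the exchanged companion performs this jump and the exchanged
    -- first family the next one. The two pairs now differ at the levels u + r + 1 and u + r + 2,
    -- which is the situation of `left_exchange_lower`.
    rcases Nat.eq_zero_or_pos k with rfl | hk0
    · rw [add_zero] at *
      have h6 : blockVal max (· + ·) W r F (u + 1)
            (insert (r + (u + 1)) (I.erase (r + (u + 1) + 1))) =
          blockVal max (· + ·) W r F u (insert (r + (u + 1)) (I.erase (r + (u + 1) + 1))) := by
        refine slantStep_of_not fun _ => ?_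
        simp only [mem_insert, mem_erase]
        exact Or.inr ⟨by omega, by rwa [add_comm r u]⟩
      rw [hGC, h6]
      have h7 := left_exchange_lower (W := W) (F := F) (G := G) (n := n) (r := r) (v := u + r + 1)
        hG (hFG (by omega)) u (by omega) (insert (u + r + 1) (I.erase (u + r + 2)))
        (mem_insert_self _ _) (by simp)
      have h8 : insert (u + r + 1 + 1) ((insert (u + r + 1) (I.erase (u + r + 2))).erase
          (u + r + 1)) = I := by
        ext x
        simp only [mem_insert, mem_erase]
        grind
      have h9 : insert (r + (u + 1)) ((range r ∪ ({u + r} ∪ Ico (u + r + 2) n)).erase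
          (r + (u + 1) + 1)) = range r ∪ ({r + u} ∪ ({u + r + 1} ∪ Ico (u + r + 1 + 2) n)) := by
        ext x
        simp only [mem_insert, mem_erase, mem_union, mem_range, mem_singleton, mem_Ico]
        omega
      have h10 : W (r + (u + 1) + 1) r + blockVal max (· + ·) W r G u
            (range r ∪ ({r + u} ∪ ({u + r + 1} ∪ Ico (u + r + 1 + 2) n))) ≤
          slantStep max (· + ·) (r + (u + 1)) (W (r + (u + 1) + 1) r)
            (blockVal max (· + ·) W r G (u + 1)) (range r ∪ ({u + r} ∪ Ico (u + r + 2) n)) := by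
        refine le_trans ?_ (le_slantStep_move ?_ ?_)
        · rw [h9]
          exact add_le_add_right le_slantStep _
        · simp only [mem_union, mem_range, mem_singleton, mem_Ico]
          omega
        · simp only [mem_union, mem_range, mem_singleton, mem_Ico]
          omega
      rw [h8] at h7
      refine le_trans ?_ (add_le_add (hFI'.trans le_slantStep) h10)
      rw [show r + (u + 1) = u + r + 1 by omega, show u + r + 1 + 1 = u + r + 2 by omega,
        show r + u + 1 = u + r + 1 by omega, show r + u = u + r by omega] at *
      refine le_trans (le_of_eq ?_) ((add_le_add_right h7 (W (u + r + 1) r + W (u + r + 2) r)).trans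
        (le_of_eq ?_)) <;> abel
    · have h6 : insert (r + (u + 1 + k)) ((insert (u + r + 1) (I.erase (u + r))).erase
            (r + (u + 1 + k) + 1)) = insert (u + r + 1)
          ((insert (r + (u + 1 + k)) (I.erase (r + (u + 1 + k) + 1))).erase (u + r)) := by
        ext x
        simp only [mem_insert, mem_erase]
        grind
      refine le_trans ?_ (add_le_add (le_slantStep_move ?_ ?_) le_slantStep)
      · rw [h6, add_assoc (W _ _), add_assoc (W _ _)]
        refine add_le_add_right (ih (by omega) _ ?_ ?_) _
        · simp only [mem_insert, mem_erase]
          exact Or.inr ⟨by omega, h1⟩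
        · simp only [mem_insert, mem_erase]
          rintro (h | h)
          exacts [by omega, h2 h.2]
      · simp only [mem_insert, mem_erase]
        exact Or.inr ⟨by omega, h4⟩
      · simp only [mem_insert, mem_erase]
        rintro (h | h)
        exacts [by omega, h5 h.2]

/-- The maximal weight of a family of particles which end in the positions `J`. -/
def finalVal (W : ℕ → ℕ → Trop) (J S : Finset ℕ) : Trop := if S = J then ∑ x ∈ J, W x x else ⊥

lemma tailVal_finalVal_eq_bot {n m x : ℕ} {J S : Finset ℕ} (hx : x < n - m)
    (hS : ¬ (x ∈ S ↔ x ∈ J)) : tailVal max (· + ·) W n (finalVal W J) m S = ⊥ :=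
  tailVal_eq_zero_of_untouched (z := (⊥ : Trop)) bot_sup_eq (fun _ => WithBot.add_bot _) hx
    (fun _ h => if_neg h) S hS

/-- After `r` blocks the companion consists of the particles already parked on the levels below `r`
and a full top segment. Its lower end, where the discrepancy sits, rises by one with every block. -/
lemma left_exchange_tail {n u r : ℕ} (J : Finset ℕ) (hr : u + r + 1 < n) (I : Finset ℕ)
    (h1 : u + r ∈ I) (h2 : u + r + 1 ∉ I) :
    tailVal max (· + ·) W n (finalVal W J) (n - r) I +
        tailVal max (· + ·) W n (finalVal W (range (n - 1 - u))) (n - r)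
          (range r ∪ Ico (u + r + 1) n) ≤
      tailVal max (· + ·) W n (finalVal W J) (n - r) (insert (u + r + 1) (I.erase (u + r))) +
        tailVal max (· + ·) W n (finalVal W (range (n - 1 - u))) (n - r)
          (range r ∪ ({u + r} ∪ Ico (u + r + 2) n)) := by
  -- For k = 0 the level u + r + 1 is the top line, and the hypothesis about the next block is
  -- vacuous; this ends the propagation of the discrepancy.
  obtain ⟨k, hk⟩ : ∃ k, n = u + r + 1 + k + 1 := ⟨n - (u + r + 2), by omega⟩
  have hr' : r < n := by omega
  have hG : ∀ r, u + r + 1 < n → ∀ S : Finset ℕ, r ∉ S →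
      tailVal max (· + ·) W n (finalVal W (range (n - 1 - u))) (n - (r + 1)) S = ⊥ := by
    refine fun r hr S hS => tailVal_finalVal_eq_bot (x := r) (by omega) ?_
    simp only [mem_range, hS, false_iff, not_not]
    omega
  induction k generalizing r I with
  | zero =>
    rw [tailVal_of_lt (F := finalVal W J) hr', tailVal_of_lt (F := finalVal W (range _)) hr']
    rw [show n - 1 - r = u + 1 + 0 by omega]
    exact left_exchange_block (n := n) (hG r hr) (by omega) 0 (by omega) I h1 h2
  | succ k ih =>
    rw [tailVal_of_lt (F := finalVal W J) hr', tailVal_of_lt (F := finalVal W (range _)) hr']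
    rw [show n - 1 - r = u + 1 + (k + 1) by omega]
    refine left_exchange_block (n := n) (hG r hr) (fun _ I h1 h2 => ?_) (k + 1) (by omega) I h1 h2
    exact ih (r := r + 1) (by omega) I h1 h2 (by omega) (by omega)

/-- Exchange for a source: a particle at `u` is replaced by a particle at `u + 1`. -/
lemma left_exchange {n u : ℕ} (J : Finset ℕ) (hu : u + 1 < n) (I : Finset ℕ) (h1 : u ∈ I)
    (h2 : u + 1 ∉ I) :
    tailVal max (· + ·) W n (finalVal W J) n I +
        tailVal max (· + ·) W n (finalVal W (range (n - 1 - u))) n (Ico (u + 1) n) ≤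
      tailVal max (· + ·) W n (finalVal W J) n (insert (u + 1) (I.erase u)) +
        tailVal max (· + ·) W n (finalVal W (range (n - 1 - u))) n ({u} ∪ Ico (u + 2) n) := by
  simpa using left_exchange_tail (r := 0) J hu I h1 h2

end Exchange

/-! ### Exchange inequalities for the sinks -/

section RightExchange

variable {W : ℕ → ℕ → Trop} {F F' H H' : Finset ℕ → Trop}

/-- Blocks above the discrepancy between the two families of sinks. -/
lemma right_exchange_upper {n b m : ℕ} {J : Finset ℕ} (hJ : b + 1 ∈ J) (hJ' : b ∉ J)
    (hm : b + 2 + m ≤ n) (I : Finset ℕ) (h1 : b + 1 ∈ I) (h2 : b ∉ I) :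
    tailVal max (· + ·) W n (finalVal W J) m I +
        tailVal max (· + ·) W n (finalVal W (range (b + 1))) m (range (b + 1)) ≤
      tailVal max (· + ·) W n (finalVal W (insert b (J.erase (b + 1)))) m
          (insert b (I.erase (b + 1))) +
        tailVal max (· + ·) W n (finalVal W (insert (b + 1) (range b))) m
          (insert (b + 1) (range b)) := by
  induction m generalizing I with
  | zero =>
    -- Behind all blocks only the final weights of the levels `b` and b + 1 are traded between the
    -- two families.
    change finalVal W J I + finalVal W _ _ ≤ finalVal W _ _ + finalVal W _ _
    simp only [finalVal, if_true]
    by_cases hI : I = J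
    · subst hI
      rw [if_pos rfl, if_pos rfl, sum_insert (by simp [hJ']), sum_insert (by simp), range_add_one,
        sum_insert (by simp), ← add_sum_erase _ _ hJ]
      refine le_of_eq ?_
      abel
    · rw [if_neg hI, WithBot.bot_add]
      exact bot_le
  | succ m ih =>
    have ih := ih (by omega)
    obtain ⟨r, hr⟩ : ∃ r, n - 1 - m = r := ⟨_, rfl⟩
    simp only [tailVal, hr]
    have key : ∀ d I, b + 1 ∈ I → b ∉ I →
        blockVal max (· + ·) W r (tailVal max (· + ·) W n (finalVal W J) m) d I +
          blockVal max (· + ·) W r (tailVal max (· + ·) W n (finalVal W (range (b + 1))) m) d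
            (range (b + 1)) ≤
        blockVal max (· + ·) W r
            (tailVal max (· + ·) W n (finalVal W (insert b (J.erase (b + 1)))) m) d
            (insert b (I.erase (b + 1))) +
          blockVal max (· + ·) W r
            (tailVal max (· + ·) W n (finalVal W (insert (b + 1) (range b))) m) d
            (insert (b + 1) (range b)) := by
      intro d
      induction d with
      | zero => exact ih
      | succ d ihd =>
        intro I h1 h2
        rw [blockVal_succ, blockVal_succ, blockVal_succ, blockVal_succ,
          slantStep_of_not (S := range (b + 1)) (fun h => by rw [mem_range] at *; omega)]
        refine le_trans ?_ (add_le_add_right le_slantStep _)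
        refine slantStep_add_le_slantStep_add (ihd I h1 h2) fun h3 h4 => ⟨?_, ?_, ?_⟩
        · simp only [mem_insert, mem_erase]
          exact Or.inr ⟨by omega, h3⟩
        · simp only [mem_insert, mem_erase]
          rintro (h | h)
          exacts [by omega, h4 h.2]
        · have h5 : insert (r + d) ((insert b (I.erase (b + 1))).erase (r + d + 1)) =
              insert b ((insert (r + d) (I.erase (r + d + 1))).erase (b + 1)) := by
            ext x
            simp only [mem_insert, mem_erase]
            grind
          rw [h5]
          refine ihd _ ?_ ?_
          · simp only [mem_insert, mem_erase]
            exact Or.inr ⟨by omega, h1⟩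
          · simp only [mem_insert, mem_erase]
            rintro (h | h)
            exacts [by omega, h2 h.2]
    exact key m I h1 h2

/-- The block in which a particle moves down to the upper one of the two exchanged sinks. -/
lemma right_exchange_middle {b : ℕ}
    (hF : ∀ S : Finset ℕ, b + 1 ∉ S → F S = ⊥)
    (hFH : ∀ I : Finset ℕ, b + 1 ∈ I → b ∉ I → F I + H (range (b + 1)) ≤
      F' (insert b (I.erase (b + 1))) + H' (insert (b + 1) (range b))) (d : ℕ)
    (I : Finset ℕ) (q : ℕ) (hq : q ∈ I) (hbq : b + 1 ≤ q) (hI : ∀ x, b ≤ x → x < q → x ∉ I) :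
    blockVal max (· + ·) W (b + 1) F d I + blockVal max (· + ·) W (b + 1) H d (range (b + 1)) ≤
      blockVal max (· + ·) W (b + 1) F' d (insert b (I.erase q)) +
        blockVal max (· + ·) W (b + 1) H' d (insert q (range b)) := by
  induction d generalizing I q with
  | zero =>
    -- Behind the block the level b + 1 must be filled, as it is in `J`; so the lowest particle `q`
    -- has arrived there or the value is -∞.
    rcases hbq.eq_or_lt with rfl | h
    · exact hFH I hq (hI b le_rfl (by omega))
    · change F I + _ ≤ _
      rw [hF I (hI _ (by omega) h), WithBot.bot_add]
      exact bot_le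
  | succ d ih =>
    rw [blockVal_succ, blockVal_succ, blockVal_succ, blockVal_succ,
      slantStep_of_not (S := range (b + 1)) (fun h => by rw [mem_range] at *; omega)]
    refine slantStep_add_le ((ih I q hq hbq hI).trans (add_le_add le_slantStep le_slantStep))
      fun h1 h2 => ?_
    have hqle : q ≤ b + 1 + d + 1 := not_lt.1 fun h => hI _ (by omega) h h1
    rcases hqle.eq_or_lt with rfl | hlt
    · have h3 := ih (insert (b + 1 + d) (I.erase (b + 1 + d + 1))) (b + 1 + d)
        (mem_insert_self _ _) (by omega) (fun x hx hx' => by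
          simp only [mem_insert, mem_erase]
          rintro (h | h)
          exacts [by omega, hI x hx (by omega) h.2])
      have h4 : (insert (b + 1 + d) (I.erase (b + 1 + d + 1))).erase (b + 1 + d) =
          I.erase (b + 1 + d + 1) := erase_insert fun h => h2 (mem_of_mem_erase h)
      have h5 : (insert (b + 1 + d + 1) (range b)).erase (b + 1 + d + 1) = range b :=
        erase_insert (by simp; omega)
      rw [h4] at h3
      refine le_trans ?_ (add_le_add le_slantStep
        (le_slantStep_move (mem_insert_self _ _) (by simp; omega)))
      rw [h5, add_assoc (W _ _), add_left_comm _ (W _ _)]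
      exact add_le_add_right h3 _
    · have hne : q ≠ b + 1 + d := fun h => h2 (h ▸ hq)
      refine le_trans ?_ (add_le_add (le_slantStep_move ?_ ?_) le_slantStep)
      · have h5 : insert (b + 1 + d) ((insert b (I.erase q)).erase (b + 1 + d + 1)) =
            insert b ((insert (b + 1 + d) (I.erase (b + 1 + d + 1))).erase q) := by
          ext x
          simp only [mem_insert, mem_erase]
          grind
        rw [h5, add_assoc (W _ _), add_assoc (W _ _)]
        refine add_le_add_right (ih _ q ?_ hbq fun x hx hx' => ?_) _
        · simp only [mem_insert, mem_erase]
          exact Or.inr ⟨by omega, hq⟩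
        · simp only [mem_insert, mem_erase]
          rintro (h | h)
          exacts [by omega, hI x hx hx' h.2]
      · simp only [mem_insert, mem_erase]
        exact Or.inr ⟨by omega, h1⟩
      · simp only [mem_insert, mem_erase]
        rintro (h | h)
        exacts [by omega, h2 h.2]

lemma le_blockVal_descend {r d : ℕ} {S : Finset ℕ} (h1 : r + d ∈ S)
    (h2 : ∀ x, r ≤ x → x < r + d → x ∉ S) :
    ∑ s ∈ range d, W (r + s + 1) r + F (insert r (S.erase (r + d))) ≤
      blockVal max (· + ·) W r F d S := by
  induction d generalizing S with
  | zero =>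
    have : insert r (S.erase (r + 0)) = S := insert_erase h1
    rw [this]
    simp [blockVal]
  | succ d ih =>
    refine le_trans ?_ (le_slantStep_move h1 (h2 _ (by omega) (by omega)))
    have h3 : (insert (r + d) (S.erase (r + d + 1))).erase (r + d) = S.erase (r + d + 1) :=
      erase_insert fun h => h2 _ (by omega) (by omega) (mem_of_mem_erase h)
    have h4 := ih (S := insert (r + d) (S.erase (r + d + 1))) (mem_insert_self _ _) (by
      intro x hx hx'
      simp only [mem_insert, mem_erase]
      rintro (h | h)
      exacts [by omega, h2 x hx (by omega) h.2])
    rw [h3] at h4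
    rw [sum_range_succ, add_comm (∑ s ∈ range d, _), add_assoc]
    exact add_le_add_right h4 _

lemma blockVal_descend {r d : ℕ} (hF : ∀ S : Finset ℕ, r ∉ S → F S = ⊥) {S : Finset ℕ}
    (h1 : r + d ∈ S) (h2 : ∀ x, r ≤ x → x < r + d → x ∉ S) :
    blockVal max (· + ·) W r F d S =
      ∑ s ∈ range d, W (r + s + 1) r + F (insert r (S.erase (r + d))) := by
  induction d generalizing S with
  | zero =>
    have : insert r (S.erase (r + 0)) = S := insert_erase h1
    rw [this]
    simp [blockVal]
  | succ d ih =>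
    have h3 : (insert (r + d) (S.erase (r + d + 1))).erase (r + d) = S.erase (r + d + 1) :=
      erase_insert fun h => h2 _ (by omega) (by omega) (mem_of_mem_erase h)
    rw [blockVal_forced bot_sup_eq hF h1 fun x hx hx' => h2 x hx (by omega), ih
      (mem_insert_self _ _), h3, sum_range_succ]
    · change W (r + d + 1) r + (_ + F (insert r (S.erase (r + d + 1)))) = _ + _ + _
      abel
    · intro x hx hx'
      simp only [mem_insert, mem_erase]
      rintro (h | h)
      exacts [by omega, h2 x hx (by omega) h.2]

/-- The block in which a particle moves down to the lower one of the two exchanged sinks. -/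
lemma right_exchange_lower {b : ℕ}
    (hF : ∀ S : Finset ℕ, b ∈ S → F S = ⊥) (hH : ∀ S : Finset ℕ, b ∉ S → H S = ⊥)
    (hFH : ∀ (I : Finset ℕ) (q : ℕ), q ∈ I → b + 1 ≤ q → (∀ x, b ≤ x → x < q → x ∉ I) →
      F I + H (range (b + 1)) ≤ F' (insert b (I.erase q)) + H' (insert q (range b))) (d : ℕ)
    (I : Finset ℕ) (q : ℕ) (hq : q ∈ I) (hbq : b ≤ q) (hqd : q ≤ b + d)
    (hI : ∀ x, b ≤ x → x < q → x ∉ I) :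
    blockVal max (· + ·) W b F d I + blockVal max (· + ·) W b H d (insert (b + d) (range b)) ≤
      blockVal max (· + ·) W b F' d I +
        blockVal max (· + ·) W b H' d (insert (b + d) (range b)) := by
  induction d generalizing I q with
  | zero =>
    change F I + _ ≤ _
    rw [hF I (by rwa [show b = q by omega]), WithBot.bot_add]
    exact bot_le
  | succ d ih =>
    have h5 : ∀ x, b ≤ x → (insert x (range b)).erase x = range b := fun x hx =>
      erase_insert (by simp; omega)
    have h6 := blockVal_forced (add := max) (mul := (· + ·)) (W := W) (d := d)
      (S := insert (b + (d + 1)) (range b)) bot_sup_eq hH (mem_insert_self _ _) (by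
        intro x; simp only [mem_insert, mem_range]; omega)
    rw [h6, ← add_assoc b d 1, h5 _ (by omega)]
    have h7 := le_slantStep_move (p := b + d) (t := W (b + d + 1) b)
      (F := blockVal max (· + ·) W b H' d) (S := insert (b + d + 1) (range b))
      (mem_insert_self _ _) (by simp)
    rw [h5 _ (by omega)] at h7
    rw [blockVal_succ, blockVal_succ, blockVal_succ]
    rcases hqd.eq_or_lt with hqd | hqd
    · rw [← add_assoc] at hqd
      subst hqd
      have h8 : insert (b + d) (I.erase (b + d + 1)) ⊆ insert (b + d) I :=
        insert_subset_insert _ (erase_subset _ _)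
      have h9 : (insert (b + d) (I.erase (b + d + 1))).erase (b + d) = I.erase (b + d + 1) :=
        erase_insert fun h => hI _ (by omega) (by omega) (mem_of_mem_erase h)
      refine slantStep_add_le ?_ fun h1 h2 => ?_
      -- If `q` stays, nothing in `I` below it can move, while the companion descends all the way to
      -- `b`. In the exchanged pair the first family makes the whole descent and the companion
      -- remains at `q`: the two families have swapped a particle.
      · rw [blockVal_of_free fun x hx hx' => hI x hx.le (by omega),
          blockVal_descend hH (mem_insert_self _ _) (by
            intro x; simp only [mem_insert, mem_range]; omega), h5 _ (by omega),
          insert_eq b (range b), ← insert_eq, ← range_add_one]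
        have h10 := le_blockVal_descend (W := W) (F := F') (r := b) (d := d)
          (S := insert (b + d) (I.erase (b + d + 1))) (mem_insert_self _ _) (by
            intro x hx hx'
            simp only [mem_insert, mem_erase]
            rintro (h | h)
            exacts [by omega, hI x hx (by omega) h.2])
        rw [h9] at h10
        refine le_trans ?_ (add_le_add
          ((add_le_add_right h10 _).trans (le_slantStep_move hq (hI _ (by omega) (by omega))))
          ((le_blockVal (W := W) b d _).trans le_slantStep))
        refine le_trans (le_of_eq ?_) ((add_le_add_right (hFH I _ hq (by omega) hI)
          (W (b + d + 1) b + ∑ s ∈ range d, W (b + s + 1) b)).trans (le_of_eq ?_)) <;> abel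
      -- If `q` jumps, the companion is at the same level and jumps too; the exchange is postponed
      -- to the lower edges.
      · refine le_trans ?_ (add_le_add (le_slantStep_move h1 h2) h7)
        refine le_trans (le_of_eq ?_) ((add_le_add_right (ih
          (insert (b + d) (I.erase (b + d + 1))) (b + d) (mem_insert_self _ _) (by omega) le_rfl
          fun x hx hx' h => ?_)
          (W (b + d + 1) b + W (b + d + 1) b)).trans (le_of_eq ?_))
        · abel
        · rcases mem_insert.1 (h8 h) with h | h
          exacts [by omega, hI x hx (by omega) h]
        · abel
    · refine le_trans ?_ (add_le_add_right h7 _)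
      refine slantStep_add_le_slantStep_add (add_left_comm_le (ih I q hq hbq (by omega) hI))
        fun h1 h2 => ⟨h1, h2, add_left_comm_le (ih _ q ?_ hbq (by omega) fun x hx hx' => ?_)⟩
      · exact mem_insert_of_mem (mem_erase.2 ⟨by omega, hq⟩)
      · have hne : q ≠ b + d := fun h => h2 (h ▸ hq)
        simp only [mem_insert, mem_erase]
        rintro (h | h)
        exacts [by omega, hI x hx hx' h.2]

/-- A block before the two blocks in which the exchange takes place. -/
lemma right_exchange_initial {n r a : ℕ} (hH : ∀ S : Finset ℕ, r ∉ S → H S = ⊥)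
    (hFH : ∀ I, F I + H (range (r + 1) ∪ Ico (a + r + 1) n) ≤
      F' I + H' (range (r + 1) ∪ Ico (a + r + 1) n)) (d : ℕ) (hd : d ≤ a) (I : Finset ℕ) :
    blockVal max (· + ·) W r F d I +
        blockVal max (· + ·) W r H d (range r ∪ ({r + d} ∪ Ico (a + r + 1) n)) ≤
      blockVal max (· + ·) W r F' d I +
        blockVal max (· + ·) W r H' d (range r ∪ ({r + d} ∪ Ico (a + r + 1) n)) := by
  induction d generalizing I with
  | zero =>
    have h3 : ∀ Y, range r ∪ ({r + 0} ∪ Y) = range (r + 1) ∪ Y := fun Y => by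
      rw [range_add_one, insert_eq, ← union_assoc, union_comm (range r), add_zero]
    rw [h3]
    exact hFH I
  | succ d ih =>
    have h3 : insert (r + d) ((range r ∪ ({r + (d + 1)} ∪ Ico (a + r + 1) n)).erase (r + d + 1)) =
        range r ∪ ({r + d} ∪ Ico (a + r + 1) n) := by
      ext x
      simp only [mem_insert, mem_erase, mem_union, mem_range, mem_singleton, mem_Ico]
      omega
    rw [blockVal_forced bot_sup_eq (d := d) hH, h3, blockVal_succ, blockVal_succ, blockVal_succ]
    · have h5 := le_slantStep_move (p := r + d) (t := W (r + d + 1) r)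
        (F := blockVal max (· + ·) W r H' d)
        (S := range r ∪ ({r + (d + 1)} ∪ Ico (a + r + 1) n)) (by
          simp only [mem_union, mem_range, mem_singleton, mem_Ico]
          omega) (by
          simp only [mem_union, mem_range, mem_singleton, mem_Ico]
          omega)
      rw [h3] at h5
      refine le_trans ?_ (add_le_add_right h5 _)
      exact slantStep_add_le_slantStep_add (add_left_comm_le (ih (by omega) I))
        fun h1 h2 => ⟨h1, h2, add_left_comm_le (ih (by omega) _)⟩
    · simp only [mem_union, mem_range, mem_singleton, mem_Ico]
      omega
    · intro x hx hx'
      simp only [mem_union, mem_range, mem_singleton, mem_Ico]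
      omega

/-- The upper `k` edges cannot move the companion, which fills all levels from a + r on; on the
remaining `a` edges its lowest free particle descends to `r`. Both companions move alike, so every
move of the first family is simply copied. -/
lemma right_exchange_initial_block {n r a : ℕ} (hH : ∀ S : Finset ℕ, r ∉ S → H S = ⊥)
    (hFH : ∀ I, F I + H (range (r + 1) ∪ Ico (a + r + 1) n) ≤
      F' I + H' (range (r + 1) ∪ Ico (a + r + 1) n)) (k : ℕ) (hk : a + r + k < n) (I : Finset ℕ) :
    blockVal max (· + ·) W r F (a + k) I +
        blockVal max (· + ·) W r H (a + k) (range r ∪ Ico (a + r) n) ≤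
      blockVal max (· + ·) W r F' (a + k) I +
        blockVal max (· + ·) W r H' (a + k) (range r ∪ Ico (a + r) n) := by
  induction k generalizing I with
  | zero =>
    have h3 : range r ∪ ({r + a} ∪ Ico (a + r + 1) n) = range r ∪ Ico (a + r) n := by
      ext x
      simp only [mem_union, mem_range, mem_singleton, mem_Ico]
      omega
    have := right_exchange_initial (W := W) hH hFH a le_rfl I
    rwa [h3] at this
  | succ k ih =>
    rw [← add_assoc, blockVal_succ, blockVal_succ, blockVal_succ, blockVal_succ,
      slantStep_of_not (S := range r ∪ Ico (a + r) n)]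
    · exact slantStep_add_le_slantStep_add
        ((ih (by omega) I).trans (add_le_add_right le_slantStep _))
        fun h1 h2 => ⟨h1, h2, (ih (by omega) _).trans (add_le_add_right le_slantStep _)⟩
    · intro _
      simp only [mem_union, mem_range, mem_Ico]
      omega

/-- Exchange for a sink: a particle which ends at `b + 1` is replaced by one which ends at `b`. -/
lemma right_exchange {n b : ℕ} {J : Finset ℕ} (hb : b + 1 < n) (hJ : b + 1 ∈ J) (hJ' : b ∉ J)
    (I : Finset ℕ) :
    tailVal max (· + ·) W n (finalVal W J) n I +
        tailVal max (· + ·) W n (finalVal W (range (b + 1))) n (Ico (n - 1 - b) n) ≤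
      tailVal max (· + ·) W n (finalVal W (insert b (J.erase (b + 1)))) n I +
        tailVal max (· + ·) W n (finalVal W (insert (b + 1) (range b))) n (Ico (n - 1 - b) n) := by
  obtain ⟨a, ha⟩ : ∃ a, n = a + b + 1 := ⟨n - 1 - b, by omega⟩
  have hm : ∀ (I : Finset ℕ) (q : ℕ), q ∈ I → b + 1 ≤ q → (∀ x, b ≤ x → x < q → x ∉ I) →
      tailVal max (· + ·) W n (finalVal W J) (n - (b + 1)) I +
        tailVal max (· + ·) W n (finalVal W (range (b + 1))) (n - (b + 1)) (range (b + 1)) ≤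
      tailVal max (· + ·) W n (finalVal W (insert b (J.erase (b + 1)))) (n - (b + 1))
          (insert b (I.erase q)) +
        tailVal max (· + ·) W n (finalVal W (insert (b + 1) (range b))) (n - (b + 1))
          (insert q (range b)) := by
    intro I q hq hbq hI
    rw [tailVal_of_lt (F := finalVal W J) hb, tailVal_of_lt (F := finalVal W (range _)) hb,
      tailVal_of_lt (F := finalVal W (insert b _)) hb,
      tailVal_of_lt (F := finalVal W (insert (b + 1) _)) hb]
    exact right_exchange_middle
      (fun S hS => tailVal_finalVal_eq_bot (x := b + 1) (by omega) (by simp [hS, hJ]))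
      (fun I h1 h2 => right_exchange_upper hJ hJ' (by omega) I h1 h2) _ I q hq hbq hI
  have hl : ∀ r, r ≤ b → ∀ I,
      tailVal max (· + ·) W n (finalVal W J) (n - r) I +
        tailVal max (· + ·) W n (finalVal W (range (b + 1))) (n - r)
          (range r ∪ Ico (a + r) n) ≤
      tailVal max (· + ·) W n (finalVal W (insert b (J.erase (b + 1)))) (n - r) I +
        tailVal max (· + ·) W n (finalVal W (insert (b + 1) (range b))) (n - r)
          (range r ∪ Ico (a + r) n) := by
    intro r hr
    obtain ⟨k, hk⟩ : ∃ k, b = r + k := ⟨b - r, by omega⟩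
    have hH : ∀ r, r ≤ b → ∀ S : Finset ℕ, r ∉ S →
        tailVal max (· + ·) W n (finalVal W (range (b + 1))) (n - (r + 1)) S = ⊥ := by
      refine fun r hr S hS => tailVal_finalVal_eq_bot (x := r) (by omega) ?_
      simp only [mem_range, hS, false_iff, not_not]
      omega
    induction k generalizing r with
    | zero =>
      have hrb : r = b := by omega
      subst hrb
      intro I
      have hrn : r < n := by omega
      rw [tailVal_of_lt (F := finalVal W J) hrn, tailVal_of_lt (F := finalVal W (range _)) hrn,
        tailVal_of_lt (F := finalVal W (insert r _)) hrn,
        tailVal_of_lt (F := finalVal W (insert (r + 1) _)) hrn]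
      -- In front of block `b` only one particle of the companion is not yet parked; it sits on the
      -- top line.
      have hS : range r ∪ Ico (a + r) n = insert (r + (n - 1 - r)) (range r) := by
        ext x
        simp only [mem_union, mem_range, mem_insert, mem_Ico]
        omega
      rw [hS]
      -- The particle to be swapped is the lowest one at or above `b`. If there is none, the sink b
      -- + 1 cannot be reached and the left side is -∞.
      by_cases hq : ∃ q, r ≤ q ∧ q < n ∧ q ∈ I
      · classical
        obtain ⟨h1, h2, h3⟩ := Nat.find_spec hq
        refine right_exchange_lower (fun S hS => ?_) (hH r le_rfl) hm _ I (Nat.find hq) h3 h1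
          (by omega) fun x hx hx' hxI => Nat.find_min hq hx' ⟨hx, by omega, hxI⟩
        exact tailVal_finalVal_eq_bot (x := r) (by omega) (by simp [hS, hJ'])
      · push Not at hq
        rw [blockVal_of_free fun x hx hx' => hq x hx.le (by omega), tailVal_of_lt hb,
          blockVal_of_free fun x hx hx' => hq x (by omega) (by omega),
          tailVal_finalVal_eq_bot (x := r + 1) (by omega), WithBot.bot_add]
        · exact bot_le
        · simp [hJ, hq (r + 1) (by omega) hb]
    | succ k ih =>
      intro I
      have hrn : r < n := by omega
      rw [tailVal_of_lt (F := finalVal W J) hrn, tailVal_of_lt (F := finalVal W (range _)) hrn,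
        tailVal_of_lt (F := finalVal W (insert b _)) hrn,
        tailVal_of_lt (F := finalVal W (insert (b + 1) _)) hrn,
        show n - 1 - r = a + (b - r) by omega]
      exact right_exchange_initial_block (hH r hr) (ih (r + 1) (by omega) (by omega)) _
        (by omega) I
  have := hl 0 (Nat.zero_le _) I
  rw [show n - 1 - b = a by omega]
  simpa using this

end RightExchange

/-! ### Minors in the standard chart -/

section Chart

variable {n : ℕ}

/-- One step of the particle recursion: the edge added on the left acts first on the particles, so
the value in front of it is expressed by the values behind it. -/
lemma minor_slantMatrix_mul {p : ℕ} (hp : p + 1 < n) (t : ℂ) (A : Matrix (Fin n) (Fin n) ℂ)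
    {F : Finset ℕ → ℂ} {J : Finset (Fin n)} (hF : ∀ I, minor A I J = F (I.map Fin.valEmbedding))
    (I : Finset (Fin n)) :
    minor (slantMatrix n (p + 1) t * A) I J =
      slantStep (· + ·) (· * ·) p t F (I.map Fin.valEmbedding) := by
  have hA : ∀ u v, (slantMatrix n (p + 1) t * A) u v =
      A u v + if (u : ℕ) = p + 1 then t * A ⟨p, by omega⟩ v else 0 := by
    intro u v
    rw [slantMatrix, add_mul, one_mul, Matrix.add_apply, smul_mul_assoc, Matrix.smul_apply,
      Matrix.mul_apply, sum_eq_single ⟨p, by omega⟩]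
    · simp [lowerUnit]
    · intro x _ hx
      rw [lowerUnit, Matrix.of_apply, if_neg, zero_mul]
      rintro ⟨-, h⟩
      exact hx (Fin.ext (by dsimp only; omega))
    · simp
  have hmem : ∀ (q : ℕ) (hq : q < n), q ∈ I.map Fin.valEmbedding ↔ ⟨q, hq⟩ ∈ I := by
    intro q hq
    rw [mem_map]
    constructor
    · rintro ⟨x, hx, rfl⟩
      exact hx
    · exact fun h => ⟨_, h, rfl⟩
  rw [minor_add_row A _ t (u₁ := ⟨p, by omega⟩) (u₀ := ⟨p + 1, hp⟩), slantStep]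
  · simp only [hmem p (by omega), hmem _ hp, hF, map_insert, map_erase]
    split_ifs <;> simp
  · simp [Fin.lt_def]
  · intro x hx
    rw [Fin.lt_def] at hx
    rw [Fin.le_def]
    dsimp only at *
    omega
  · intro c
    rw [hA, if_pos rfl]
  · intro x hx
    funext c
    rw [hA, if_neg fun h => hx (Fin.ext h), add_zero]

/-- The value of a family of particles which end in the positions `J`. -/
def finalProd (W : ℕ → ℕ → ℂ) (J S : Finset ℕ) : ℂ := if S = J then ∏ x ∈ J, W x x else 0

lemma minor_diagonal_eq_finalProd (W : ℕ → ℕ → ℂ) (I J : Finset (Fin n)) :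
    minor (Matrix.diagonal fun i : Fin n => W i i) I J =
      finalProd W (J.map Fin.valEmbedding) (I.map Fin.valEmbedding) := by
  rw [minor_diagonal, finalProd, prod_map]
  by_cases h : I = J
  · subst h
    rw [if_pos rfl, if_pos rfl]
    rfl
  · rw [if_neg h, if_neg fun h' => h (map_injective _ h')]

lemma minor_prod_slantedEdges (W : ℕ → ℕ → ℂ) (J : Finset (Fin n)) {m : ℕ} (hm : m ≤ n)
    (I : Finset (Fin n)) :
    minor (((slantedEdges n m).map fun e => slantMatrix n e.1 (W e.1 e.2)).prod *
        Matrix.diagonal fun i : Fin n => W i i) I J =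
      tailVal (· + ·) (· * ·) W n (finalProd W (J.map Fin.valEmbedding)) m
        (I.map Fin.valEmbedding) := by
  induction m generalizing I with
  | zero => simpa [slantedEdges, tailVal] using minor_diagonal_eq_finalProd W I J
  | succ m ih =>
    rw [slantedEdges, List.map_append, List.prod_append, mul_assoc, tailVal]
    have ih := ih (by omega)
    obtain ⟨r, hr⟩ : ∃ r, n - 1 - m = r := ⟨_, rfl⟩
    rw [hr]
    have key : ∀ d I, r + d < n → minor (((blockEdges r d).map fun e =>
          slantMatrix n e.1 (W e.1 e.2)).prod *
          (((slantedEdges n m).map fun e => slantMatrix n e.1 (W e.1 e.2)).prod *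
            Matrix.diagonal fun i : Fin n => W i i)) I J =
        blockVal (· + ·) (· * ·) W r (tailVal (· + ·) (· * ·) W n
          (finalProd W (J.map Fin.valEmbedding)) m) d (I.map Fin.valEmbedding) := by
      intro d
      induction d with
      | zero => simpa [blockEdges, blockVal] using fun I _ => ih I
      | succ d ihd =>
        intro I hd
        rw [blockEdges, List.map_cons, List.prod_cons, mul_assoc, blockVal_succ]
        exact minor_slantMatrix_mul hd _ _ (fun I => ihd I (by omega)) I
    exact key m I (by omega)

lemma standardChart_val (a : EssEdge n → ℂˣ) :
    (standardChart a).val.val =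
      (standardNetwork n).matrix (standardWeighting fun x => (a x : ℂ)) :=
  rfl

lemma minor_standardChart (a : EssEdge n → ℂˣ) (I J : Finset (Fin n)) :
    minor (standardChart a).val.val I J =
      tailVal (· + ·) (· * ·) (edgeWeight 1 fun x => (a x : ℂ)) n
        (finalProd (edgeWeight 1 fun x => (a x : ℂ)) (J.map Fin.valEmbedding)) n
        (I.map Fin.valEmbedding) := by
  rw [standardChart_val, standardNetwork_matrix_eq]
  exact minor_prod_slantedEdges (edgeWeight 1 fun x => (a x : ℂ)) J le_rfl I

/-- The weights of the essential edges as tropical numbers. -/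
def tropEdgeWeight (w : EssEdge n → ℝ) (i j : ℕ) : Trop := (edgeWeight 0 w i j : ℝ)

/-- The tropical minor with rows `I` and columns `J`. -/
def tropMinor (w : EssEdge n → ℝ) (I J : Finset ℕ) : Trop :=
  tailVal max (· + ·) (tropEdgeWeight w) n (finalVal (tropEdgeWeight w) J) n I

/-! ### Positivity of the minors -/

variable {σ : Type*} [Fintype σ]

lemma posTrop_edgeWeight (s : EssEdge n → σ) (i j : ℕ) :
    PosTrop (fun x : σ → ℂˣ => edgeWeight 1 (fun e => (x (s e) : ℂ)) i j)
      (fun w => tropEdgeWeight (fun e => w (s e)) i j) := by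
  simp only [edgeWeight, tropEdgeWeight]
  split_ifs
  · exact posTrop_coord _
  · simpa using posTrop_one

lemma PosTrop.slantStep {W : (σ → ℂˣ) → ℂ} {T : (σ → ℝ) → Trop} {F : (σ → ℂˣ) → Finset ℕ → ℂ}
    {V : (σ → ℝ) → Finset ℕ → Trop} (hW : PosTrop W T)
    (hF : ∀ S, PosTrop (fun x => F x S) (fun w => V w S)) (p : ℕ) (S : Finset ℕ) :
    PosTrop (fun x => BKGZ.slantStep (· + ·) (· * ·) p (W x) (F x) S)
      (fun w => BKGZ.slantStep max (· + ·) p (T w) (V w) S) := by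
  simp only [BKGZ.slantStep]
  split_ifs
  · exact (hF S).add (hW.mul (hF _))
  · exact hF S

lemma PosTrop.blockVal {W : (σ → ℂˣ) → ℕ → ℕ → ℂ} {T : (σ → ℝ) → ℕ → ℕ → Trop}
    {F : (σ → ℂˣ) → Finset ℕ → ℂ} {V : (σ → ℝ) → Finset ℕ → Trop}
    (hW : ∀ i j, PosTrop (fun x => W x i j) (fun w => T w i j))
    (hF : ∀ S, PosTrop (fun x => F x S) (fun w => V w S)) (r d : ℕ) (S : Finset ℕ) :
    PosTrop (fun x => BKGZ.blockVal (· + ·) (· * ·) (W x) r (F x) d S)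
      (fun w => BKGZ.blockVal max (· + ·) (T w) r (V w) d S) := by
  induction d generalizing S with
  | zero => exact hF S
  | succ d ih => exact PosTrop.slantStep (hW _ _) ih _ S

lemma PosTrop.tailVal {W : (σ → ℂˣ) → ℕ → ℕ → ℂ} {T : (σ → ℝ) → ℕ → ℕ → Trop}
    {F : (σ → ℂˣ) → Finset ℕ → ℂ} {V : (σ → ℝ) → Finset ℕ → Trop}
    (hW : ∀ i j, PosTrop (fun x => W x i j) (fun w => T w i j))
    (hF : ∀ S, PosTrop (fun x => F x S) (fun w => V w S)) (m : ℕ) (S : Finset ℕ) :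
    PosTrop (fun x => BKGZ.tailVal (· + ·) (· * ·) (W x) n (F x) m S)
      (fun w => BKGZ.tailVal max (· + ·) (T w) n (V w) m S) := by
  induction m generalizing S with
  | zero => exact hF S
  | succ m ih => exact PosTrop.blockVal hW ih _ _ S

/-- The particle recursion uses only sums and products of edge weights, so it is positive and
tropicalizes step by step with (max, +) in place of (+, ·). -/
lemma posTrop_minor (s : EssEdge n → σ) (I J : Finset (Fin n)) :
    PosTrop (fun x : σ → ℂˣ => minor (standardChart fun e => x (s e)).val.val I J)
      (fun w => tropMinor (fun e => w (s e)) (I.map Fin.valEmbedding)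
        (J.map Fin.valEmbedding)) := by
  simp only [minor_standardChart, tropMinor]
  refine PosTrop.tailVal (posTrop_edgeWeight s) (fun S => ?_) n _
  simp only [finalProd, finalVal]
  split_ifs
  · exact PosTrop.prod _ fun i _ => posTrop_edgeWeight s i i
  · exact posTrop_zero

/-! ### Corner minors -/

/-- Starting from a parked segment and a full top segment, no particle can use the upper edges, and
then the one at a + r is forced down to `r`. Only one history of the block survives. -/
lemma blockVal_corner_mono {r a : ℕ} {F : Finset ℕ → ℂ} {W : ℕ → ℕ → ℂ}
    (hF : ∀ S : Finset ℕ, r ∉ S → F S = 0) (k : ℕ) (hk : a + r + k < n) :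
    blockVal (· + ·) (· * ·) W r F (a + k) (range r ∪ Ico (a + r) n) =
      ((blockEdges r a).map fun e => W e.1 e.2).prod * F (range (r + 1) ∪ Ico (a + r + 1) n) := by
  induction k with
  | succ k ih =>
    rw [← add_assoc, blockVal_succ, slantStep_of_not, ih (by omega)]
    intro _
    simp only [mem_union, mem_range, mem_Ico]
    omega
  | zero =>
    have key : ∀ d ≤ a, blockVal (· + ·) (· * ·) W r F d
        (range r ∪ ({r + d} ∪ Ico (a + r + 1) n)) =
        ((blockEdges r d).map fun e => W e.1 e.2).prod *
          F (range (r + 1) ∪ Ico (a + r + 1) n) := by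
      intro d hd
      induction d with
      | zero =>
        have h3 : ∀ Y, range r ∪ ({r + 0} ∪ Y) = range (r + 1) ∪ Y := fun Y => by
          rw [range_add_one, insert_eq, ← union_assoc, union_comm (range r), add_zero]
        rw [h3]
        simp [blockEdges, blockVal]
      | succ d ih =>
        have h3 : insert (r + d) ((range r ∪ ({r + (d + 1)} ∪ Ico (a + r + 1) n)).erase
            (r + d + 1)) = range r ∪ ({r + d} ∪ Ico (a + r + 1) n) := by
          ext x
          simp only [mem_insert, mem_erase, mem_union, mem_range, mem_singleton, mem_Ico]
          omega
        rw [blockVal_forced zero_add hF, h3, ih (by omega), blockEdges, List.map_cons,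
          List.prod_cons, mul_assoc]
        · simp only [mem_union, mem_range, mem_singleton, mem_Ico]
          omega
        · intro x hx hx'
          simp only [mem_union, mem_range, mem_singleton, mem_Ico]
          omega
    have h3 : range r ∪ ({r + a} ∪ Ico (a + r + 1) n) = range r ∪ Ico (a + r) n := by
      ext x
      simp only [mem_union, mem_range, mem_singleton, mem_Ico]
      omega
    have := key a le_rfl
    rwa [h3] at this

lemma tailVal_range (F : Finset ℕ → ℂ) (W : ℕ → ℕ → ℂ) (m k : ℕ) :
    tailVal (· + ·) (· * ·) W n F k (range m) = F (range m) := by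
  induction k with
  | zero => rfl
  | succ k ih =>
    rw [tailVal]
    have : ∀ d, blockVal (· + ·) (· * ·) W (n - 1 - k) (tailVal (· + ·) (· * ·) W n F k) d
        (range m) = F (range m) := by
      intro d
      induction d with
      | zero => exact ih
      | succ d ihd =>
        rw [blockVal_succ, slantStep_of_not, ihd]
        simp only [mem_range]
        omega
    exact this k

/-- Every block has a single admissible history, so the corner minor is a monomial. The list of its
edges does not depend on the weights, which makes the denominators of the potential invertible and
their tropical values finite. -/
lemma tailVal_corner {a m : ℕ} (h : n = a + m) : ∃ l : List (ℕ × ℕ), ∀ W : ℕ → ℕ → ℂ,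
    tailVal (· + ·) (· * ·) W n (finalProd W (range m)) n (Ico a n) =
      (l.map fun e => W e.1 e.2).prod := by
  have key : ∀ k r, r + k = m → ∃ l : List (ℕ × ℕ), ∀ W : ℕ → ℕ → ℂ,
      tailVal (· + ·) (· * ·) W n (finalProd W (range m)) (n - r) (range r ∪ Ico (a + r) n) =
        (l.map fun e => W e.1 e.2).prod := by
    intro k
    induction k with
    | zero =>
      intro r hr
      refine ⟨(List.range m).map fun i => (i, i), fun W => ?_⟩
      have : range r ∪ Ico (a + r) n = range m := by
        rw [Ico_eq_empty (by omega), union_empty, show r = m by omega]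
      rw [this, tailVal_range, finalProd, if_pos rfl, List.map_map]
      clear h hr this
      induction m with
      | zero => simp
      | succ m ihm => rw [prod_range_succ, ihm, List.range_succ]; simp
    | succ k ih =>
      intro r hr
      obtain ⟨l, hl⟩ := ih (r + 1) (by omega)
      refine ⟨blockEdges r a ++ l, fun W => ?_⟩
      rw [tailVal_of_lt (by omega), List.map_append, List.prod_append, ← hl W,
        show n - 1 - r = a + (m - 1 - r) by omega]
      refine blockVal_corner_mono (fun S hS => ?_) _ (by omega)
      refine tailVal_eq_zero_of_untouched (J := range m) (x := r) zero_add mul_zero (by omega)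
        (fun S hS => if_neg hS) S ?_
      simp only [mem_range, hS, false_iff, not_not]
      omega
  simpa using key m 0 (zero_add m)

end Chart

/-! ### The potential -/

section Potential

variable {n : ℕ}

lemma map_initial {i : ℕ} (hi : i ≤ n) : (initial n i).map Fin.valEmbedding = range i := by
  ext x
  simp only [initial, mem_map, mem_filter, mem_univ, true_and, mem_range, Fin.valEmbedding_apply]
  exact ⟨fun ⟨y, hy, h⟩ => h ▸ hy, fun h => ⟨⟨x, by omega⟩, h, rfl⟩⟩

lemma mem_map_op {I : Finset (Fin n)} {x : ℕ} :
    x ∈ (op I).map Fin.valEmbedding ↔ ∃ y ∈ I, x + y + 1 = n := by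
  simp only [op, mem_map, mem_image, Fin.valEmbedding_apply]
  constructor
  · rintro ⟨-, ⟨y, hy, rfl⟩, rfl⟩
    exact ⟨y, hy, by rw [Fin.val_rev]; omega⟩
  · rintro ⟨y, hy, h⟩
    exact ⟨_, ⟨y, hy, rfl⟩, by rw [Fin.val_rev]; omega⟩

lemma map_op_initial {i : ℕ} (hi : i ≤ n) :
    (op (initial n i)).map Fin.valEmbedding = Ico (n - i) n := by
  ext x
  rw [mem_map_op, mem_Ico]
  simp only [initial, mem_filter, mem_univ, true_and]
  constructor
  · rintro ⟨y, hy, h⟩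
    omega
  · intro h
    exact ⟨⟨n - 1 - x, by omega⟩, by dsimp only; omega, by dsimp only; omega⟩

lemma map_skipped {i : ℕ} (hi : i + 1 < n) :
    (skipped n (i + 1)).map Fin.valEmbedding = insert (i + 1) (range i) := by
  ext x
  simp only [skipped, mem_map, mem_filter, mem_univ, true_and, mem_range, Fin.valEmbedding_apply,
    mem_insert]
  constructor
  · rintro ⟨y, hy, rfl⟩
    omega
  · intro h
    exact ⟨⟨x, by omega⟩, by dsimp only; omega, rfl⟩

lemma map_op_skipped {i u : ℕ} (hi : 1 ≤ i) (hu : u + i + 1 = n) :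
    (op (skipped n i)).map Fin.valEmbedding = {u} ∪ Ico (u + 2) n := by
  ext x
  rw [mem_map_op]
  simp only [skipped, mem_filter, mem_univ, true_and, mem_union, mem_singleton, mem_Ico]
  constructor
  · rintro ⟨y, hy, h⟩
    omega
  · intro h
    exact ⟨⟨n - 1 - x, by omega⟩, by dsimp only; omega, by dsimp only; omega⟩

/-! ### Positivity of the potential -/

variable {σ : Type*} [Fintype σ]

lemma posTrop_inv_coord (s : σ) :
    PosTrop (fun x : σ → ℂˣ => (x s : ℂ)⁻¹) (fun w => ((-w s : ℝ) : Trop)) := by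
  classical
  refine (posTrop_monomial (Pi.single s (-1) : σ → ℤ)).congr (fun x => ?_) fun w => ?_
  · rw [prod_eq_single s (fun t _ h => by simp [h]) (by simp)]
    simp
  · rw [sum_eq_single s (fun t _ h => by simp [h]) (by simp)]
    simp

lemma exists_posTrop_list_prod (s : EssEdge n → σ) (l : List (ℕ × ℕ)) :
    ∃ c : (σ → ℝ) → ℝ,
      PosTrop (fun x : σ → ℂˣ =>
        (l.map fun e => edgeWeight 1 (fun e => (x (s e) : ℂ)) e.1 e.2).prod) (fun w => (c w : Trop)) ∧
      PosTrop (fun x : σ → ℂˣ =>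
        (l.map fun e => edgeWeight 1 (fun e => (x (s e) : ℂ)) e.1 e.2).prod⁻¹)
        (fun w => ((-c w : ℝ) : Trop)) := by
  induction l with
  | nil => exact ⟨fun _ => 0, by simpa using posTrop_one, by simpa using posTrop_one⟩
  | cons e l ih =>
    obtain ⟨c, h1, h2⟩ := ih
    refine ⟨fun w => edgeWeight 0 (fun e => w (s e)) e.1 e.2 + c w, ?_, ?_⟩
    · simp only [List.map_cons, List.prod_cons, WithBot.coe_add]
      exact (posTrop_edgeWeight s e.1 e.2).mul h1
    · simp only [List.map_cons, List.prod_cons, mul_inv, neg_add, WithBot.coe_add]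
      refine PosTrop.mul ?_ h2
      simp only [edgeWeight]
      split_ifs
      · exact posTrop_inv_coord _
      · simpa using posTrop_one

lemma exists_posTrop_corner (s : EssEdge n → σ) {i : ℕ} (hi : i ≤ n) :
    ∃ c : (σ → ℝ) → ℝ,
      (∀ w, tropMinor (fun e => w (s e)) (Ico (n - i) n) (range i) = (c w : Trop)) ∧
      PosTrop (fun x : σ → ℂˣ => (minor (standardChart fun e => x (s e)).val.val
        (op (initial n i)) (initial n i))⁻¹) (fun w => ((-c w : ℝ) : Trop)) := by
  obtain ⟨l, hl⟩ := tailVal_corner (n := n) (a := n - i) (m := i) (by omega)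
  obtain ⟨c, h1, h2⟩ := exists_posTrop_list_prod s l
  have h : ∀ x : σ → ℂˣ, minor (standardChart fun e => x (s e)).val.val (op (initial n i))
      (initial n i) = (l.map fun e => edgeWeight 1 (fun e => (x (s e) : ℂ)) e.1 e.2).prod := by
    intro x
    rw [minor_standardChart, map_op_initial hi, map_initial hi, hl]
  refine ⟨c, fun w => ?_, h2.congr (fun x => by rw [h]) fun _ => rfl⟩
  have h3 := (posTrop_minor s (op (initial n i)) (initial n i)).unique
    (h1.congr (fun x => h x) fun _ => rfl) w
  rwa [map_op_initial hi, map_initial hi] at h3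

lemma tropMinor_corner_ne_bot (w : EssEdge n → ℝ) {i : ℕ} (hi : i ≤ n) :
    tropMinor w (Ico (n - i) n) (range i) ≠ ⊥ := by
  obtain ⟨c, hc, -⟩ := exists_posTrop_corner (id : EssEdge n → EssEdge n) hi
  exact (hc w).symm ▸ WithBot.coe_ne_bot

/-- The tropical potential is nonpositive. -/
def PotentialNonpos (w : EssEdge n → ℝ) : Prop :=
  (∀ u, u + 1 < n → tropMinor w ({u} ∪ Ico (u + 2) n) (range (n - 1 - u)) ≤
    tropMinor w (Ico (u + 1) n) (range (n - 1 - u))) ∧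
  ∀ b, b + 1 < n → tropMinor w (Ico (n - 1 - b) n) (insert (b + 1) (range b)) ≤
    tropMinor w (Ico (n - 1 - b) n) (range (b + 1))

lemma add_neg_coe_le_zero (x : Trop) (c : ℝ) : x + ((-c : ℝ) : Trop) ≤ 0 ↔ x ≤ c := by
  induction x using WithBot.recBotCoe with
  | bot => simp
  | coe x =>
    rw [← WithBot.coe_add, ← WithBot.coe_zero, WithBot.coe_le_coe, WithBot.coe_le_coe]
    constructor <;> intro h <;> linarith

/-- Division by a monomial subtracts its finite tropical value. A maximum is nonpositive exactly if
every entry is, so the condition splits into comparisons of the numerator minors with the corner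
minors; the summand `i` corresponds to u = n - 1 - i and b = i - 1. -/
lemma exists_posTrop_potential (s : EssEdge n → σ) :
    ∃ τ : (σ → ℝ) → Trop,
      PosTrop (fun x : σ → ℂˣ => potential (standardChart fun e => x (s e)).val) τ ∧
      ∀ w, τ w ≤ 0 ↔ PotentialNonpos fun e => w (s e) := by
  have hc : ∀ i, ∃ c : (σ → ℝ) → ℝ, i ≤ n →
      (∀ w, tropMinor (fun e => w (s e)) (Ico (n - i) n) (range i) = (c w : Trop)) ∧
      PosTrop (fun x : σ → ℂˣ => (minor (standardChart fun e => x (s e)).val.val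
        (op (initial n i)) (initial n i))⁻¹) (fun w => ((-c w : ℝ) : Trop)) := by
    intro i
    by_cases hi : i ≤ n
    · obtain ⟨c, hc⟩ := exists_posTrop_corner s hi
      exact ⟨c, fun _ => hc⟩
    · exact ⟨0, fun h => absurd h hi⟩
  choose c hc using hc
  refine ⟨fun w => (Icc 1 (n - 1)).sup fun i =>
    (tropMinor (fun e => w (s e)) ((op (skipped n i)).map Fin.valEmbedding)
        ((initial n i).map Fin.valEmbedding) ⊔
      tropMinor (fun e => w (s e)) ((op (initial n i)).map Fin.valEmbedding)
        ((skipped n i).map Fin.valEmbedding)) + ((-c i w : ℝ) : Trop),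
    PosTrop.sum (Icc 1 (n - 1)) fun i hi => ?_, fun w => ?_⟩
  · rw [mem_Icc] at hi
    simp only [div_eq_mul_inv]
    exact ((posTrop_minor s _ _).add (posTrop_minor s _ _)).mul (hc i (by omega)).2
  · simp only [Finset.sup_le_iff, mem_Icc, add_neg_coe_le_zero, sup_le_iff]
    constructor
    · intro h
      refine ⟨fun u hu => ?_, fun b hb => ?_⟩
      · have h1 := (h (n - 1 - u) (by omega)).1
        rwa [map_op_skipped (u := u) (by omega) (by omega), map_initial (by omega),
          ← (hc (n - 1 - u) (by omega)).1, show n - (n - 1 - u) = u + 1 by omega] at h1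
      · have h1 := (h (b + 1) (by omega)).2
        rwa [map_skipped hb, map_op_initial (by omega), ← (hc (b + 1) (by omega)).1,
          show n - (b + 1) = n - 1 - b by omega] at h1
    · rintro ⟨h1, h2⟩ i hi
      obtain ⟨b, rfl⟩ : ∃ b, i = b + 1 := ⟨i - 1, by omega⟩
      obtain ⟨u, hu⟩ : ∃ u, u + (b + 1) + 1 = n := ⟨n - 1 - (b + 1), by omega⟩
      have h3 := h1 u (by omega)
      have h4 := h2 b (by omega)
      rw [map_op_skipped (u := u) (by omega) hu, map_initial (by omega), map_skipped (by omega),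
        map_op_initial (by omega), ← (hc (b + 1) (by omega)).1]
      rw [show n - 1 - u = b + 1 by omega] at h3
      rw [show n - 1 - b = u + 1 by omega] at h4
      rw [show n - (b + 1) = u + 1 by omega]
      exact ⟨h3, h4⟩

/-! ### Monotonicity of the tropical minors -/

/-- A particle moves up by one. -/
def StepUp (n : ℕ) (A B : Finset ℕ) : Prop :=
  ∃ u, u + 1 < n ∧ u ∈ A ∧ u + 1 ∉ A ∧ B = insert (u + 1) (A.erase u)

lemma le_of_exchange {f f' c c' : Trop} (h : f + c ≤ f' + c') (hc : c' ≤ c) (h0 : c ≠ ⊥) :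
    f ≤ f' := by
  have h1 : f + c ≤ f' + c := h.trans (add_le_add_right hc _)
  exact (WithBot.add_le_add_iff_right h0).1 h1

/-- For one upward move, `left_exchange` bounds the loss by the difference between a numerator and
its corner minor, which the potential makes nonpositive; the corner term is finite and cancels. -/
lemma PotentialNonpos.mono_left {w : EssEdge n → ℝ} (hw : PotentialNonpos w) (J : Finset ℕ)
    {A B : Finset ℕ} (h : Relation.ReflTransGen (StepUp n) A B) :
    tropMinor w A J ≤ tropMinor w B J := by
  induction h with
  | refl => exact le_rfl
  | tail _ h ih =>
    obtain ⟨u, hu, h1, h2, rfl⟩ := h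
    refine ih.trans (le_of_exchange (left_exchange J hu _ h1 h2) (hw.1 u hu) ?_)
    have := tropMinor_corner_ne_bot w (i := n - 1 - u) (by omega)
    rwa [show n - (n - 1 - u) = u + 1 by omega] at this

/-- The move is read backwards: `right_exchange` lowers a sink from b + 1 to `b`, hence the reversed
inequality. -/
lemma PotentialNonpos.mono_right {w : EssEdge n → ℝ} (hw : PotentialNonpos w) (I : Finset ℕ)
    {A B : Finset ℕ} (h : Relation.ReflTransGen (StepUp n) A B) :
    tropMinor w I B ≤ tropMinor w I A := by
  induction h with
  | refl => exact le_rfl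
  | @tail A' B' _ h ih =>
    obtain ⟨b, hb, h1, h2, rfl⟩ := h
    refine le_trans ?_ ih
    have h3 := right_exchange (W := tropEdgeWeight w) (J := insert (b + 1) (A'.erase b)) hb
      (mem_insert_self _ _) (by simp) I
    have h4 : insert b ((insert (b + 1) (A'.erase b)).erase (b + 1)) = A' := by
      rw [erase_insert fun h => h2 (mem_of_mem_erase h), insert_erase h1]
    rw [h4] at h3
    refine le_of_exchange h3 (hw.2 b hb) ?_
    have := tropMinor_corner_ne_bot w (i := b + 1) (by omega)
    rwa [show n - (b + 1) = n - 1 - b by omega] at this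

/-- The dominance order is generated by the moves of a particle by one. -/
lemma reflTransGen_stepUp {n : ℕ} {A B : Finset ℕ} (hB : ∀ x ∈ B, x < n) (hcard : A.card = B.card)
    (h : ∀ x, (A.filter (x ≤ ·)).card ≤ (B.filter (x ≤ ·)).card) :
    Relation.ReflTransGen (StepUp n) A B := by
  -- This sum drops with each move. Truncated subtraction is harmless, because the moved particle
  -- lies below an element of `B`, hence below `n`.
  obtain ⟨N, hN⟩ : ∃ N, ∑ x ∈ A, (n - x) = N := ⟨_, rfl⟩
  induction N using Nat.strong_induction_on generalizing A with
  | _ N ih =>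
  by_cases hAB : A = B
  · exact hAB ▸ Relation.ReflTransGen.refl
  have hne : (B \ A).Nonempty := by
    rw [sdiff_nonempty]
    exact fun h => hAB (eq_of_subset_of_card_le h hcard.le).symm
  have hne' : ((B \ A) ∪ (A \ B)).Nonempty := hne.mono subset_union_left
  -- the largest element of the symmetric difference
  set y := ((B \ A) ∪ (A \ B)).max' hne' with hy
  have hmax : ∀ x, y < x → (x ∈ A ↔ x ∈ B) := by
    intro x hx
    by_contra hc
    refine absurd (le_max' _ x ?_) (not_le.2 hx)
    simp only [mem_union, mem_sdiff]
    tauto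
  have hyB : y ∈ B ∧ y ∉ A := by
    have h1 := max'_mem _ hne'
    rw [← hy, mem_union, mem_sdiff, mem_sdiff] at h1
    refine h1.resolve_right fun h2 => ?_
    have h3 : B.filter (y ≤ ·) ⊂ A.filter (y ≤ ·) := by
      refine Finset.ssubset_iff_subset_ne.2 ⟨fun x hx => ?_, fun hc => ?_⟩
      · rw [mem_filter] at hx ⊢
        refine ⟨?_, hx.2⟩
        rcases hx.2.eq_or_lt with h | h
        · exact h ▸ h2.1
        · exact (hmax x h).2 hx.1
      · have : y ∈ B.filter (y ≤ ·) := hc ▸ mem_filter.2 ⟨h2.1, le_rfl⟩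
        exact h2.2 (mem_filter.1 this).1
    exact absurd (h y) (not_le.2 (card_lt_card h3))
  have hex : (A.filter (· < y)).Nonempty := by
    by_contra hc
    rw [not_nonempty_iff_eq_empty, filter_eq_empty_iff] at hc
    refine absurd hcard (ne_of_lt (card_lt_card (Finset.ssubset_iff_subset_ne.2 ⟨fun x hx => ?_, hAB⟩)))
    have h1 : y ≤ x := not_lt.1 (hc hx)
    exact (hmax x (lt_of_le_of_ne h1 fun h => hyB.2 (h ▸ hx))).1 hx
  -- The particle to move is the one of `A` closest below the largest discrepancy `y`, which belongs
  -- to `B`.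
  set u := (A.filter (· < y)).max' hex with hu
  have huA : u ∈ A ∧ u < y := mem_filter.1 (max'_mem _ hex)
  have humax : ∀ x, u < x → x ≤ y → x ∉ A := by
    intro x hx hxy hxA
    rcases hxy.eq_or_lt with rfl | hlt
    · exact hyB.2 hxA
    · exact absurd (le_max' _ x (mem_filter.2 ⟨hxA, hlt⟩)) (not_le.2 hx)
  have hyn := hB y hyB.1
  have hu1 : u + 1 ∉ A := humax _ (by omega) (by omega)
  have hstep : StepUp n A (insert (u + 1) (A.erase u)) := ⟨u, by omega, huA.1, hu1, rfl⟩
  refine Relation.ReflTransGen.head hstep (ih _ ?_ ?_ ?_ rfl)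
  · rw [← hN, sum_insert fun h => hu1 (mem_of_mem_erase h), ← add_sum_erase A _ huA.1]
    omega
  · rw [card_insert_of_notMem fun h => hu1 (mem_of_mem_erase h), card_erase_add_one huA.1, hcard]
  · intro x
    -- Only the count from u + 1 on grows. There `B` has room: all other counted elements lie above
    -- `y` and hence in `B`, and `y` itself makes up for u + 1.
    by_cases hx : x = u + 1
    · subst hx
      have h1 : (insert (u + 1) (A.erase u)).filter (u + 1 ≤ ·) ⊆ B.filter (y ≤ ·) \ {y} ∪ {u + 1} := by
        intro x hx
        rw [mem_filter, mem_insert, mem_erase] at hx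
        rw [mem_union, mem_singleton, mem_sdiff, mem_filter, mem_singleton]
        rcases hx.1 with h | h
        · exact Or.inr h
        · have h2 : y < x := not_le.1 fun h3 => humax x (by omega) h3 h.2
          exact Or.inl ⟨⟨(hmax x h2).1 h.2, h2.le⟩, h2.ne'⟩
      refine (card_le_card h1).trans ((card_union_le _ _).trans ?_)
      have h2 : y ∈ B.filter (y ≤ ·) := mem_filter.2 ⟨hyB.1, le_rfl⟩
      rw [card_singleton, ← erase_eq, card_erase_add_one h2]
      refine card_le_card fun x hx => ?_
      rw [mem_filter] at hx ⊢
      exact ⟨hx.1, by omega⟩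
    · refine le_trans (le_of_eq ?_) (h x)
      by_cases hxu : x ≤ u
      · rw [filter_insert, if_pos (by omega), filter_erase, card_insert_of_notMem,
          card_erase_add_one (mem_filter.2 ⟨huA.1, hxu⟩)]
        exact fun h => hu1 (mem_filter.1 (mem_of_mem_erase h)).1
      · rw [filter_insert, if_neg (by omega), filter_erase, erase_eq_of_notMem]
        exact fun h => hxu (mem_filter.1 h).2

end Potential

/-! ### Tropical minors and disjoint paths -/

section DisjointPaths

variable {n : ℕ}

open Classical in
/-- The tropical weight of an edge, `-∞` for a missing edge. -/
def tropStepMatrix (w : EssEdge n → ℝ) (c : ℕ) (u v : Fin n) : Trop :=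
  if (standardNetwork n).IsEdge c u v then tropStandardWeighting w c u v else ⊥

/-- The tropical minor of a column of the standard network. -/
def tropStepMinor (w : EssEdge n → ℝ) (c : ℕ) (I J : Finset (Fin n)) : Trop :=
  if h : J.card = I.card then
    ∑ a, tropStepMatrix w c (I.orderEmbOfFin rfl a) (J.orderEmbOfFin h a)
  else ⊥

open Classical in
lemma posTrop_stepMatrix (c : ℕ) (u v : Fin n) :
    PosTrop (fun x : EssEdge n → ℂˣ =>
        (standardNetwork n).stepMatrix (standardWeighting fun e => (x e : ℂ)) c u v)
      (fun w => tropStepMatrix w c u v) := by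
  simp only [PlanarNetwork.stepMatrix, Matrix.of_apply, tropStepMatrix]
  split_ifs
  · simp only [standardWeighting, tropStandardWeighting]
    refine PosTrop.prod _ fun e _ => ?_
    split_ifs
    · exact posTrop_coord e
    · exact posTrop_one
  · exact posTrop_zero

lemma PlanarNetwork.isEdge_of_stepMatrix_ne_zero {N : PlanarNetwork n}
    {w : ℕ → Fin n → Fin n → ℂ} {c : ℕ} {u v : Fin n} (h : N.stepMatrix w c u v ≠ 0) :
    N.IsEdge c u v := by
  classical
  by_contra hc
  exact h (if_neg hc)

lemma posTrop_step_minor (c : ℕ) (I J : Finset (Fin n)) :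
    PosTrop (fun x : EssEdge n → ℂˣ =>
        minor ((standardNetwork n).stepMatrix (standardWeighting fun e => (x e : ℂ)) c) I J)
      (fun w => tropStepMinor w c I J) := by
  by_cases h : J.card = I.card
  · have key : ∀ x : EssEdge n → ℂˣ,
        minor ((standardNetwork n).stepMatrix (standardWeighting fun e => (x e : ℂ)) c) I J =
          ∏ a, (standardNetwork n).stepMatrix (standardWeighting fun e => (x e : ℂ)) c
            (I.orderEmbOfFin rfl a) (J.orderEmbOfFin h a) := by
      intro x
      rw [← minor_planar _ _ (OrderEmbedding.strictMono _) (OrderEmbedding.strictMono _),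
        image_orderEmbOfFin_univ, image_orderEmbOfFin_univ]
      intro u v u' v' huv huv' hlt
      exact (standardNetwork n).planar c u v u' v'
        (PlanarNetwork.isEdge_of_stepMatrix_ne_zero huv)
        (PlanarNetwork.isEdge_of_stepMatrix_ne_zero huv') hlt
    refine (PosTrop.prod univ fun a _ => posTrop_stepMatrix c (I.orderEmbOfFin rfl a)
      (J.orderEmbOfFin h a)).congr key fun w => ?_
    rw [tropStepMinor, dif_pos h]
  · exact posTrop_zero.congr (fun x => minor_of_card_ne _ h) fun w => dif_neg h

/-- A second positive evaluation of the same minor, by Cauchy–Binet over the grid columns instead of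
the blocks. Uniqueness of the tropicalization identifies it with the particle recursion. -/
lemma tropMinor_eq_sup_chains (w : EssEdge n → ℝ) (I J : Finset (Fin n)) :
    tropMinor w (I.map Fin.valEmbedding) (J.map Fin.valEmbedding) =
      (univ.filter fun K : Fin ((standardNetwork n).width + 1) → Finset (Fin n) =>
        K 0 = I ∧ K (Fin.last _) = J).sup
        fun K => ∑ c : Fin (standardNetwork n).width, tropStepMinor w c (K c.castSucc) (K c.succ) := by
  have h := PosTrop.sum (univ.filter fun K : Fin ((standardNetwork n).width + 1) →
      Finset (Fin n) => K 0 = I ∧ K (Fin.last _) = J) fun K _ =>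
    PosTrop.prod (univ : Finset (Fin (standardNetwork n).width)) fun c _ =>
      posTrop_step_minor (c : ℕ) (K c.castSucc) (K c.succ)
  refine (posTrop_minor (id : EssEdge n → EssEdge n) I J).unique (h.congr (fun x => ?_)
    fun w => rfl) w
  rw [standardChart_val, PlanarNetwork.matrix_eq_prod, minor_list_ofFn_prod]
  rfl

lemma tropStepMatrix_of_isEdge {w : EssEdge n → ℝ} {c : ℕ} {u v : Fin n}
    (h : (standardNetwork n).IsEdge c u v) :
    tropStepMatrix w c u v = tropStandardWeighting w c u v :=
  if_pos h

/-- Planarity makes the order of the end points that of the starting points, so the increasing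
enumerations pair each `s x` with `t x`. -/
lemma tropStepMinor_image {ι : Type*} [Fintype ι] (w : EssEdge n → ℝ) (c : ℕ) {s t : ι → Fin n}
    (hs : Function.Injective s) (ht : Function.Injective t)
    (hst : ∀ x, (standardNetwork n).IsEdge c (s x) (t x)) :
    tropStepMinor w c (univ.image s) (univ.image t) =
      ∑ x, tropStandardWeighting w c (s x) (t x) := by
  have hcard : (univ.image t).card = (univ.image s).card := by
    rw [card_image_of_injective _ hs, card_image_of_injective _ ht]
  rw [tropStepMinor, dif_pos hcard]
  set r := (univ.image s).orderEmbOfFin rfl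
  have hmem : ∀ a, ∃ x, s x = r a := by
    intro a
    obtain ⟨x, -, hx⟩ := mem_image.1 (orderEmbOfFin_mem (univ.image s) rfl a)
    exact ⟨x, hx⟩
  choose e he using hmem
  have hmono : StrictMono fun a => t (e a) := by
    intro a b hab
    refine lt_of_le_of_ne ((standardNetwork n).planar c _ _ _ _ (hst (e a)) (hst (e b)) ?_) ?_
    · rw [he, he]
      exact r.strictMono hab
    · intro h
      have := congrArg s (ht h)
      rw [he, he] at this
      exact hab.ne (r.injective this)
  have ht' := orderEmbOfFin_unique hcard (fun a => mem_image_of_mem t (mem_univ (e a))) hmono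
  have hbij : Function.Bijective e := by
    constructor
    · intro a b hab
      refine r.injective ?_
      rw [← he, ← he, hab]
    · intro x
      have : s x ∈ Set.range r := by
        rw [range_orderEmbOfFin]
        exact mem_coe.2 (mem_image_of_mem s (mem_univ x))
      obtain ⟨a, ha⟩ := this
      exact ⟨a, hs ((he a).trans ha)⟩
  refine Fintype.sum_bijective e hbij _ _ fun a => ?_
  rw [← ht', ← tropStepMatrix_of_isEdge (hst (e a)), he]

lemma sum_tropWeight_le_tropMinor {ι : Type*} [Fintype ι] (w : EssEdge n → ℝ)
    (p : ι → Fin ((standardNetwork n).width + 1) → Fin n)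
    (hp : ∀ x, (standardNetwork n).IsPath (p x))
    (hd : ∀ c, Function.Injective fun x => p x c) :
    ∑ x, (standardNetwork n).tropWeight (tropStandardWeighting w) (p x) ≤
      tropMinor w ((univ.image fun x => p x 0).map Fin.valEmbedding)
        ((univ.image fun x => p x (Fin.last _)).map Fin.valEmbedding) := by
  rw [tropMinor_eq_sup_chains]
  refine le_trans (le_of_eq ?_) (le_sup (f := fun K => _)
    (b := fun c => univ.image fun x => p x c) (mem_filter.2 ⟨mem_univ _, rfl, rfl⟩))
  simp only [PlanarNetwork.tropWeight]
  rw [sum_comm]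
  refine sum_congr rfl fun c _ => ?_
  exact (tropStepMinor_image w c (hd _) (hd _) fun x => hp x c).symm

lemma sum_ne_bot_apply {ι : Type*} {s : Finset ι} {f : ι → Trop} (h : ∑ i ∈ s, f i ≠ ⊥) :
    ∀ i ∈ s, f i ≠ ⊥ := by
  classical
  intro i hi hf
  rw [← add_sum_erase s f hi, hf, WithBot.bot_add] at h
  exact h rfl

/-- In an optimal chain of finite value all sets have the same size and consecutive sets are joined
in increasing order by edges; following the a-th smallest element through the columns gives disjoint
paths. -/
lemma exists_paths_of_tropMinor_ne_bot (w : EssEdge n → ℝ) (I J : Finset (Fin n))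
    (h : tropMinor w (I.map Fin.valEmbedding) (J.map Fin.valEmbedding) ≠ ⊥) :
    ∃ (m : ℕ) (p : Fin m → Fin ((standardNetwork n).width + 1) → Fin n),
      (∀ a, (standardNetwork n).IsPath (p a)) ∧ (∀ c, Function.Injective fun a => p a c) ∧
      (univ.image fun a => p a 0) = I ∧ (univ.image fun a => p a (Fin.last _)) = J ∧
      ∑ a, (standardNetwork n).tropWeight (tropStandardWeighting w) (p a) =
        tropMinor w (I.map Fin.valEmbedding) (J.map Fin.valEmbedding) := by
  rw [tropMinor_eq_sup_chains] at h ⊢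
  have hne : (univ.filter fun K : Fin ((standardNetwork n).width + 1) → Finset (Fin n) =>
        K 0 = I ∧ K (Fin.last _) = J).Nonempty := by
    by_contra hc
    rw [not_nonempty_iff_eq_empty] at hc
    exact h (by rw [hc, sup_empty])
  obtain ⟨K, hK, hsup⟩ := exists_mem_eq_sup _ hne
    fun K => ∑ c : Fin (standardNetwork n).width, tropStepMinor w c (K c.castSucc) (K c.succ)
  rw [hsup] at h ⊢
  obtain ⟨-, hK0, hKl⟩ := mem_filter.1 hK
  have hstep := sum_ne_bot_apply h
  have hcard' : ∀ c : Fin (standardNetwork n).width, (K c.succ).card = (K c.castSucc).card := by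
    intro c
    by_contra hc
    exact hstep c (mem_univ _) (dif_neg hc)
  have hcard : ∀ c, (K c).card = I.card := by
    intro c
    induction c using Fin.induction with
    | zero => rw [hK0]
    | succ c ih => rw [hcard', ih]
  have hval : ∀ c : Fin (standardNetwork n).width,
      tropStepMinor w c (K c.castSucc) (K c.succ) =
        ∑ a, tropStepMatrix w c ((K c.castSucc).orderEmbOfFin (hcard _) a)
          ((K c.succ).orderEmbOfFin (hcard _) a) := by
    intro c
    rw [tropStepMinor, dif_pos (hcard' c)]
    have : ∀ (m : ℕ) (h : (K c.castSucc).card = m) (h' : (K c.succ).card = (K c.castSucc).card),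
        ∑ a, tropStepMatrix w c ((K c.castSucc).orderEmbOfFin rfl a)
          ((K c.succ).orderEmbOfFin h' a) =
        ∑ a, tropStepMatrix w c ((K c.castSucc).orderEmbOfFin h a)
          ((K c.succ).orderEmbOfFin (h'.trans h) a) := by
      rintro m rfl h'
      rfl
    exact this _ (hcard _) _
  have hedge : ∀ (c : Fin (standardNetwork n).width) (a : Fin I.card),
      (standardNetwork n).IsEdge c ((K c.castSucc).orderEmbOfFin (hcard _) a)
        ((K c.succ).orderEmbOfFin (hcard _) a) := by
    intro c a
    have h1 := hstep c (mem_univ _)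
    rw [hval] at h1
    have h2 := sum_ne_bot_apply h1 a (mem_univ _)
    by_contra hc
    exact h2 (if_neg hc)
  refine ⟨I.card, fun a c => (K c).orderEmbOfFin (hcard c) a, fun a c => hedge c a,
    fun c => ((K c).orderEmbOfFin (hcard c)).injective, ?_, ?_, ?_⟩
  · exact (image_orderEmbOfFin_univ (K 0) (hcard 0)).trans hK0
  · exact (image_orderEmbOfFin_univ _ (hcard (Fin.last _))).trans hKl
  · simp only [PlanarNetwork.tropWeight]
    rw [sum_comm]
    refine sum_congr rfl fun c _ => ?_
    rw [hval]
    exact sum_congr rfl fun a _ => (tropStepMatrix_of_isEdge (hedge c a)).symm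

end DisjointPaths

/-! ### Multipaths -/

section Multipaths

variable {n k : ℕ}

/-- The sets of indices that occur in `fullMinorSum`. -/
def IsFullIndex (α : Fin k → ℕ)
    (s : (Fin (k + 1) → Finset (Fin n)) × (Fin k → Finset (Fin n))) : Prop :=
  s.1 (Fin.last k) = ∅ ∧ ∀ i : Fin k, (s.2 i).card = α i ∧ Disjoint (s.2 i) (s.1 i.succ) ∧
    (s.1 i.castSucc).card = (s.2 i).card + (s.1 i.succ).card

/-- The tropical value of a term of `fullMinorSum`. -/
def termVal (w : Fin k × EssEdge n → ℝ)
    (s : (Fin (k + 1) → Finset (Fin n)) × (Fin k → Finset (Fin n))) : Trop :=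
  ∑ i : Fin k, tropMinor (fun e => w (i, e)) ((s.1 i.castSucc).map Fin.valEmbedding)
    ((s.2 i ∪ s.1 i.succ).map Fin.valEmbedding)

open Classical in
/-- The tropical value of `fullMinorSum`. -/
def fullVal (w : Fin k × EssEdge n → ℝ) (α : Fin k → ℕ) : Trop :=
  (univ.filter fun s => IsFullIndex (n := n) α s).sup (termVal w)

lemma posTrop_term (s : (Fin (k + 1) → Finset (Fin n)) × (Fin k → Finset (Fin n))) :
    PosTrop (fun x : Fin k × EssEdge n → ℂˣ => ∏ i : Fin k,
      minor (standardChartPow x i).val.val (s.1 i.castSucc) (s.2 i ∪ s.1 i.succ))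
      (fun w => termVal w s) :=
  PosTrop.prod univ fun i _ => posTrop_minor (fun e => (i, e)) _ _

lemma posTrop_fullMinorSum (α : Fin k → ℕ) :
    PosTrop (fun x : Fin k × EssEdge n → ℂˣ => fullMinorSum α fun i => (standardChartPow x i).val)
      (fun w => fullVal w α) := by
  classical
  refine (PosTrop.sum (univ.filter fun s => IsFullIndex (n := n) α s) fun s _ =>
    posTrop_term s).congr (fun x => ?_) fun w => ?_
  · unfold fullMinorSum
    exact sum_congr (by ext; rw [mem_filter, mem_filter]; rfl) fun _ _ => rfl
  · unfold fullVal
    congr!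

/-- The weight is regrouped by copies: the copy `b` is traversed by the paths with i ≥ b. -/
lemma sum_multipath {M : Type*} [AddCommMonoid M] {α : Fin k → ℕ}
    (f : (i : Fin k) → Fin (α i) → Fin k → M) :
    ∑ i, ∑ a, ∑ b : Fin (i.val + 1), f i a (Fin.castLE i.isLt b) =
      ∑ b : Fin k, ∑ p : {p : Σ i : Fin k, Fin (α i) // (b : ℕ) ≤ p.1}, f p.1.1 p.1.2 b := by
  classical
  have h1 : ∀ i a, ∑ b : Fin (i.val + 1), f i a (Fin.castLE i.isLt b) =
      ∑ b : Fin k, if (b : ℕ) ≤ i then f i a b else 0 := by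
    intro i a
    refine Fintype.sum_of_injective _ (Fin.castLE_injective _) _ _ (fun b hb => if_neg fun h => ?_)
      fun b => (if_pos (Nat.lt_succ_iff.1 b.isLt)).symm
    exact hb ⟨⟨b, Nat.lt_succ_of_le h⟩, rfl⟩
  have h2 : ∀ b : Fin k, ∑ p : {p : Σ i : Fin k, Fin (α i) // (b : ℕ) ≤ p.1}, f p.1.1 p.1.2 b =
      ∑ p : Σ i : Fin k, Fin (α i), if (b : ℕ) ≤ p.1 then f p.1 p.2 b else 0 := by
    intro b
    refine Fintype.sum_of_injective _ Subtype.val_injective _ _ (fun p hp => if_neg fun h => ?_)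
      fun p => (if_pos p.2).symm
    exact hp ⟨⟨p, h⟩, rfl⟩
  simp only [h1, h2]
  simp only [Fintype.sum_sigma]
  rw [sum_comm (s := (univ : Finset (Fin k)))]
  exact sum_congr rfl fun i _ => sum_comm

/-- A multipath determines a term of M̃_α: L_b is the set of sources of the copy `b` used by the
paths, and J_i the set of end points of the paths stopping in the copy `i`. Disjointness gives the
conditions on sizes and intersections. -/
lemma multipath_weight_le_fullVal (w : Fin k × EssEdge n → ℝ) {α : Fin k → ℕ}
    {q : (i : Fin k) → Fin (α i) → Fin (i.val + 1) →
      Fin ((standardNetwork n).width + 1) → Fin n} (hq : (standardNetwork n).IsMultipath α q) :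
    ∑ i, ∑ a, ∑ b : Fin (i.val + 1), (standardNetwork n).tropWeight
      (tropStandardWeighting fun x => w (Fin.castLE i.isLt b, x)) (q i a b) ≤ fullVal w α := by
  classical
  let Q : (b : ℕ) → {p : Σ i : Fin k, Fin (α i) // b ≤ p.1} →
      Fin ((standardNetwork n).width + 1) → Fin n :=
    fun b p => q p.1.1 p.1.2 ⟨b, Nat.lt_succ_of_le p.2⟩
  have hinj : ∀ b c, Function.Injective fun p => Q b p c := by
    intro b c p p' h
    by_contra hne
    exact hq.disjoint p.1.1 p.1.2 p'.1.1 p'.1.2 (fun h => hne (Subtype.ext h)) _ _ rfl c h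
  let L : Fin (k + 1) → Finset (Fin n) := fun b => univ.image fun p => Q b p 0
  let J : Fin k → Finset (Fin n) := fun i =>
    univ.image fun a : Fin (α i) => q i a (Fin.last _) (Fin.last _)
  have hglue : ∀ (b : ℕ) (p : {p : Σ i : Fin k, Fin (α i) // b + 1 ≤ p.1}),
      Q b ⟨p.1, Nat.le_of_succ_le p.2⟩ (Fin.last _) = Q (b + 1) p 0 :=
    fun b p => hq.glue _ _ _ _ rfl
  have hE : ∀ i : Fin k, J i ∪ L i.succ = univ.image fun p => Q i p (Fin.last _) := by
    intro i
    ext y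
    simp only [L, J, mem_union, mem_image, mem_univ, true_and]
    constructor
    · rintro (⟨a, rfl⟩ | ⟨p, rfl⟩)
      · exact ⟨⟨⟨i, a⟩, le_rfl⟩, rfl⟩
      · exact ⟨_, hglue i p⟩
    · rintro ⟨⟨⟨i', a⟩, hp⟩, rfl⟩
      dsimp only at hp
      rcases hp.eq_or_lt with h | h
      · obtain rfl : i = i' := Fin.ext h
        exact Or.inl ⟨a, rfl⟩
      · exact Or.inr ⟨⟨⟨i', a⟩, h⟩, (hglue i ⟨⟨i', a⟩, h⟩).symm⟩
  have hJcard : ∀ i, (J i).card = α i := by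
    intro i
    rw [card_image_of_injective, card_fin]
    intro a a' h
    by_contra hne
    exact hq.disjoint i a i a' (fun h => hne (by simpa using h)) _ _ rfl _ h
  have hdisj : ∀ i : Fin k, Disjoint (J i) (L i.succ) := by
    intro i
    rw [disjoint_left]
    intro y hy hy'
    simp only [L, J, mem_image, mem_univ, true_and] at hy hy'
    obtain ⟨a, rfl⟩ := hy
    obtain ⟨p, hp⟩ := hy'
    have h1 := (hglue i p).trans hp
    have h2 : (⟨p.1, Nat.le_of_succ_le p.2⟩ : {p : Σ i : Fin k, Fin (α i) // (i : ℕ) ≤ p.1}) =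
        ⟨⟨i, a⟩, le_rfl⟩ := hinj i (Fin.last _) h1
    have h3 : p.1.1 = i := congrArg (fun p => p.1.1) h2
    have h4 := p.2
    rw [h3] at h4
    exact absurd h4 (by simp)
  have hidx : IsFullIndex α (L, J) := by
    refine ⟨?_, fun i => ⟨hJcard i, hdisj i, ?_⟩⟩
    · refine image_eq_empty.2 (univ_eq_empty_iff.2 ⟨fun p => ?_⟩)
      have h1 : k ≤ (p.1.1 : ℕ) := p.2
      have h2 := p.1.1.isLt
      omega
    · change (L i.castSucc).card = (J i).card + (L i.succ).card
      rw [← card_union_of_disjoint (hdisj i), hE, card_image_of_injective _ (hinj _ _),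
        card_image_of_injective _ (hinj _ _)]
  refine le_trans ?_ (le_sup (f := termVal w) (mem_filter.2 ⟨mem_univ _, hidx⟩))
  let f : (i : Fin k) → Fin (α i) → Fin k → Trop := fun i a b =>
    if h : (b : ℕ) ≤ i then (standardNetwork n).tropWeight
      (tropStandardWeighting fun x => w (b, x)) (q i a ⟨b, Nat.lt_succ_of_le h⟩) else 0
  have hf : ∀ (i : Fin k) (a : Fin (α i)) (b : Fin (i.val + 1)), (standardNetwork n).tropWeight
      (tropStandardWeighting fun x => w (Fin.castLE i.isLt b, x)) (q i a b) =
      f i a (Fin.castLE i.isLt b) :=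
    fun i a b => by
      simp only [f]
      rw [dif_pos (by simpa using Nat.lt_succ_iff.1 b.isLt)]
      rfl
  simp only [hf]
  rw [sum_multipath]
  refine sum_le_sum fun b _ => ?_
  have h1 := sum_tropWeight_le_tropMinor (fun x => w (b, x)) (Q b)
    (fun p => hq.isPath _ _ _) (hinj b)
  rw [← hE] at h1
  refine le_trans (le_of_eq ?_) h1
  exact sum_congr rfl fun p _ => dif_pos p.2

/-! ### Multipaths from families of disjoint paths in the copies of a network -/

section Trace

variable {V C : Type*} (P : ℕ → V → C → V) (c₀ : C)

/-- The part in the copy `b` of the path that ends at `y` in the copy `b + d`. -/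
def tracePath : ℕ → ℕ → V → C → V
  | b, 0, y => P b y
  | b, d + 1, y => P b (tracePath (b + 1) d y c₀)

variable {P c₀} [DecidableEq V] {c₁ : C} {J L : ℕ → Finset V}

lemma tracePath_start (hstart : ∀ b, ∀ y ∈ J b ∪ L (b + 1), P b y c₀ ∈ L b) {b d : ℕ} {y : V}
    (hy : y ∈ J (b + d)) : tracePath P c₀ b d y c₀ ∈ L b := by
  induction d generalizing b with
  | zero => exact hstart b y (mem_union_left _ hy)
  | succ d ih =>
    refine hstart b _ (mem_union_right _ (ih ?_))
    rwa [add_right_comm]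

lemma exists_tracePath_eq (hstart : ∀ b, ∀ y ∈ J b ∪ L (b + 1), P b y c₀ ∈ L b) {b d : ℕ} {y : V}
    (hy : y ∈ J (b + d)) : ∃ z ∈ J b ∪ L (b + 1), tracePath P c₀ b d y = P b z := by
  cases d with
  | zero => exact ⟨y, mem_union_left _ hy, rfl⟩
  | succ d =>
    refine ⟨_, mem_union_right _ (tracePath_start hstart ?_), rfl⟩
    rwa [add_right_comm]

/-- Pieces that meet in a copy have the same end point. If both paths continue, they already meet in
the next copy; if only one does, its end point lies in `L` and the other's in `J`, which are
disjoint. -/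
lemma tracePath_disjoint (hstart : ∀ b, ∀ y ∈ J b ∪ L (b + 1), P b y c₀ ∈ L b)
    (hJL : ∀ b, Disjoint (J b) (L (b + 1)))
    (hdisj : ∀ b, ∀ y ∈ J b ∪ L (b + 1), ∀ y' ∈ J b ∪ L (b + 1), y ≠ y' →
      ∀ c, P b y c ≠ P b y' c) {b d d' : ℕ} {y y' : V} (hy : y ∈ J (b + d)) (hy' : y' ∈ J (b + d'))
    (hne : d ≠ d' ∨ y ≠ y') (c : C) :
    tracePath P c₀ b d y c ≠ tracePath P c₀ b d' y' c := by
  induction d generalizing b d' c with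
  | zero =>
    cases d' with
    | zero =>
      exact hdisj b _ (mem_union_left _ hy) _ (mem_union_left _ hy') (by simpa using hne) c
    | succ d' =>
      have h1 : tracePath P c₀ (b + 1) d' y' c₀ ∈ L (b + 1) :=
        tracePath_start hstart (by rwa [add_right_comm])
      exact hdisj b _ (mem_union_left _ hy) _ (mem_union_right _ h1)
        (fun h => disjoint_left.1 (hJL b) hy (h ▸ h1)) c
  | succ d ih =>
    have h1 : tracePath P c₀ (b + 1) d y c₀ ∈ L (b + 1) :=
      tracePath_start hstart (by rwa [add_right_comm])
    cases d' with
    | zero =>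
      exact hdisj b _ (mem_union_right _ h1) _ (mem_union_left _ hy')
        (fun h => disjoint_left.1 (hJL b) hy' (h ▸ h1)) c
    | succ d' =>
      have h2 : tracePath P c₀ (b + 1) d' y' c₀ ∈ L (b + 1) :=
        tracePath_start hstart (by rwa [add_right_comm])
      refine hdisj b _ (mem_union_right _ h1) _ (mem_union_right _ h2) ?_ c
      exact ih (by rwa [add_right_comm]) (by rwa [add_right_comm])
        (hne.imp_left fun h h' => h (by omega)) c₀

/-- Following a piece forward, an end point in `L` is the start of a piece in the next copy. Since
`L` is eventually empty, the path stops in some `J`; so tracing back from all of `J` uses every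
piece. -/
lemma exists_tracePath (hsurj : ∀ b, ∀ x ∈ L b, ∃ y ∈ J b ∪ L (b + 1), P b y c₀ = x) {k : ℕ}
    (hL : ∀ b, k ≤ b → L b = ∅) {b : ℕ} {z : V} (hz : z ∈ J b ∪ L (b + 1)) :
    ∃ d y, y ∈ J (b + d) ∧ tracePath P c₀ b d y = P b z := by
  obtain ⟨m, hm⟩ : ∃ m, k ≤ b + 1 + m := ⟨k, by omega⟩
  induction m generalizing b z with
  | zero =>
    rw [hL _ hm, union_empty] at hz
    exact ⟨0, z, hz, rfl⟩
  | succ m ih =>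
    rcases mem_union.1 hz with h | h
    · exact ⟨0, z, h, rfl⟩
    · obtain ⟨z', hz', rfl⟩ := hsurj _ _ h
      obtain ⟨d, y, hy, h1⟩ := ih hz' (by omega)
      exact ⟨d + 1, y, by rwa [add_right_comm] at hy, by rw [tracePath, h1]⟩

end Trace

lemma exists_pathFamily_of_tropMinor_ne_bot (w : EssEdge n → ℝ) (I J : Finset (Fin n))
    (h : tropMinor w (I.map Fin.valEmbedding) (J.map Fin.valEmbedding) ≠ ⊥) :
    ∃ P : Fin n → Fin ((standardNetwork n).width + 1) → Fin n,
      (∀ y ∈ J, (standardNetwork n).IsPath (P y)) ∧ (∀ y ∈ J, P y (Fin.last _) = y) ∧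
      (∀ y ∈ J, ∀ y' ∈ J, y ≠ y' → ∀ c, P y c ≠ P y' c) ∧ J.image (fun y => P y 0) = I ∧
      ∑ y ∈ J, (standardNetwork n).tropWeight (tropStandardWeighting w) (P y) =
        tropMinor w (I.map Fin.valEmbedding) (J.map Fin.valEmbedding) := by
  classical
  obtain ⟨m, p, hp, hd, hI, hJ, hw⟩ := exists_paths_of_tropMinor_ne_bot w I J h
  -- The paths are indexed by their end points, so that pieces in consecutive copies can be glued;
  -- outside `J` the value is irrelevant.
  let P := Function.extend (fun a => p a (Fin.last _)) p fun y _ => y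
  have hP : ∀ a, P (p a (Fin.last _)) = p a := fun a => (hd (Fin.last _)).extend_apply p _ a
  refine ⟨P, ?_, ?_, ?_, ?_, ?_⟩
  · intro y hy
    rw [← hJ] at hy
    obtain ⟨a, -, rfl⟩ := mem_image.1 hy
    rw [hP]
    exact hp a
  · intro y hy
    rw [← hJ] at hy
    obtain ⟨a, -, rfl⟩ := mem_image.1 hy
    simp only [hP]
  · intro y hy y' hy' hne c
    rw [← hJ] at hy hy'
    obtain ⟨a, -, rfl⟩ := mem_image.1 hy
    obtain ⟨a', -, rfl⟩ := mem_image.1 hy'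
    simp only [hP]
    intro hc
    exact hne (by rw [hd c hc])
  · rw [← hJ, image_image, ← hI]
    exact image_congr fun a _ => by simp only [Function.comp, hP]
  · rw [← hw, ← hJ, sum_image fun a _ a' _ h => hd _ h]
    simp only [hP]

/-- Each factor is realized by an optimal disjoint family in its copy. The sinks in L_i are exactly
the sources of the next family, so the families glue to a multipath of the same total weight. -/
lemma termVal_le_maxWeight (w : Fin k × EssEdge n → ℝ) {α : Fin k → ℕ}
    {s : (Fin (k + 1) → Finset (Fin n)) × (Fin k → Finset (Fin n))} (hs : IsFullIndex α s) :
    termVal w s ≤ (standardNetwork n).maxWeight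
      (fun i => tropStandardWeighting fun x => w (i, x)) α := by
  classical
  by_cases hbot : termVal w s = ⊥
  · rw [hbot]
    exact bot_le
  obtain ⟨h0, hs⟩ := hs
  choose P hpath hlast hdisj himage hweight using fun i : Fin k =>
    exists_pathFamily_of_tropMinor_ne_bot _ _ _ (sum_ne_bot_apply hbot i (mem_univ i))
  -- Extension to all natural copy numbers, with empty sets and dummy paths beyond `k`, so that the
  -- tracing recursion needs no bounds.
  let Q : ℕ → Fin n → Fin ((standardNetwork n).width + 1) → Fin n := fun b =>
    if h : b < k then P ⟨b, h⟩ else fun y _ => y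
  let J : ℕ → Finset (Fin n) := fun b => if h : b < k then s.2 ⟨b, h⟩ else ∅
  let L : ℕ → Finset (Fin n) := fun b => if h : b < k + 1 then s.1 ⟨b, h⟩ else ∅
  have hQ : ∀ b : Fin k, Q b = P b := fun b => dif_pos b.isLt
  have hJ : ∀ b : Fin k, J b = s.2 b := fun b => dif_pos b.isLt
  have hL : ∀ b : Fin k, L b = s.1 b.castSucc := fun b => dif_pos b.castSucc.isLt
  have hL' : ∀ b : Fin k, L (b + 1) = s.1 b.succ := fun b => dif_pos b.succ.isLt
  have hJ0 : ∀ b, k ≤ b → J b = ∅ := fun b hb => dif_neg (not_lt.2 hb)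
  have hL0 : ∀ b, k ≤ b → L b = ∅ := by
    intro b hb
    rcases hb.eq_or_lt with rfl | hb
    · exact (dif_pos (Nat.lt_succ_self _)).trans h0
    · exact dif_neg (by omega)
  have hlt : ∀ {b y}, y ∈ J b ∪ L (b + 1) → b < k := by
    intro b y hy
    by_contra hb
    rw [hJ0 b (by omega), hL0 _ (by omega)] at hy
    simp at hy
  have hE : ∀ b : Fin k, J b ∪ L (b + 1) = s.2 b ∪ s.1 b.succ := fun b => by rw [hJ, hL']
  have hstart : ∀ b, ∀ y ∈ J b ∪ L (b + 1), Q b y 0 ∈ L b := by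
    intro b y hy
    obtain ⟨b, rfl⟩ : ∃ i : Fin k, (i : ℕ) = b := ⟨⟨b, hlt hy⟩, rfl⟩
    rw [hE] at hy
    rw [hQ, hL, ← himage b]
    exact mem_image_of_mem _ hy
  have hsurj : ∀ b, ∀ x ∈ L b, ∃ y ∈ J b ∪ L (b + 1), Q b y 0 = x := by
    intro b x hx
    have hb : b < k := by
      by_contra hb
      rw [hL0 _ (by omega)] at hx
      simp at hx
    obtain ⟨b, rfl⟩ : ∃ i : Fin k, (i : ℕ) = b := ⟨⟨b, hb⟩, rfl⟩
    rw [hL, ← himage b] at hx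
    rw [hE, hQ]
    exact mem_image.1 hx
  have hJL : ∀ b, Disjoint (J b) (L (b + 1)) := by
    intro b
    by_cases hb : b < k
    · obtain ⟨b, rfl⟩ : ∃ i : Fin k, (i : ℕ) = b := ⟨⟨b, hb⟩, rfl⟩
      rw [hJ, hL']
      exact (hs b).2.1
    · rw [hJ0 b (by omega)]
      exact disjoint_empty_left _
  have hQdisj : ∀ b, ∀ y ∈ J b ∪ L (b + 1), ∀ y' ∈ J b ∪ L (b + 1), y ≠ y' →
      ∀ c, Q b y c ≠ Q b y' c := by
    intro b y hy y' hy'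
    obtain ⟨b, rfl⟩ : ∃ i : Fin k, (i : ℕ) = b := ⟨⟨b, hlt hy⟩, rfl⟩
    rw [hE] at hy hy'
    rw [hQ]
    exact hdisj b y hy y' hy'
  have hQlast : ∀ b, ∀ y ∈ J b ∪ L (b + 1), Q b y (Fin.last _) = y := by
    intro b y hy
    obtain ⟨b, rfl⟩ : ∃ i : Fin k, (i : ℕ) = b := ⟨⟨b, hlt hy⟩, rfl⟩
    rw [hE] at hy
    rw [hQ]
    exact hlast b y hy
  have hQpath : ∀ b, ∀ y ∈ J b ∪ L (b + 1), (standardNetwork n).IsPath (Q b y) := by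
    intro b y hy
    obtain ⟨b, rfl⟩ : ∃ i : Fin k, (i : ℕ) = b := ⟨⟨b, hlt hy⟩, rfl⟩
    rw [hE] at hy
    rw [hQ]
    exact hpath b y hy
  let e : (i : Fin k) → Fin (α i) → Fin n := fun i => (s.2 i).orderEmbOfFin (hs i).1
  have he : ∀ (i : Fin k) (a : Fin (α i)), e i a ∈ J i := fun i a => by
    rw [hJ]
    exact orderEmbOfFin_mem _ _ a
  have he' : ∀ (i : Fin k) (a) (b : ℕ), b ≤ i → e i a ∈ J (b + (i - b)) := fun i a b hb => by
    rw [Nat.add_sub_of_le hb]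
    exact he i a
  let q : (i : Fin k) → Fin (α i) → ℕ → Fin ((standardNetwork n).width + 1) → Fin n :=
    fun i a b => tracePath Q 0 b (i - b) (e i a)
  have hqdisj : ∀ (i : Fin k) (a : Fin (α i)) (i' : Fin k) (a' : Fin (α i')),
      (⟨i, a⟩ : Σ i : Fin k, Fin (α i)) ≠ ⟨i', a'⟩ → ∀ b : ℕ, b ≤ i → b ≤ i' → ∀ c, q i a b c ≠ q i' a' b c := by
    intro i a i' a' hne b hb hb' c
    refine tracePath_disjoint hstart hJL hQdisj (he' i a b hb) (he' i' a' b hb') ?_ c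
    by_contra hcon
    push Not at hcon
    obtain rfl : i = i' := Fin.ext (by omega)
    exact hne (by rw [((s.2 i).orderEmbOfFin (hs i).1).injective hcon.2])
  have hq : (standardNetwork n).IsMultipath α fun i a b => q i a b := by
    refine ⟨fun i a b => ?_, fun i a b b' hb => ?_, fun i a i' a' hne b b' hb c => ?_⟩
    · obtain ⟨z, hz, h⟩ := exists_tracePath_eq hstart (he' i a b (Nat.lt_succ_iff.1 b.isLt))
      simp only [q, h]
      exact hQpath _ _ hz
    · have hb' := b'.isLt
      obtain ⟨d, hd⟩ : ∃ d, (i : ℕ) - b = d + 1 := ⟨i - b - 1, by omega⟩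
      have hd' : (i : ℕ) - b' = d := by omega
      have hmem := he' i a b' (by omega)
      simp only [q, hd, hd', tracePath]
      rw [hd'] at hmem
      rw [hb] at hmem ⊢
      exact hQlast _ _ (mem_union_right _ (tracePath_start hstart hmem))
    · have h1 := b.isLt
      have h2 := b'.isLt
      simp only [hb]
      exact hqdisj i a i' a' hne b' (by omega) (by omega) c
  refine le_trans (le_of_eq ?_) (le_sup (f := fun q => _) (mem_filter.2 ⟨mem_univ _, hq⟩))
  refine Eq.trans ?_ (sum_multipath fun i a b => (standardNetwork n).tropWeight
    (tropStandardWeighting fun x => w (b, x)) (q i a b)).symm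
  refine sum_congr rfl fun b _ => ?_
  rw [← hweight b]
  symm
  -- In a fixed copy the pieces of the multipath correspond bijectively to their end points.
  refine sum_bij (fun p _ => q p.1.1 p.1.2 b (Fin.last _)) ?_ ?_ ?_ ?_
  · intro p _
    obtain ⟨z, hz, h⟩ := exists_tracePath_eq hstart (he' p.1.1 p.1.2 b p.2)
    rw [← hE]
    simp only [q, h]
    rwa [hQlast _ _ hz]
  · intro p _ p' _ h
    by_contra hne
    exact hqdisj _ _ _ _ (fun h => hne (Subtype.ext h)) b p.2 p'.2 _ h
  · intro z hz
    rw [← hE] at hz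
    obtain ⟨d, y, hy, h⟩ := exists_tracePath hsurj hL0 hz
    have hlt' : (b : ℕ) + d < k := hlt (mem_union_left _ hy)
    have hy' : y ∈ s.2 ⟨b + d, hlt'⟩ := by
      have := hJ ⟨b + d, hlt'⟩
      rwa [← this]
    obtain ⟨a, ha⟩ : ∃ a, e ⟨b + d, hlt'⟩ a = y := by
      have : y ∈ Set.range (e ⟨b + d, hlt'⟩) := by
        simp only [e, range_orderEmbOfFin]
        exact hy'
      exact this
    refine ⟨⟨⟨⟨b + d, hlt'⟩, a⟩, Nat.le_add_right _ _⟩, mem_univ _, ?_⟩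
    simp only [q, ha, Nat.add_sub_cancel_left, h]
    exact hQlast _ _ hz
  · intro p _
    obtain ⟨z, hz, h⟩ := exists_tracePath_eq hstart (he' p.1.1 p.1.2 b p.2)
    simp only [q, h]
    rw [hQlast _ _ hz, hQ]

lemma maxWeight_eq_fullVal (w : Fin k × EssEdge n → ℝ) (α : Fin k → ℕ) :
    (standardNetwork n).maxWeight (fun i => tropStandardWeighting fun x => w (i, x)) α =
      fullVal w α := by
  classical
  refine le_antisymm (Finset.sup_le fun q hq => ?_) (Finset.sup_le fun s hs => ?_)
  · exact multipath_weight_le_fullVal w (mem_filter.1 hq).2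
  · exact termVal_le_maxWeight w (mem_filter.1 hs).2

end Multipaths

/-! ### The expansion of multi-corner minors -/

section MultiCorner

/-! ### Elimination of unit columns from a minor -/

section UnitColumns

variable {ι κ : Type*} [LinearOrder ι] [LinearOrder κ]

lemma minor_of_column_eq_zero (A : Matrix ι κ ℂ) {I : Finset ι} {J : Finset κ} {j : κ} (hj : j ∈ J)
    (h : ∀ x ∈ I, A x j = 0) : minor A I J = 0 := by
  by_cases hJ : J.card = I.card
  swap
  · exact minor_of_card_ne A hJ
  rw [minor_eq_det A rfl hJ]
  obtain ⟨p, hp⟩ : j ∈ Set.range (J.orderEmbOfFin hJ) := by rwa [range_orderEmbOfFin]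
  refine Matrix.det_eq_zero_of_column_eq_zero p fun x => ?_
  rw [Matrix.submatrix_apply, hp]
  exact h _ (orderEmbOfFin_mem I rfl x)

lemma orderEmbOfFin_erase_min {I : Finset ι} {i : ι} (hi : i ∈ I) (hmin : ∀ x ∈ I, i ≤ x) {m : ℕ}
    (hm : I.card = m + 1) (hm' : (I.erase i).card = m) :
    I.orderEmbOfFin hm 0 = i ∧
      ∀ x : Fin m, I.orderEmbOfFin hm x.succ = (I.erase i).orderEmbOfFin hm' x := by
  have h0 : I.orderEmbOfFin hm 0 = i := by
    have h := orderEmbOfFin_zero hm (Nat.succ_pos m)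
    exact h.trans (le_antisymm (min'_le _ _ hi) (le_min' _ _ _ hmin))
  refine ⟨h0, fun x => ?_⟩
  refine congrFun (orderEmbOfFin_unique hm' (f := fun x => I.orderEmbOfFin hm x.succ)
    (fun x => mem_erase.2 ⟨?_, orderEmbOfFin_mem _ _ _⟩)
    fun x y hxy => (I.orderEmbOfFin hm).strictMono (Fin.succ_lt_succ_iff.2 hxy)) x
  rw [← h0]
  exact fun h => Fin.succ_ne_zero x ((I.orderEmbOfFin hm).injective h)

/-- Laplace expansion along a column with a single nonzero entry; it stands in the upper left
corner, so there is no sign. -/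
lemma minor_erase_min (A : Matrix ι κ ℂ) {I : Finset ι} {J : Finset κ} {i : ι} {j : κ} (hi : i ∈ I)
    (hmini : ∀ x ∈ I, i ≤ x) (hj : j ∈ J) (hminj : ∀ y ∈ J, j ≤ y)
    (hone : A i j = 1) (hzero : ∀ x ∈ I, x ≠ i → A x j = 0) :
    minor A I J = minor A (I.erase i) (J.erase j) := by
  have hIc := card_erase_add_one hi
  have hJc := card_erase_add_one hj
  by_cases hJ : J.card = I.card
  swap
  · rw [minor_of_card_ne A hJ, minor_of_card_ne]
    omega
  have hJ' : (J.erase j).card = (I.erase i).card := by omega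
  rw [minor_eq_det A rfl hJ', minor_eq_det A hIc.symm (hJ.trans hIc.symm)]
  obtain ⟨hi0, hi1⟩ := orderEmbOfFin_erase_min hi hmini hIc.symm rfl
  obtain ⟨hj0, hj1⟩ := orderEmbOfFin_erase_min hj hminj (hJ.trans hIc.symm) hJ'
  rw [Matrix.det_succ_column_zero, Fin.sum_univ_succ, sum_eq_zero fun x _ => ?_]
  · simp only [Matrix.submatrix_apply, hi0, hj0, hone]
    simp only [Fin.val_zero, pow_zero, one_mul, add_zero]
    congr 1
    ext x y
    simp [hi1, hj1]
  · rw [Matrix.submatrix_apply, hj0, hi1]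
    have h := orderEmbOfFin_mem (I.erase i) rfl x
    rw [hzero _ (mem_of_mem_erase h) (ne_of_mem_erase h)]
    simp

lemma minor_unit_columns (A : Matrix ι κ ℂ) {c : ι → κ} (hc : StrictMono c)
    (hone : ∀ x, A x (c x) = 1) (hzero : ∀ x y, x ≠ y → A x (c y) = 0) {J : Finset κ}
    (hJ : ∀ x, ∀ y ∈ J, c x < y) {I S : Finset ι} (hS : S ⊆ I)
    (hmin : ∀ x ∈ S, ∀ y ∈ I, y ∉ S → x < y) :
    minor A I (S.image c ∪ J) = minor A (I \ S) J := by
  induction S using Finset.induction_on_min generalizing I with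
  | empty => simp
  | insert a S ha ih =>
    have haS : a ∉ S := fun h => lt_irrefl _ (ha a h)
    have haI : a ∈ I := hS (mem_insert_self _ _)
    have hca : c a ∉ S.image c ∪ J := by
      rw [mem_union, mem_image]
      rintro (⟨x, hx, h⟩ | h)
      · exact haS (hc.injective h ▸ hx)
      · exact lt_irrefl _ (hJ a _ h)
    have hS' : S ⊆ I.erase a := fun x hx =>
      mem_erase.2 ⟨fun h => haS (h ▸ hx), hS (mem_insert_of_mem hx)⟩
    rw [image_insert, insert_union, minor_erase_min A haI (fun x hx => ?_) (mem_insert_self _ _)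
      (fun y hy => ?_) (hone a) (fun x _ hx => hzero x a hx), erase_insert hca,
      ih hS']
    · congr 1
      ext x
      simp only [mem_sdiff, mem_erase, mem_insert]
      tauto
    · intro x hx y hy hyS
      refine hmin x (mem_insert_of_mem hx) y (mem_of_mem_erase hy) fun h => ?_
      exact (mem_insert.1 h).elim (ne_of_mem_erase hy) hyS
    · by_cases hxS : x ∈ insert a S
      · rcases mem_insert.1 hxS with rfl | h
        · exact le_rfl
        · exact (ha x h).le
      · exact (hmin a (mem_insert_self _ _) x hx hxS).le
    · rcases mem_insert.1 hy with rfl | hy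
      · exact le_rfl
      rcases mem_union.1 hy with hy | hy
      · obtain ⟨x, hx, rfl⟩ := mem_image.1 hy
        exact hc.monotone (ha x hx).le
      · exact (hJ a y hy).le

end UnitColumns

/-! ### The block matrix and its minors -/

variable {n k : ℕ}

/-- The first `β b` columns of the block `b`, for all `b`. -/
def blockColumns (n : ℕ) {k : ℕ} (β : Fin k → ℕ) : Finset (Fin k ×ₗ Fin n) :=
  univ.filter fun x => ((ofLex x).2 : ℕ) < β (ofLex x).1

lemma mem_blockColumns {β : Fin k → ℕ} {b : Fin k} {c : Fin n} :
    toLex (b, c) ∈ blockColumns n β ↔ (c : ℕ) < β b := by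
  simp [blockColumns]

/-- The shift of the blocks by one. -/
def blockSucc (n k : ℕ) : (Fin k ×ₗ Fin n) ↪o (Fin (k + 1) ×ₗ Fin n) :=
  OrderEmbedding.ofMapLEIff (fun x => toLex ((ofLex x).1.succ, (ofLex x).2)) fun x y => by
    simp [Prod.Lex.le_iff]

lemma blockColumns_cons_zero (α : Fin k → ℕ) :
    blockColumns n (Fin.cons 0 α : Fin (k + 1) → ℕ) =
      (blockColumns n α).map (blockSucc n k).toEmbedding := by
  ext x
  obtain ⟨⟨b, c⟩, rfl⟩ := toLex.surjective x
  rw [mem_blockColumns, mem_map]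
  constructor
  · intro h
    rcases Fin.eq_zero_or_eq_succ b with rfl | ⟨b, rfl⟩
    · simp at h
    · exact ⟨toLex (b, c), mem_blockColumns.2 (by simpa using h), rfl⟩
  · rintro ⟨y, hy, h⟩
    obtain ⟨⟨b', c'⟩, rfl⟩ := toLex.surjective y
    rw [mem_blockColumns] at hy
    have h' : (b'.succ, c') = (b, c) := toLex.injective h
    obtain ⟨rfl, rfl⟩ := Prod.mk.inj h'
    simpa using hy

lemma blockColumns_cons (m : ℕ) (α : Fin k → ℕ) :
    blockColumns n (Fin.cons m α : Fin (k + 1) → ℕ) =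
      (initial n m).image (fun c => toLex (0, c)) ∪ blockColumns n (Fin.cons 0 α : Fin (k + 1) → ℕ) := by
  ext x
  obtain ⟨⟨b, c⟩, rfl⟩ := toLex.surjective x
  rw [mem_union, mem_blockColumns, mem_blockColumns, mem_image]
  rcases Fin.eq_zero_or_eq_succ b with rfl | ⟨b, rfl⟩
  · simp [initial]
  · have : ∀ c', toLex ((0 : Fin (k + 1)), c') ≠ toLex (b.succ, c) := fun c' h =>
      Fin.succ_ne_zero b (Prod.mk.inj (toLex.injective h)).1.symm
    simp [this]

lemma blockRow_zero (g : Fin k → GL (Fin n) ℂ) (r c : Fin n) :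
    blockRow g r (toLex (0, c)) = (1 : Matrix (Fin n) (Fin n) ℂ) r c := by
  simp [blockRow]

lemma blockRow_succ (g : Fin (k + 1) → GL (Fin n) ℂ) :
    (blockRow g).submatrix id (blockSucc n (k + 1)) =
      (g 0).val * blockRow fun i => g i.succ := by
  ext r x
  simp [blockRow, blockSucc, List.ofFn_succ, Matrix.mul_apply]

lemma minor_blockRow_cons (g : Fin k → GL (Fin n) ℂ) (α : Fin k → ℕ) (m : ℕ) (I : Finset (Fin n)) :
    minor (blockRow g) I (blockColumns n (Fin.cons m α : Fin (k + 1) → ℕ)) =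
      if initial n m ⊆ I then
        minor (blockRow g) (I \ initial n m) (blockColumns n (Fin.cons 0 α : Fin (k + 1) → ℕ))
      else 0 := by
  rw [blockColumns_cons]
  split_ifs with h
  · refine minor_unit_columns _ ?_ ?_ ?_ ?_ h ?_
    · intro x y hxy
      simpa [Prod.Lex.lt_iff] using hxy
    · intro x
      rw [blockRow_zero, Matrix.one_apply_eq]
    · intro x y hxy
      rw [blockRow_zero, Matrix.one_apply_ne hxy]
    · intro x y hy
      obtain ⟨⟨b, c⟩, rfl⟩ := toLex.surjective y
      rw [mem_blockColumns] at hy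
      rcases Fin.eq_zero_or_eq_succ b with rfl | ⟨b, rfl⟩
      · simp at hy
      · rw [Prod.Lex.lt_iff]
        exact Or.inl (Fin.succ_pos b)
    · intro x hx y _ hy
      simp only [initial, mem_filter, mem_univ, true_and] at hx hy
      rw [Fin.lt_def]
      omega
  · obtain ⟨y, hy, hyI⟩ := not_subset.1 h
    refine minor_of_column_eq_zero _ (mem_union_left _ (mem_image_of_mem _ hy)) fun x hx => ?_
    rw [blockRow_zero, Matrix.one_apply_ne]
    rintro rfl
    exact hyI hx

/-- The substitution E = S ⊔ L. It converts the intermediate sets of Cauchy–Binet that contain an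
initial segment into the sets L_i disjoint from it. -/
lemma sum_subset_eq_sum_disjoint {ι M : Type*} [Fintype ι] [DecidableEq ι] [AddCommMonoid M]
    (S : Finset ι) (f : Finset ι → Finset ι → M) :
    ∑ E : Finset ι, (if S ⊆ E then f E (E \ S) else 0) =
      ∑ L : Finset ι, if Disjoint S L then f (S ∪ L) L else 0 := by
  rw [← sum_filter, ← sum_filter]
  refine sum_nbij' (fun E => E \ S) (fun L => S ∪ L) ?_ ?_ ?_ ?_ ?_
  · intro E _
    simp [disjoint_sdiff]
  · intro L _
    simp [subset_union_left]
  · intro E hE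
    simpa using hE
  · intro L hL
    simp only [mem_filter, mem_univ, true_and] at hL
    exact union_sdiff_cancel_left hL
  · intro E hE
    simp only [mem_filter, mem_univ, true_and] at hE
    rw [union_sdiff_of_subset hE]

/-- Without its first block, the matrix is g_0 times the block matrix of the remaining factors.
Cauchy–Binet splits off g_0, and the unit block of the remaining matrix strikes out the initial α_0
rows; induction does the rest. -/
lemma minor_blockRow_eq_sum : ∀ {k : ℕ} (g : Fin k → GL (Fin n) ℂ) (α : Fin k → ℕ)
    (I : Finset (Fin n)),
    minor (blockRow g) I (blockColumns n (Fin.cons 0 α : Fin (k + 1) → ℕ)) =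
      ∑ L : Fin (k + 1) → Finset (Fin n),
        if L 0 = I ∧ L (Fin.last k) = ∅ ∧ ∀ i : Fin k, Disjoint (initial n (α i)) (L i.succ) then
          ∏ i : Fin k, minor (g i).val (L i.castSucc) (initial n (α i) ∪ L i.succ)
        else 0
  | 0, g, α, I => by
    have h0 : blockColumns n (Fin.cons 0 α : Fin 1 → ℕ) = ∅ := by
      rw [blockColumns_cons_zero]
      simp [blockColumns]
    rw [h0, ← (Equiv.funUnique (Fin 1) (Finset (Fin n))).symm.sum_comp]
    simp only [Equiv.funUnique_symm_apply, uniqueElim_const, prod_of_isEmpty]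
    by_cases hI : I = ∅
    · subst hI
      rw [minor_empty]
      simp
    · rw [minor_of_card_ne _ (by simpa [eq_comm] using hI)]
      refine (sum_eq_zero fun L _ => if_neg ?_).symm
      rintro ⟨rfl, h, -⟩
      exact hI h
  | k + 1, g, α, I => by
    obtain ⟨a, α, rfl⟩ : ∃ a α', α = Fin.cons a α' := ⟨_, _, (Fin.cons_self_tail α).symm⟩
    rw [blockColumns_cons_zero, ← minor_submatrix_map, blockRow_succ, minor_mul]
    have hcons : ∀ E : Finset (Fin n), minor (blockRow fun i => g i.succ) E
        (blockColumns n (Fin.cons a α : Fin (k + 1) → ℕ)) = _ := minor_blockRow_cons _ _ _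
    simp only [hcons, mul_ite, mul_zero]
    rw [sum_subset_eq_sum_disjoint (initial n a) fun E L => minor (g 0).val I E *
      minor (blockRow fun i => g i.succ) L (blockColumns n (Fin.cons 0 α : Fin (k + 1) → ℕ))]
    simp only [minor_blockRow_eq_sum (fun i => g i.succ) α, mul_sum]
    rw [← (Fin.consEquiv fun _ => Finset (Fin n)).sum_comp, Fintype.sum_prod_type]
    refine Eq.trans ?_ (sum_eq_single I ?_ (by simp)).symm
    swap
    · intro I' _ hI'
      refine sum_eq_zero fun L _ => if_neg fun h => hI' ?_
      simpa [Fin.consEquiv] using h.1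
    have hite : ∀ (p : Prop) [Decidable p] (f : (Fin (k + 1) → Finset (Fin n)) → ℂ),
        (if p then ∑ L, f L else 0) = ∑ L, if p then f L else 0 := by
      intro p _ f
      split_ifs <;> simp
    simp only [hite]
    rw [sum_comm]
    refine sum_congr rfl fun L _ => ?_
    rw [sum_eq_single (L 0) (fun L' _ h => ?_) (by simp)]
    · by_cases hd : Disjoint (initial n a) (L 0)
      · simp [Fin.consEquiv, Fin.forall_fin_succ, Fin.prod_univ_succ, hd]
      · simp [Fin.consEquiv, Fin.forall_fin_succ, hd]
    · simp [h.symm]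

lemma multiCorner_eq_sum (α : Fin k → ℕ) (g : Fin k → GL (Fin n) ℂ) :
    multiCorner α g =
      ∑ L : Fin (k + 1) → Finset (Fin n),
        if L 0 = univ \ initial n (n - ∑ i, α i) ∧ L (Fin.last k) = ∅ ∧
          ∀ i : Fin k, Disjoint (initial n (α i)) (L i.succ) then
          ∏ i : Fin k, minor (g i).val (L i.castSucc) (initial n (α i) ∪ L i.succ)
        else 0 := by
  refine (minor_blockRow_cons g α (n - ∑ i, α i) univ).trans ?_
  rw [if_pos (subset_univ _), minor_blockRow_eq_sum]

end MultiCorner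

/-! ### Tropical multi-corner minors -/

section Comparison

variable {n k : ℕ}

/-- The sets of indices that occur in the expansion of a multi-corner minor. -/
def IsCornerIndex (α : Fin k → ℕ) (L : Fin (k + 1) → Finset (Fin n)) : Prop :=
  IsFullIndex α (L, fun i => initial n (α i)) ∧ L 0 = univ \ initial n (n - ∑ i, α i)

open Classical in
/-- The tropical value of a multi-corner minor. -/
def cornerVal (w : Fin k × EssEdge n → ℝ) (α : Fin k → ℕ) : Trop :=
  (univ.filter fun L => IsCornerIndex (n := n) α L).sup fun L =>
    termVal w (L, fun i => initial n (α i))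

lemma card_initial {i : ℕ} (hi : i ≤ n) : (initial n i).card = i := by
  rw [← card_map Fin.valEmbedding, map_initial hi, card_range]

/-- The size conditions of `IsCornerIndex` can be added to the expansion because minors of
non-square shape vanish. -/
lemma posTrop_multiCorner {α : Fin k → ℕ} (hα : ∑ i, α i ≤ n) :
    PosTrop (fun x : Fin k × EssEdge n → ℂˣ => multiCorner α fun i => (standardChartPow x i).val)
      (fun w => cornerVal w α) := by
  classical
  refine (PosTrop.sum (univ.filter fun L => IsCornerIndex (n := n) α L) fun L _ =>
    posTrop_term (L, fun i => initial n (α i))).congr (fun x => ?_) fun w => ?_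
  · rw [multiCorner_eq_sum, ← sum_filter]
    have hle : ∀ i, α i ≤ n := fun i =>
      (single_le_sum (f := α) (fun _ _ => Nat.zero_le _) (mem_univ i)).trans hα
    symm
    refine sum_subset (fun L hL => ?_) fun L hL hL' => ?_
    · obtain ⟨⟨h1, h2⟩, h3⟩ := (mem_filter.1 hL).2
      exact mem_filter.2 ⟨mem_univ _, h3, h1, fun i => (h2 i).2.1⟩
    · obtain ⟨-, h3, h1, h2⟩ := mem_filter.1 hL
      by_contra hne
      refine hL' (mem_filter.2 ⟨mem_univ _, ⟨h1, fun i => ⟨card_initial (hle i), h2 i, ?_⟩⟩, h3⟩)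
      rw [← card_union_of_disjoint (h2 i)]
      by_contra hcard
      exact hne (prod_eq_zero (mem_univ i) (minor_of_card_ne _ fun h => hcard h.symm))
  · unfold cornerVal
    congr!

lemma cornerVal_le_fullVal (w : Fin k × EssEdge n → ℝ) (α : Fin k → ℕ) :
    cornerVal w α ≤ fullVal w α := by
  classical
  refine Finset.sup_le fun L hL => ?_
  exact le_sup (f := termVal w) (mem_filter.2 ⟨mem_univ _, (mem_filter.1 hL).2.1⟩)

/-! ### The sizes of the index sets -/

lemma sum_eq_of_recursion : ∀ {k : ℕ} {α : Fin k → ℕ} {c : Fin (k + 1) → ℕ},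
    c (Fin.last k) = 0 → (∀ i : Fin k, c i.castSucc = α i + c i.succ) → c 0 = ∑ i, α i
  | 0, _, _, h0, _ => h0
  | k + 1, α, c, h0, h => by
    rw [Fin.sum_univ_succ, ← sum_eq_of_recursion (c := fun i => c i.succ) h0 fun i => h i.succ]
    exact h 0

lemma IsFullIndex.card_zero {α : Fin k → ℕ}
    {s : (Fin (k + 1) → Finset (Fin n)) × (Fin k → Finset (Fin n))} (hs : IsFullIndex α s) :
    (s.1 0).card = ∑ i, α i :=
  sum_eq_of_recursion (c := fun i => (s.1 i).card) (card_eq_zero.2 hs.1) fun i => by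
    rw [(hs.2 i).2.2, (hs.2 i).1]

lemma IsFullIndex.card_eq {α : Fin k → ℕ}
    {s s' : (Fin (k + 1) → Finset (Fin n)) × (Fin k → Finset (Fin n))} (hs : IsFullIndex α s)
    (hs' : IsFullIndex α s') (i : Fin (k + 1)) : (s.1 i).card = (s'.1 i).card := by
  induction i using Fin.reverseInduction with
  | last => rw [hs.1, hs'.1]
  | cast i ih => rw [(hs.2 i).2.2, (hs.2 i).1, (hs'.2 i).2.2, (hs'.2 i).1, ih]

lemma IsFullIndex.card_union {α : Fin k → ℕ}
    {s : (Fin (k + 1) → Finset (Fin n)) × (Fin k → Finset (Fin n))} (hs : IsFullIndex α s)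
    (i : Fin k) : (s.2 i ∪ s.1 i.succ).card = (s.1 i.castSucc).card := by
  rw [card_union_of_disjoint (hs.2 i).2.1, (hs.2 i).2.2]

/-! ### Top parts of finite sets -/

/-- `T` consists of the largest elements of `E`. -/
def IsTopPart {ι : Type*} [LinearOrder ι] (T E : Finset ι) : Prop :=
  T ⊆ E ∧ ∀ y ∈ E, y ∉ T → ∀ x ∈ T, y < x

lemma exists_isTopPart {ι : Type*} [LinearOrder ι] (E : Finset ι) {m : ℕ} (hm : m ≤ E.card) :
    ∃ T, IsTopPart T E ∧ T.card = m := by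
  induction m with
  | zero => exact ⟨∅, ⟨empty_subset _, by simp⟩, rfl⟩
  | succ m ih =>
    obtain ⟨T, ⟨hTE, hT⟩, hc⟩ := ih (by omega)
    have hne : (E \ T).Nonempty := by
      rw [← card_pos, card_sdiff_of_subset hTE]
      omega
    have ha := (E \ T).max'_mem hne
    have hmax := fun y hy => (E \ T).le_max' y hy
    set a := (E \ T).max' hne
    rw [mem_sdiff] at ha
    refine ⟨insert a T, ⟨insert_subset ha.1 hTE, fun y hy hyT x hx => ?_⟩, ?_⟩
    · rw [mem_insert, not_or] at hyT
      rcases mem_insert.1 hx with rfl | hx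
      · exact lt_of_le_of_ne (hmax y (mem_sdiff.2 ⟨hy, hyT.2⟩)) hyT.1
      · exact hT y hy hyT.2 x hx
    · rw [card_insert_of_notMem ha.2, hc]

lemma IsTopPart.map {T E : Finset (Fin n)} (h : IsTopPart T E) :
    IsTopPart (T.map Fin.valEmbedding) (E.map Fin.valEmbedding) := by
  refine ⟨map_subset_map.2 h.1, fun y hy hyT x hx => ?_⟩
  obtain ⟨y, hy', rfl⟩ := mem_map.1 hy
  obtain ⟨x, hx', rfl⟩ := mem_map.1 hx
  exact h.2 y hy' (fun h' => hyT (mem_map_of_mem _ h')) x hx'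

/-- As soon as some element of `T` is below `x`, all elements of `E` from `x` on belong to `T`.
Hence the top part dominates every subset of its size. -/
lemma IsTopPart.card_filter_le {T E L : Finset ℕ} (h : IsTopPart T E) (hL : L ⊆ E)
    (hc : L.card = T.card) (x : ℕ) : (L.filter (x ≤ ·)).card ≤ (T.filter (x ≤ ·)).card := by
  by_cases hx : ∀ t ∈ T, x ≤ t
  · rw [filter_true_of_mem hx, ← hc]
    exact Finset.card_filter_le _ _
  · push Not at hx
    obtain ⟨t, ht, htx⟩ := hx
    refine card_le_card fun y hy => ?_
    rw [mem_filter] at hy ⊢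
    refine ⟨?_, hy.2⟩
    by_contra hyT
    have := h.2 y (hL hy.1) hyT t ht
    omega

lemma IsTopPart.sdiff_card_le {T E : Finset ℕ} (h : IsTopPart T E) {x : ℕ} (hx : x ∈ T) :
    (E \ T).card ≤ x := by
  rw [← card_range x]
  refine card_le_card fun y hy => ?_
  rw [mem_sdiff] at hy
  exact mem_range.2 (h.2 y hy.1 hy.2 x hx)

lemma card_filter_range_le (S : Finset ℕ) (x : ℕ) :
    ((range S.card).filter (x ≤ ·)).card ≤ (S.filter (x ≤ ·)).card := by
  have h1 : (range S.card).filter (x ≤ ·) = Ico x S.card := by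
    ext y
    simp only [mem_filter, mem_range, mem_Ico]
    omega
  have h2 : (S.filter fun y => ¬ x ≤ y).card ≤ x := by
    refine (card_le_card (t := range x) fun y hy => ?_).trans (card_range x).le
    rw [mem_filter] at hy
    exact mem_range.2 (not_le.1 hy.2)
  have h3 := card_filter_add_card_filter_not (s := S) (x ≤ ·)
  rw [h1, Nat.card_Ico]
  omega

/-- Pushing the elements outside the top part down to an initial segment can only lower the set in
the dominance order. -/
lemma IsTopPart.card_filter_range_union_le {T E : Finset ℕ} (h : IsTopPart T E) (x : ℕ) :
    ((range (E \ T).card ∪ T).filter (x ≤ ·)).card ≤ (E.filter (x ≤ ·)).card := by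
  have h1 := card_filter_range_le (E \ T) x
  have h2 : (E.filter (x ≤ ·)).card =
      ((E \ T).filter (x ≤ ·)).card + (T.filter (x ≤ ·)).card := by
    rw [← card_union_of_disjoint (disjoint_filter_filter sdiff_disjoint), ← filter_union,
      sdiff_union_of_subset h.1]
  have h3 := card_union_le ((range (E \ T).card).filter (x ≤ ·)) (T.filter (x ≤ ·))
  rw [filter_union]
  omega

/-! ### Comparison of the tropical values -/

/-- The comparison term is chosen in all factors at once: the same replacement of L_i raises the
rows of the next factor and, with J_i pushed down, lowers the columns of this one. Both changes
increase tropical minors when the potential is nonpositive. -/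
lemma termVal_le_cornerVal {w : Fin k × EssEdge n → ℝ}
    (hw : ∀ i, PotentialNonpos fun e => w (i, e)) {α : Fin k → ℕ} (hα : ∑ i, α i ≤ n)
    {s : (Fin (k + 1) → Finset (Fin n)) × (Fin k → Finset (Fin n))} (hs : IsFullIndex α s) :
    termVal w s ≤ cornerVal w α := by
  classical
  have hle : ∀ i, α i ≤ n := fun i =>
    (single_le_sum (f := α) (fun _ _ => Nat.zero_le _) (mem_univ i)).trans hα
  choose T hT hTc using fun i : Fin k => exists_isTopPart (s.2 i ∪ s.1 i.succ)
    (card_le_card (subset_union_right (s₁ := s.2 i) (s₂ := s.1 i.succ)))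
  let L : Fin (k + 1) → Finset (Fin n) := Fin.cons (univ \ initial n (n - ∑ i, α i)) T
  have hL0 : L 0 = univ \ initial n (n - ∑ i, α i) := rfl
  have hLs : ∀ i : Fin k, L i.succ = T i := fun i => rfl
  have hcard : ∀ i, (L i).card = (s.1 i).card := by
    intro i
    rcases Fin.eq_zero_or_eq_succ i with rfl | ⟨i, rfl⟩
    · rw [hL0, card_sdiff_of_subset (subset_univ _), card_fin, card_initial (Nat.sub_le _ _),
        hs.card_zero]
      omega
    · rw [hLs, hTc]
  have hdiff : ∀ i, ((s.2 i ∪ s.1 i.succ) \ T i).card = α i := by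
    intro i
    rw [card_sdiff_of_subset (hT i).1, hTc, card_union_of_disjoint (hs.2 i).2.1, (hs.2 i).1]
    omega
  have hdiff' : ∀ i, ((s.2 i ∪ s.1 i.succ).map Fin.valEmbedding \
      (T i).map Fin.valEmbedding).card = α i := by
    intro i
    rw [← Finset.map_sdiff, card_map, hdiff]
  -- Each element of the top part exceeds the α_i elements left out, hence lies outside the initial
  -- segment of length α_i.
  have hdisj : ∀ i : Fin k, Disjoint (initial n (α i)) (L i.succ) := by
    intro i
    rw [disjoint_left]
    intro x hx hxT
    have h1 := (hT i).map.sdiff_card_le (mem_map_of_mem Fin.valEmbedding hxT)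
    rw [hdiff'] at h1
    simp only [initial, mem_filter, mem_univ, true_and] at hx
    simp only [Fin.valEmbedding_apply] at h1
    omega
  have hidx : IsCornerIndex α L := by
    refine ⟨⟨?_, fun i => ⟨card_initial (hle i), hdisj i, ?_⟩⟩, hL0⟩
    · rw [← card_eq_zero, hcard, hs.1, card_empty]
    · simp only [hcard, card_initial (hle i)]
      rw [(hs.2 i).2.2, (hs.2 i).1]
  have htop : ∀ i, ∃ E, s.1 i ⊆ E ∧ IsTopPart (L i) E := by
    intro i
    rcases Fin.eq_zero_or_eq_succ i with rfl | ⟨i, rfl⟩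
    · refine ⟨univ, subset_univ _, subset_univ _, fun y _ hy x hx => ?_⟩
      simp only [hL0, initial, mem_sdiff, mem_univ, true_and, mem_filter, not_not] at hx hy
      rw [Fin.lt_def]
      omega
    · exact ⟨_, subset_union_right, hT i⟩
  refine le_trans ?_ (le_sup (f := fun L => termVal w (L, fun i => initial n (α i)))
    (mem_filter.2 ⟨mem_univ _, hidx⟩))
  refine sum_le_sum fun i _ => ?_
  have hlt : ∀ S : Finset (Fin n), ∀ x ∈ S.map Fin.valEmbedding, x < n := by
    intro S x hx
    obtain ⟨x, -, rfl⟩ := mem_map.1 hx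
    exact x.isLt
  obtain ⟨E, hsE, hLE⟩ := htop i.castSucc
  -- First the rows are raised to the top part, with the columns unchanged; then the columns are
  -- lowered.
  refine ((hw i).mono_left _ (reflTransGen_stepUp (hlt (L i.castSucc)) ?_ fun x => ?_)).trans
    ((hw i).mono_right _ (reflTransGen_stepUp (hlt _) ?_ fun x => ?_))
  · rw [card_map, card_map, hcard]
  · refine hLE.map.card_filter_le (map_subset_map.2 hsE) ?_ x
    rw [card_map, card_map, hcard]
  · rw [card_map, card_map, hs.card_union, hidx.1.card_union i, hcard]
  · have h := (hT i).map.card_filter_range_union_le x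
    rw [hdiff', ← map_initial (hle i), ← map_union] at h
    exact h

lemma fullVal_le_cornerVal {w : Fin k × EssEdge n → ℝ}
    (hw : ∀ i, PotentialNonpos fun e => w (i, e)) {α : Fin k → ℕ} (hα : ∑ i, α i ≤ n) :
    fullVal w α ≤ cornerVal w α := by
  classical
  exact Finset.sup_le fun _ hs => termVal_le_cornerVal hw hα (mem_filter.1 hs).2

/-! ### The converse: isolating one factor -/

lemma map_univ_sdiff_initial {m : ℕ} :
    (univ \ initial n (n - m)).map Fin.valEmbedding = Ico (n - m) n := by
  rw [Finset.map_sdiff, map_initial (Nat.sub_le _ _)]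
  ext x
  simp only [mem_sdiff, mem_map, mem_univ, true_and, Fin.valEmbedding_apply, mem_range, mem_Ico]
  constructor
  · rintro ⟨⟨a, rfl⟩, h⟩
    have := a.isLt
    omega
  · rintro ⟨h1, h2⟩
    exact ⟨⟨⟨x, h2⟩, rfl⟩, by omega⟩

/-- For the `α` chosen here, every factor other than the j-th has full or empty index sets and
contributes the same finite constant to all terms. The j-th factor ranges over minors of size `m` in
M̃_α, but only over the corner minor in M_α. -/
lemma tropMinor_le_corner {w : Fin k × EssEdge n → ℝ}
    (hw : ∀ α : Fin k → ℕ, ∑ i, α i ≤ n → cornerVal w α = fullVal w α) (j : Fin k)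
    {m : ℕ} {I J : Finset (Fin n)} (hI : I.card = m) (hJ : J.card = m) :
    tropMinor (fun e => w (j, e)) (I.map Fin.valEmbedding) (J.map Fin.valEmbedding) ≤
      tropMinor (fun e => w (j, e)) (Ico (n - m) n) (range m) := by
  classical
  have hm : m ≤ n := by rw [← hI]; exact card_finset_fin_le I
  -- The n - m paths stopping in the copy j - 1 free exactly the complement of `I`, so that
  -- arbitrary rows `I` can enter the factor `j`. For j = 0 there is no such copy, and `I` is the
  -- set L_0 itself.
  let α : Fin k → ℕ := fun i => if i = j then m else if (i : ℕ) + 1 = j then n - m else 0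
  let s : (Fin (k + 1) → Finset (Fin n)) × (Fin k → Finset (Fin n)) :=
    (fun i => if (i : ℕ) < j then univ else if (i : ℕ) = j then I else ∅,
      fun i => if i = j then J else if (i : ℕ) + 1 = j then Iᶜ else ∅)
  have hs : IsFullIndex α s := by
    refine ⟨?_, fun i => ?_⟩
    · have := j.isLt
      simp only [s, Fin.val_last]
      rw [if_neg (by omega), if_neg (by omega)]
    · simp only [s, α, Fin.val_castSucc, Fin.val_succ, Fin.ext_iff]
      rcases lt_trichotomy (i : ℕ) j with h | h | h
      · rw [if_pos h, if_neg h.ne, if_neg h.ne]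
        by_cases h' : (i : ℕ) + 1 = j
        · rw [if_pos h', if_pos h', if_neg (by omega), if_pos h', card_compl, card_univ,
            Fintype.card_fin, hI]
          exact ⟨rfl, disjoint_compl_left, by omega⟩
        · rw [if_neg h', if_neg h', if_pos (by omega)]
          simp
      · simp [h, hI, hJ]
      · have h1 : ¬(i : ℕ) < j := by omega
        have h2 : (i : ℕ) ≠ j := by omega
        have h3 : (i : ℕ) + 1 ≠ j := by omega
        have h4 : ¬(i : ℕ) + 1 < j := by omega
        simp [h1, h2, h3, h4]
  have hα : ∑ i, α i ≤ n := by
    rw [← hs.card_zero]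
    exact card_finset_fin_le _
  have hsj : s.1 j.castSucc = I := by simp [s]
  have hsj' : s.1 j.succ = ∅ := by simp [s]
  have hsJ : s.2 j = J := by simp [s]
  have hαj : α j = m := by simp [α]
  have hext : ∀ i : Fin k, i ≠ j → s.1 i.castSucc = univ ∨ s.1 i.castSucc = ∅ := by
    intro i hi
    have hi' : (i : ℕ) ≠ j := fun h => hi (Fin.ext h)
    simp only [s, Fin.val_castSucc, if_neg hi']
    split_ifs <;> simp
  let c : Fin k → Trop := fun i => tropMinor (fun e => w (i, e))
    ((s.1 i.castSucc).map Fin.valEmbedding) ((s.1 i.castSucc).map Fin.valEmbedding)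
  have hc : ∀ i, i ≠ j → c i ≠ ⊥ := by
    intro i hi
    rcases hext i hi with h | h
    · have := tropMinor_corner_ne_bot (n := n) (fun e => w (i, e)) le_rfl
      rw [← map_initial le_rfl, ← map_univ_sdiff_initial] at this
      have h1 : univ \ initial n (n - n) = univ := by
        ext x; simp [initial]
      have h2 : initial n n = univ := by
        ext x; simp [initial]
      rw [h1, h2] at this
      simpa only [c, h] using this
    · have := tropMinor_corner_ne_bot (n := n) (fun e => w (i, e)) (Nat.zero_le n)
      simpa [c, h] using this
  have hunion : ∀ s' : (Fin (k + 1) → Finset (Fin n)) × (Fin k → Finset (Fin n)),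
      IsFullIndex α s' → ∀ i : Fin k, i ≠ j → s'.1 i.castSucc = s.1 i.castSucc ∧
        s'.2 i ∪ s'.1 i.succ = s.1 i.castSucc := by
    intro s' hs' i hi
    have h1 := hs'.card_eq hs i.castSucc
    have h2 := hs'.card_union i
    rw [h1] at h2
    rcases hext i hi with h | h <;> rw [h] at h1 h2 ⊢
    · exact ⟨(card_eq_iff_eq_univ _).1 (by simpa using h1),
        (card_eq_iff_eq_univ _).1 (by simpa using h2)⟩
    · exact ⟨card_eq_zero.1 h1, card_eq_zero.1 h2⟩
  have hterm : ∀ s' : (Fin (k + 1) → Finset (Fin n)) × (Fin k → Finset (Fin n)),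
      IsFullIndex α s' → termVal w s' = tropMinor (fun e => w (j, e))
        ((s'.1 j.castSucc).map Fin.valEmbedding) ((s'.2 j ∪ s'.1 j.succ).map Fin.valEmbedding) +
        ∑ i ∈ univ.erase j, c i := by
    intro s' hs'
    rw [termVal, ← add_sum_erase univ _ (mem_univ j)]
    congr 1
    refine sum_congr rfl fun i hi => ?_
    obtain ⟨h1, h2⟩ := hunion s' hs' i (ne_of_mem_erase hi)
    simp only [h1, h2, c]
  have hfin : ∑ i ∈ univ.erase j, c i ≠ ⊥ := by
    rw [Ne, WithBot.sum_eq_bot_iff]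
    rintro ⟨i, hi, h⟩
    exact hc i (ne_of_mem_erase hi) h
  have hcorner : ∀ L : Fin (k + 1) → Finset (Fin n), IsCornerIndex α L →
      L j.castSucc = univ \ initial n (n - m) ∧ initial n (α j) ∪ L j.succ = initial n m := by
    rintro L ⟨hL, hL0⟩
    have h1 : (L j.castSucc).card = m := (hL.card_eq hs j.castSucc).trans (by rw [hsj, hI])
    have h2 : L j.succ = ∅ := card_eq_zero.1 ((hL.card_eq hs j.succ).trans (by rw [hsj', card_empty]))
    refine ⟨?_, by rw [h2, union_empty, hαj]⟩
    have hcard : (univ \ initial n (n - m)).card = m := by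
      rw [card_sdiff_of_subset (subset_univ _), card_fin, card_initial (Nat.sub_le _ _)]
      omega
    refine eq_of_subset_of_card_le ?_ (by rw [hcard, h1])
    -- For j = 0 the rows are prescribed by the block of the unit matrix; otherwise they avoid the
    -- first n - m indices, taken by the preceding factor, and their number leaves no choice.
    rcases Nat.eq_zero_or_pos (j : ℕ) with hj | hj
    · have h0 : j.castSucc = 0 := Fin.ext hj
      have h3 := hs.card_zero
      rw [← h0, hsj, hI] at h3
      rw [h0, hL0, h3]
    · have hj' : (j : ℕ) - 1 < k := by omega
      have h3 := (hL.2 ⟨j - 1, hj'⟩).2.1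
      have h4 : (⟨j - 1, hj'⟩ : Fin k).succ = j.castSucc := Fin.ext (by simp; omega)
      have h5 : α ⟨j - 1, hj'⟩ = n - m := by
        simp only [α]
        rw [if_neg (fun h => by have := congrArg Fin.val h; simp only at this; omega),
          if_pos (by omega)]
      simp only [h4, h5] at h3
      exact fun x hx => mem_sdiff.2 ⟨mem_univ _, fun h => disjoint_left.1 h3 h hx⟩
  have hle : termVal w s ≤ cornerVal w α := by
    rw [hw α hα]
    exact le_sup (f := termVal w) (mem_filter.2 ⟨mem_univ _, hs⟩)
  have hle' : cornerVal w α ≤ tropMinor (fun e => w (j, e)) (Ico (n - m) n) (range m) +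
      ∑ i ∈ univ.erase j, c i := by
    refine Finset.sup_le fun L hL => ?_
    have hL := (mem_filter.1 hL).2
    rw [hterm _ hL.1]
    simp only [hcorner L hL, map_univ_sdiff_initial, map_initial hm]
    exact le_rfl
  rw [hterm s hs, hsj, hsj', hsJ, union_empty] at hle
  exact (WithBot.add_le_add_iff_right hfin).1 (hle.trans hle')

/-- The numerators of the potential are minors of the same size as their denominators, so maximality
of the corner minors suffices. -/
lemma potentialNonpos_of_forall_eq {w : Fin k × EssEdge n → ℝ}
    (hw : ∀ α : Fin k → ℕ, ∑ i, α i ≤ n → cornerVal w α = fullVal w α) (j : Fin k) :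
    PotentialNonpos fun e => w (j, e) := by
  have key : ∀ (m : ℕ) (I J : Finset ℕ), (∀ x ∈ I, x < n) → (∀ x ∈ J, x < n) → I.card = m →
      J.card = m → tropMinor (fun e => w (j, e)) I J ≤
        tropMinor (fun e => w (j, e)) (Ico (n - m) n) (range m) := by
    intro m I J hI hJ hIc hJc
    have h := tropMinor_le_corner hw j (I := I.attachFin hI) (J := J.attachFin hJ)
      (by rw [card_attachFin, hIc]) (by rw [card_attachFin, hJc])
    rwa [map_valEmbedding_attachFin, map_valEmbedding_attachFin] at h
  constructor
  · intro u hu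
    have h := key (n - 1 - u) ({u} ∪ Ico (u + 2) n) (range (n - 1 - u)) (fun x hx => ?_)
      (fun x hx => ?_) ?_ (card_range _)
    · rwa [show n - (n - 1 - u) = u + 1 by omega] at h
    · simp only [mem_union, mem_singleton, mem_Ico] at hx
      omega
    · rw [mem_range] at hx
      omega
    · rw [card_union_of_disjoint (by simp), card_singleton, Nat.card_Ico]
      omega
  · intro b hb
    have h := key (b + 1) (Ico (n - 1 - b) n) (insert (b + 1) (range b)) (fun x hx => ?_)
      (fun x hx => ?_) ?_ ?_
    · rwa [show n - (b + 1) = n - 1 - b by omega] at h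
    · rw [mem_Ico] at hx
      omega
    · simp only [mem_insert, mem_range] at hx
      omega
    · rw [Nat.card_Ico]
      omega
    · rw [card_insert_of_notMem (by simp), card_range]

end Comparison

end BKGZ

end

/-! ### The main theorem -/

theorem mainTheorem9 (n k : ℕ) :
    -- all functions involved are positive with respect to the chart `θ_st × ⋯ × θ_st` on `B₋^k`
    (∀ α : Fin k → ℕ, ∑ i, α i ≤ n →
      BKGZ.IsPositive (BKGZ.standardChartPow (n := n) (k := k))
        (fun b => BKGZ.multiCorner α fun i => (b i).val)) ∧
    (∀ α : Fin k → ℕ, ∑ i, α i ≤ n →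
      BKGZ.IsPositive (BKGZ.standardChartPow (n := n) (k := k))
        (fun b => BKGZ.fullMinorSum α fun i => (b i).val)) ∧
    (∀ i : Fin k, BKGZ.IsPositive (BKGZ.standardChartPow (n := n) (k := k))
        (fun b => BKGZ.potential (b i).val)) ∧
    ∀ w : Fin k × BKGZ.EssEdge n → ℝ,
      -- `M̃_α^t = m_α`
      (∀ α : Fin k → ℕ, ∑ i, α i ≤ n →
        BKGZ.tropicalization BKGZ.standardChartPow
            (fun b => BKGZ.fullMinorSum α fun i => (b i).val) w =
          (BKGZ.standardNetwork n).maxWeight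
            (fun i => BKGZ.tropStandardWeighting fun x => w (i, x)) α) ∧
      -- `M_α^t = M̃_α^t` for all `α` if and only if `(Φ_BK ∘ pr_i)^t ≤ 0` for all `i`
      ((∀ α : Fin k → ℕ, ∑ i, α i ≤ n →
          BKGZ.tropicalization BKGZ.standardChartPow
              (fun b => BKGZ.multiCorner α fun i => (b i).val) w =
            BKGZ.tropicalization BKGZ.standardChartPow
              (fun b => BKGZ.fullMinorSum α fun i => (b i).val) w) ↔
        ∀ i : Fin k,
          BKGZ.tropicalization BKGZ.standardChartPow
            (fun b => BKGZ.potential (b i).val) w ≤ 0) := by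
  have hM := fun (α : Fin k → ℕ) hα => BKGZ.posTrop_multiCorner (n := n) (α := α) hα
  have hF := fun α : Fin k → ℕ => BKGZ.posTrop_fullMinorSum (n := n) α
  choose τ hP hτ using fun i : Fin k =>
    BKGZ.exists_posTrop_potential (n := n) fun e => (i, e)
  refine ⟨fun α hα => (hM α hα).isPositive, fun α _ => (hF α).isPositive,
    fun i => (hP i).isPositive, fun w => ⟨fun α _ => ?_, ?_⟩⟩
  · rw [BKGZ.maxWeight_eq_fullVal]
    exact (hF α).tropicalization_eq w
  · have hpot : ∀ i : Fin k, BKGZ.tropicalization BKGZ.standardChartPow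
        (fun b : Fin k → BKGZ.BMinus n => BKGZ.potential (b i).val) w = τ i w :=
      fun i => (hP i).tropicalization_eq w
    simp only [hpot, hτ]
    have hiff : ∀ α : Fin k → ℕ, ∑ i, α i ≤ n →
        (BKGZ.tropicalization BKGZ.standardChartPow
            (fun b : Fin k → BKGZ.BMinus n => BKGZ.multiCorner α fun i => (b i).val) w =
          BKGZ.tropicalization BKGZ.standardChartPow
            (fun b : Fin k → BKGZ.BMinus n => BKGZ.fullMinorSum α fun i => (b i).val) w ↔
          BKGZ.cornerVal w α = BKGZ.fullVal w α) := fun α hα =>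
      Eq.congr ((hM α hα).tropicalization_eq w) ((hF α).tropicalization_eq w)
    exact ⟨fun h => BKGZ.potentialNonpos_of_forall_eq fun α hα => (hiff α hα).1 (h α hα),
      fun h α hα => (hiff α hα).2
        (le_antisymm (BKGZ.cornerVal_le_fullVal w α) (BKGZ.fullVal_le_cornerVal h hα))⟩
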